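/- Let $k$ be a field, $V$ a $k$-vector space of finite dimension $d$, and let $S$ be the completion of $\mathrm{Sym}^*(V)$ at the kernel of the augmentation $\mathrm{Sym}^*(V)\to k$, $V\mapsto 0$ (so $S$ is non-canonically a power series ring over $k$ in $d$ variables). View $k$ as an $S$-module through the augmentation, fix a K-projective resolution $P\to k$ over $S$, and let $E=\mathrm{RHom}_S(k,k)$ be the dg algebra $\mathrm{End}_S(P)$. Let $D(S)$ be the derived category of $S$-modules and $D_{perf}(S)\subset D(S)$ the smallest triangulated subcategory that contains $S$ and is closed under retracts. Let $D(E)$ be the derived category of right dg $E$-modules and $D_{coh}(E)\subset D(E)$ the full subcategory of objects whose total cohomology is finite-dimensional over $k$. Let $k\in D(E)$ denote the distinguished object, that is, a right dg $E$-module whose cohomology is $k$ concentrated in degree $0$. Then there is a K-projective right dg $E$-module $\kappa$ whose cohomology is $k$ concentrated in degree $0$, and for every such $\kappa$ the following holds. Consider the $S$-linear dg functors $$F=\mathrm{RHom}_S(k,-)=\mathrm{Hom}_S(P,-),\qquad G=\mathrm{RHom}_E(k,-)[d]\otimes_k\wedge^dV=\mathrm{Hom}_E(\kappa,-)[d]\otimes_k\wedge^d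 V$$ between complexes of $S$-modules and right dg $E$-modules. 1. $F$ sends perfect complexes to coherent dg modules, and $G$ sends coherent dg modules to perfect complexes. 2. (Equivalence of dg categories.) There are dg natural transformations $\mathrm{id}\to GF$ and $\mathrm{id}\to FG$, the first of which is a quasi-isomorphism on every perfect complex, and the second on every coherent dg module. 3. (Equivalence of homotopy categories.) $F$ and $G$ induce functors $D(S)\to D(E)$ and $D(E)\to D(S)$ on derived categories, and these restrict to mutually inverse equivalences $D_{perf}(S)\simeq D_{coh}(E)$. -/

import Mathlib

open CategoryTheory

universe u v w v' w' v'' w''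

namespace BGG

noncomputable section

/-! ### Differential graded categories, functors and natural transformations -/

/-- A dg category over `R`, given as an ordinary category together with a dg enhancement:
complexes of morphisms `hom X Y` with a composition satisfying the Leibniz rule, such that the
ordinary morphisms are exactly the closed elements of degree `0`.  Composition is written in
diagrammatic order, `comp f g` is "first `f`, then `g`", that is `g ∘ f`; this is why the sign
in the Leibniz rule is governed by the degree of `g`. -/
class DGCategory (R : Type u) [CommRing R] (C : Type w) [Category.{v} C] where
  hom : C → C → CochainComplex (ModuleCat.{u} R) ℤ
  comp {X Y Z : C} {p q n : ℤ} (h : p + q = n) :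
    (hom X Y).X p →ₗ[R] (hom Y Z).X q →ₗ[R] (hom X Z).X n
  ofHom {X Y : C} (f : X ⟶ Y) : (hom X Y).X 0
  d_ofHom {X Y : C} (f : X ⟶ Y) : (hom X Y).d 0 1 (ofHom f) = 0
  existsUnique_ofHom {X Y : C} (z : (hom X Y).X 0) (hz : (hom X Y).d 0 1 z = 0) :
    ∃! f : X ⟶ Y, ofHom f = z
  ofHom_comp {X Y Z : C} (f : X ⟶ Y) (g : Y ⟶ Z) :
    ofHom (f ≫ g) = comp (add_zero 0) (ofHom f) (ofHom g)
  id_comp {X Y : C} {n : ℤ} (f : (hom X Y).X n) : comp (zero_add n) (ofHom (𝟙 X)) f = f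
  comp_id {X Y : C} {n : ℤ} (f : (hom X Y).X n) : comp (add_zero n) f (ofHom (𝟙 Y)) = f
  assoc {X Y Z T : C} {p q r a b n : ℤ} (hpq : p + q = a) (hqr : q + r = b)
    (har : a + r = n) (hpb : p + b = n)
    (f : (hom X Y).X p) (g : (hom Y Z).X q) (l : (hom Z T).X r) :
    comp har (comp hpq f g) l = comp hpb f (comp hqr g l)
  d_comp {X Y Z : C} {p p' q q' n n' : ℤ} (h : p + q = n) (hp : p + 1 = p') (hq : q + 1 = q')
    (hn : n + 1 = n') (h₁ : p + q' = n') (h₂ : p' + q = n')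
    (f : (hom X Y).X p) (g : (hom Y Z).X q) :
    (hom X Z).d n n' (comp h f g) =
      comp h₁ f ((hom Y Z).d q q' g) + q.negOnePow • comp h₂ ((hom X Y).d p p' f) g

/-- The complex of morphisms `X ⟶ Y` in a dg category over `R`. -/
abbrev dgHom (R : Type u) [CommRing R] {C : Type w} [Category.{v} C] [DGCategory R C] (X Y : C) :
    CochainComplex (ModuleCat.{u} R) ℤ :=
  DGCategory.hom X Y

/-- A dg functor: an ordinary functor together with a compatible action on the complexes of
morphisms. -/
structure DGFunctor (R : Type u) [CommRing R] (C : Type w) [Category.{v} C] [DGCategory R C]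
    (D : Type w') [Category.{v'} D] [DGCategory R D] extends C ⥤ D where
  mapHom {X Y : C} (n : ℤ) :
    (dgHom R X Y).X n →ₗ[R] (dgHom R (obj X) (obj Y)).X n
  mapHom_d {X Y : C} {n n' : ℤ} (hn : n + 1 = n') (z : (dgHom R X Y).X n) :
    mapHom n' ((dgHom R X Y).d n n' z) =
      (dgHom R (obj X) (obj Y)).d n n' (mapHom n z)
  mapHom_ofHom {X Y : C} (f : X ⟶ Y) :
    mapHom 0 (DGCategory.ofHom (R := R) f) = DGCategory.ofHom (R := R) (map f)
  mapHom_comp {X Y Z : C} {p q n : ℤ} (h : p + q = n)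
    (f : (dgHom R X Y).X p) (g : (dgHom R Y Z).X q) :
    mapHom n (DGCategory.comp h f g) = DGCategory.comp h (mapHom p f) (mapHom q g)

namespace DGFunctor

variable {R : Type u} [CommRing R] {C : Type w} [Category.{v} C] [DGCategory R C]
  {D : Type w'} [Category.{v'} D] [DGCategory R D]
  {D' : Type w''} [Category.{v''} D'] [DGCategory R D']

variable (R C) in
/-- The identity dg functor. -/
def id : DGFunctor R C C where
  toFunctor := 𝟭 C
  mapHom _ := LinearMap.id
  mapHom_d _ _ := rfl
  mapHom_ofHom _ := rfl
  mapHom_comp _ _ _ := rfl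

/-- The composite of two dg functors, first `F` and then `G`. -/
def comp (F : DGFunctor R C D) (G : DGFunctor R D D') : DGFunctor R C D' where
  toFunctor := F.toFunctor ⋙ G.toFunctor
  mapHom n := (G.mapHom n).comp (F.mapHom n)
  mapHom_d hn z := by
    simp [F.mapHom_d hn, G.mapHom_d hn]
  mapHom_ofHom f := by
    simp [F.mapHom_ofHom, G.mapHom_ofHom]
  mapHom_comp h f g := by
    simp [F.mapHom_comp, G.mapHom_comp]

/-- A natural transformation between dg functors is a dg natural transformation (closed, of
degree `0`) if it is natural with respect to morphisms of all degrees. -/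
def IsDGNatural {F G : DGFunctor R C D} (τ : F.toFunctor ⟶ G.toFunctor) : Prop :=
  ∀ ⦃X Y : C⦄ (n : ℤ) (z : (dgHom R X Y).X n),
    DGCategory.comp (zero_add n) (DGCategory.ofHom (τ.app X)) (G.mapHom n z) =
      DGCategory.comp (add_zero n) (F.mapHom n z) (DGCategory.ofHom (τ.app Y))

end DGFunctor

/-! ### The dg category of complexes of `R`-modules -/

section Complexes

open CochainComplex.HomComplex

variable {R : Type u} [CommRing R]

/-- The complex of `R`-modules `Hom_R(M, N)`. -/
def homComplex (M N : CochainComplex (ModuleCat.{u} R) ℤ) :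
    CochainComplex (ModuleCat.{u} R) ℤ where
  X n := ModuleCat.of R (Cochain M N n)
  d n m := ModuleCat.ofHom (δ_hom R M N n m)
  shape n m h := by
    exact ModuleCat.hom_ext (LinearMap.ext fun z => δ_shape n m h z)
  d_comp_d' n m l _ _ := by
    exact ModuleCat.hom_ext (LinearMap.ext fun z => δ_δ n m l z)

instance : DGCategory R (CochainComplex (ModuleCat.{u} R) ℤ) where
  hom := homComplex
  comp h := LinearMap.mk₂ R (fun f g => Cochain.comp f g h)
    (fun _ _ _ => Cochain.add_comp _ _ _ h) (fun _ _ _ => Cochain.smul_comp _ _ _ h)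
    (fun _ _ _ => Cochain.comp_add _ _ _ h) (fun _ _ _ => Cochain.comp_smul _ _ _ h)
  ofHom f := Cochain.ofHom f
  d_ofHom f := δ_ofHom f
  existsUnique_ofHom z hz := by
    refine ⟨Cocycle.homOf (Cocycle.mk z 1 (by simp) hz),
      Cocycle.cochain_ofHom_homOf_eq_coe (Cocycle.mk z 1 (by simp) hz), fun f hf => ?_⟩
    exact Cochain.ofHom_injective (hf.trans (Cocycle.cochain_ofHom_homOf_eq_coe (Cocycle.mk z 1 (by simp) hz)).symm)
  ofHom_comp f g := Cochain.ofHom_comp f g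
  id_comp f := Cochain.id_comp f
  comp_id f := Cochain.comp_id f
  assoc hpq hqr har _ f g l := Cochain.comp_assoc f g l hpq hqr (by lia)
  d_comp h hp hq hn _ _ f g := δ_comp f g h _ _ _ hn hp hq

/-- The action `z ↦ (-1) ^ (n * a) z[a]` of the shift on morphisms of degree `n`. -/
def shiftCochain (M N : CochainComplex (ModuleCat.{u} R) ℤ) (n a : ℤ) :
    Cochain M N n →ₗ[R] Cochain (M⟦a⟧) (N⟦a⟧) n where
  toFun z := (n * a).negOnePow • z.shift a
  map_add' z w := by simp
  map_smul' c z := by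
    dsimp
    rw [Cochain.shift_smul, smul_comm]

lemma shiftCochain_δ {M N : CochainComplex (ModuleCat.{u} R) ℤ} {n n' : ℤ} (a : ℤ)
    (hn : n + 1 = n') (z : Cochain M N n) :
    shiftCochain M N n' a (δ n n' z) = δ n n' (shiftCochain M N n a z) := by
  change (n' * a).negOnePow • Cochain.shift (δ n n' z) a =
    δ n n' ((n * a).negOnePow • Cochain.shift z a)
  rw [δ_units_smul, Cochain.δ_shift, smul_smul, ← Int.negOnePow_add, ← hn, add_mul, one_mul]

lemma shiftCochain_ofHom {M N : CochainComplex (ModuleCat.{u} R) ℤ} (a : ℤ) (f : M ⟶ N) :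
    shiftCochain M N 0 a (Cochain.ofHom f) = Cochain.ofHom (f⟦a⟧') := by
  change (0 * a).negOnePow • Cochain.shift (Cochain.ofHom f) a = Cochain.ofHom (f⟦a⟧')
  rw [zero_mul, Int.negOnePow_zero, one_smul]
  refine Cochain.ext₀ _ _ fun p => ?_
  rw [Cochain.shift_v']
  simp

lemma shiftCochain_comp {M N L : CochainComplex (ModuleCat.{u} R) ℤ} {p q n : ℤ} (a : ℤ)
    (h : p + q = n) (f : Cochain M N p) (g : Cochain N L q) :
    shiftCochain M L n a (f.comp g h) =
      (shiftCochain M N p a f).comp (shiftCochain N L q a g) h := by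
  change (n * a).negOnePow • Cochain.shift (Cochain.comp f g h) a =
    Cochain.comp ((p * a).negOnePow • Cochain.shift f a)
      ((q * a).negOnePow • Cochain.shift g a) h
  rw [Cochain.units_smul_comp, Cochain.comp_units_smul, smul_smul, ← Int.negOnePow_add,
    ← add_mul, h]
  congr 1
  refine Cochain.ext _ _ fun i j hij => ?_
  rw [Cochain.comp_v _ _ h i (i + p) j rfl (by lia), Cochain.shift_v', Cochain.shift_v',
    Cochain.shift_v', Cochain.comp_v _ _ h (i + a) (i + p + a) (j + a) (by lia) (by lia)]
  rfl

/-- The dg functor `M ↦ M[a]`.  On morphisms `z` of degree `n` it is the usual translate with the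
sign `(-1) ^ (n * a)`, as is forced by the sign `(-1) ^ a` in the differential of `M[a]`. -/
def shiftDG (R : Type u) [CommRing R] (a : ℤ) :
    DGFunctor R (CochainComplex (ModuleCat.{u} R) ℤ) (CochainComplex (ModuleCat.{u} R) ℤ) where
  toFunctor := shiftFunctor (CochainComplex (ModuleCat.{u} R) ℤ) a
  mapHom {M N} n := shiftCochain M N n a
  mapHom_d hn z := shiftCochain_δ a hn z
  mapHom_ofHom f := shiftCochain_ofHom a f
  mapHom_comp h f g := shiftCochain_comp a h f g

/-- The action `z ↦ z ⊗ L` on morphisms of degree `n`. -/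
def tensorCochain (L : ModuleCat.{u} R) (M N : CochainComplex (ModuleCat.{u} R) ℤ) (n : ℤ) :
    Cochain M N n →ₗ[R] Cochain
      (((MonoidalCategory.tensorRight L).mapHomologicalComplex _).obj M)
      (((MonoidalCategory.tensorRight L).mapHomologicalComplex _).obj N) n where
  toFun z := z.map (MonoidalCategory.tensorRight L)
  map_add' z w := Cochain.map_add z w _
  map_smul' c z := by
    refine Cochain.ext _ _ fun p q hpq => ?_
    dsimp only [RingHom.id_apply]
    rw [Cochain.map_v, Cochain.smul_v, Cochain.smul_v, Cochain.map_v, Functor.map_smul]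
    rfl

/-- The dg functor `M ↦ M ⊗_R L`, for an `R`-module `L`. -/
def tensorDG (L : ModuleCat.{u} R) :
    DGFunctor R (CochainComplex (ModuleCat.{u} R) ℤ) (CochainComplex (ModuleCat.{u} R) ℤ) where
  toFunctor := (MonoidalCategory.tensorRight L).mapHomologicalComplex _
  mapHom {M N} n := tensorCochain L M N n
  mapHom_d {M N n n'} _ z :=
    (δ_map (K := M) (L := N) n n' z (MonoidalCategory.tensorRight L)).symm
  mapHom_ofHom {M N} f := Cochain.map_ofHom M N f (MonoidalCategory.tensorRight L)
  mapHom_comp {M N T _ _ _} h f g :=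
    Cochain.map_comp (F := M) (G := N) (K := T) f g h (MonoidalCategory.tensorRight L)

end Complexes

/-! ### Differential graded algebras and right dg modules -/

/-- A differential graded `R`-algebra (cohomologically graded, unital, associative). -/
structure DGAlgebra (R : Type u) [CommRing R] where
  cx : CochainComplex (ModuleCat.{u} R) ℤ
  one : cx.X 0
  mul {p q n : ℤ} (h : p + q = n) : cx.X p →ₗ[R] cx.X q →ₗ[R] cx.X n
  one_mul {n : ℤ} (a : cx.X n) : mul (zero_add n) one a = a
  mul_one {n : ℤ} (a : cx.X n) : mul (add_zero n) a one = a
  mul_assoc {p q r s t n : ℤ} (hpq : p + q = s) (hqr : q + r = t) (hsr : s + r = n)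
    (hpt : p + t = n) (a : cx.X p) (b : cx.X q) (c : cx.X r) :
    mul hsr (mul hpq a b) c = mul hpt a (mul hqr b c)
  d_mul {p p' q q' n n' : ℤ} (h : p + q = n) (hp : p + 1 = p') (hq : q + 1 = q')
    (hn : n + 1 = n') (h₁ : p' + q = n') (h₂ : p + q' = n') (a : cx.X p) (b : cx.X q) :
    cx.d n n' (mul h a b) = mul h₁ (cx.d p p' a) b + p.negOnePow • mul h₂ a (cx.d q q' b)

/-- A right dg module over the dg algebra `A`. -/
structure DGModule {R : Type u} [CommRing R] (A : DGAlgebra R) where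
  cx : CochainComplex (ModuleCat.{u} R) ℤ
  act {p q n : ℤ} (h : p + q = n) : cx.X p →ₗ[R] A.cx.X q →ₗ[R] cx.X n
  act_one {n : ℤ} (x : cx.X n) : act (add_zero n) x A.one = x
  act_mul {p q r s t n : ℤ} (hpq : p + q = s) (hqr : q + r = t) (hsr : s + r = n)
    (hpt : p + t = n) (x : cx.X p) (a : A.cx.X q) (b : A.cx.X r) :
    act hsr (act hpq x a) b = act hpt x (A.mul hqr a b)
  d_act {p p' q q' n n' : ℤ} (h : p + q = n) (hp : p + 1 = p') (hq : q + 1 = q')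
    (hn : n + 1 = n') (h₁ : p' + q = n') (h₂ : p + q' = n') (x : cx.X p) (a : A.cx.X q) :
    cx.d n n' (act h x a) =
      act h₁ (cx.d p p' x) a + p.negOnePow • act h₂ x (A.cx.d q q' a)

namespace DGModule

open CochainComplex.HomComplex

variable {R : Type u} [CommRing R] {A : DGAlgebra R}

/-- Morphisms of dg modules: morphisms of complexes commuting with the action. -/
@[ext]
structure Hom (M N : DGModule A) where
  f : M.cx ⟶ N.cx
  map_act {p q n : ℤ} (h : p + q = n) (x : M.cx.X p) (a : A.cx.X q) :
    f.f n (M.act h x a) = N.act h (f.f p x) a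

instance : Category (DGModule A) where
  Hom := Hom
  id M := ⟨𝟙 _, fun _ _ _ => rfl⟩
  comp φ ψ := ⟨φ.f ≫ ψ.f, fun h x a => by simp [φ.map_act, ψ.map_act]⟩

/-- The `A`-linear maps of degree `n` from `M` to `N`.  There is no sign, since the maps are
written on the left and `A` acts on the right. -/
def linearCochain (M N : DGModule A) (n : ℤ) : Submodule R (Cochain M.cx N.cx n) where
  carrier := {z | ∀ ⦃p q r p' r' : ℤ⦄ (hp : p + n = p') (hr : r + n = r') (h : p + q = r)
    (h' : p' + q = r') (x : M.cx.X p) (a : A.cx.X q),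
    z.v r r' hr (M.act h x a) = N.act h' (z.v p p' hp x) a}
  add_mem' hz hz' p q r p' r' hp hr h h' x a := by
    simp [hz hp hr h h' x a, hz' hp hr h h' x a]
  zero_mem' p q r p' r' hp hr h h' x a := by simp
  smul_mem' c z hz p q r p' r' hp hr h h' x a := by
    simp [hz hp hr h h' x a]

lemma δ_mem (M N : DGModule A) (n m : ℤ) (z : Cochain M.cx N.cx n)
    (hz : z ∈ linearCochain M N n) : δ n m z ∈ linearCochain M N m := by
  by_cases hnm : n + 1 = m
  swap
  · rw [δ_shape n m hnm]
    exact Submodule.zero_mem _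
  intro p q r p' r' hp hr h h' x a
  rw [δ_v n m hnm z r r' hr (r' - 1) (r + 1) rfl rfl,
    δ_v n m hnm z p p' hp (p' - 1) (p + 1) rfl rfl]
  have e₁ := hz (p := p) (q := q) (r := r) (p' := p' - 1) (r' := r' - 1)
    (by lia) (by lia) h (by lia) x a
  have e₂ := hz (p := p + 1) (q := q) (r := r + 1) (p' := p') (r' := r')
    (by lia) (by lia) (by lia) h' (M.cx.d p (p + 1) x) a
  have e₃ := hz (p := p) (q := q + 1) (r := r + 1) (p' := p' - 1) (r' := r')
    (by lia) (by lia) (by lia) (by lia) x (A.cx.d q (q + 1) a)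
  have f₁ := M.d_act h rfl rfl rfl (by lia) (by lia) x a
  have f₂ := N.d_act (p := p' - 1) (p' := p') (n := r' - 1) (n' := r') (q := q) (q' := q + 1)
    (by lia) (by lia) rfl (by lia) h' (by lia) (z.v p (p' - 1) (by lia) x) a
  have hs : m.negOnePow * p.negOnePow = - (p' - 1).negOnePow := by
    rw [← Int.negOnePow_add, add_comm, hp, Int.negOnePow_sub, Int.negOnePow_one]
    simp
  have aux (a b c : N.cx.X r') : a + b + (c + -b) = a + c := by abel
  simp [Units.smul_def, e₁, f₁, f₂, e₂, e₃, smul_smul]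
  rw [← Units.val_mul, hs, Units.val_neg, neg_smul]
  exact aux _ _ _

/-- The complex of `R`-modules `Hom_A(M, N)`. -/
def homComplex (M N : DGModule A) : CochainComplex (ModuleCat.{u} R) ℤ where
  X n := ModuleCat.of R (linearCochain M N n)
  d n m := ModuleCat.ofHom ((δ_hom R M.cx N.cx n m).restrict (δ_mem M N n m))
  shape n m h := by
    exact ModuleCat.hom_ext (LinearMap.ext fun z => Subtype.ext (δ_shape n m h z.1))
  d_comp_d' n m l _ _ := by
    exact ModuleCat.hom_ext (LinearMap.ext fun z => Subtype.ext (δ_δ n m l z.1))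

lemma comp_mem {M N L : DGModule A} {p q n : ℤ} {f : Cochain M.cx N.cx p}
    {g : Cochain N.cx L.cx q} (hf : f ∈ linearCochain M N p) (hg : g ∈ linearCochain N L q)
    (h : p + q = n) : Cochain.comp f g h ∈ linearCochain M L n := by
  intro i j r i' r' hi hr e e' x a
  rw [Cochain.comp_v f g h r (r + p) r' rfl (by lia),
    Cochain.comp_v f g h i (i + p) i' rfl (by lia)]
  simp [hf (p := i) (q := j) (r := r) (p' := i + p) (r' := r + p) rfl rfl e (by lia) x a,
    hg (p := i + p) (q := j) (r := r + p) (p' := i') (r' := r') (by lia) (by lia) (by lia) e'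
      (f.v i (i + p) rfl x) a]

lemma ofHom_mem {M N : DGModule A} (f : M ⟶ N) : Cochain.ofHom f.f ∈ linearCochain M N 0 := by
  intro i j r i' r' hi hr e e' x a
  obtain rfl : i = i' := by lia
  obtain rfl : r = r' := by lia
  rw [Cochain.ofHom_v, Cochain.ofHom_v]
  exact f.map_act e x a

instance : DGCategory R (DGModule A) where
  hom := homComplex
  comp {M N L p q n} h := LinearMap.mk₂ R
    (fun (f : linearCochain M N p) (g : linearCochain N L q) =>
      (⟨Cochain.comp f.1 g.1 h, comp_mem f.2 g.2 h⟩ : linearCochain M L n))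
    (fun _ _ _ => Subtype.ext (Cochain.add_comp _ _ _ h))
    (fun _ _ _ => Subtype.ext (Cochain.smul_comp _ _ _ h))
    (fun _ _ _ => Subtype.ext (Cochain.comp_add _ _ _ h))
    (fun _ _ _ => Subtype.ext (Cochain.comp_smul _ _ _ h))
  ofHom f := (⟨Cochain.ofHom f.f, ofHom_mem f⟩ : linearCochain _ _ 0)
  d_ofHom f := Subtype.ext (δ_ofHom f.f)
  existsUnique_ofHom {M N} (z : linearCochain M N 0) hz := by
    let c : Cocycle M.cx N.cx 0 := Cocycle.mk z.1 1 (by simp) (congrArg Subtype.val hz)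
    have hc : Cochain.ofHom (Cocycle.homOf c) = z.1 := Cocycle.cochain_ofHom_homOf_eq_coe c
    refine ⟨⟨Cocycle.homOf c, fun {p q n} h x a => ?_⟩, Subtype.ext hc, fun f hf => ?_⟩
    · have hz' : z.1 ∈ linearCochain M N 0 := z.2
      have := hz' (p := p) (q := q) (r := n) (p' := p) (r' := n) (by simp) (by simp) h h x a
      rw [← hc, Cochain.ofHom_v, Cochain.ofHom_v] at this
      exact this
    · exact Hom.ext (Cochain.ofHom_injective ((congrArg Subtype.val hf).trans hc.symm))
  ofHom_comp f g := Subtype.ext (Cochain.ofHom_comp f.f g.f)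
  id_comp f := Subtype.ext (Cochain.id_comp f.1)
  comp_id f := Subtype.ext (Cochain.comp_id f.1)
  assoc hpq hqr har _ f g l := Subtype.ext (Cochain.comp_assoc f.1 g.1 l.1 hpq hqr (by lia))
  d_comp h hp hq hn _ _ f g := Subtype.ext (δ_comp f.1 g.1 h _ _ _ hn hp hq)

variable (A) in
/-- The quasi-isomorphisms of dg modules. -/
def quasiIso : MorphismProperty (DGModule A) := fun _ _ φ => QuasiIso φ.f

/-- A dg module `M` is K-projective if `Hom_A(M, N)` is acyclic for every acyclic `N`. -/
def IsKProjective (M : DGModule A) : Prop :=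
  ∀ N : DGModule A, N.cx.Acyclic → (homComplex M N).Acyclic

variable (A) in
/-- The derived category of right dg modules, obtained by inverting the quasi-isomorphisms. -/
abbrev Derived := (quasiIso A).Localization

variable (A) in
/-- The localization functor. -/
abbrev toDerived : DGModule A ⥤ Derived A := (quasiIso A).Q

end DGModule

/-! ### Endomorphism dg algebras and the functors they give -/

section Corepresentable

open CochainComplex.HomComplex

variable {R : Type u} [CommRing R] {C : Type w} [Category.{v} C] [DGCategory R C]

/-- The dg algebra of endomorphisms of an object, with multiplication `a * b = a ∘ b`. -/
def endDGA (R : Type u) [CommRing R] {C : Type w} [Category.{v} C] [DGCategory R C] (X : C) :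
    DGAlgebra R where
  cx := dgHom R X X
  one := DGCategory.ofHom (𝟙 X)
  mul {p q n} h := (DGCategory.comp (X := X) (Y := X) (Z := X) ((add_comm q p).trans h)).flip
  one_mul a := DGCategory.comp_id a
  mul_one a := DGCategory.id_comp a
  mul_assoc _ _ _ _ a b c := (DGCategory.assoc _ _ _ _ c b a).symm
  d_mul {p _ q _ _ _} h hp hq hn _ _ a b := by
    have e := DGCategory.d_comp ((add_comm q p).trans h) hq hp hn (by lia) (by lia) b a
    exact e

/-- `Hom(X, Y)` as a right dg module over `End(X)`, by precomposition: `f * a = f ∘ a`. -/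
def homModule (R : Type u) [CommRing R] {C : Type w} [Category.{v} C] [DGCategory R C]
    (X Y : C) : DGModule (endDGA R X) where
  cx := dgHom R X Y
  act {p q n} h := (DGCategory.comp (X := X) (Y := X) (Z := Y) ((add_comm q p).trans h)).flip
  act_one x := DGCategory.id_comp x
  act_mul _ _ _ _ x a b := (DGCategory.assoc _ _ _ _ b a x).symm
  d_act h hp hq hn h₁ h₂ x a := by
    exact DGCategory.d_comp _ hq hp hn (by lia) (by lia) a x

/-- Postcomposition with `z : Hom(Y, Z)^n`, as a map `Hom(X, Y) → Hom(X, Z)` of degree `n`. -/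
def postcomp (X : C) {Y Z : C} (n : ℤ) :
    (dgHom R Y Z).X n →ₗ[R] Cochain (dgHom R X Y) (dgHom R X Z) n where
  toFun z := Cochain.mk fun _ _ h => ModuleCat.ofHom ((DGCategory.comp h).flip z)
  map_add' z z' := by
    ext p q h x
    simp
  map_smul' c z := by
    ext p q h x
    simp

lemma postcomp_v (X : C) {Y Z : C} {n : ℤ} (z : (dgHom R Y Z).X n) {p q : ℤ} (h : p + n = q)
    (x : (dgHom R X Y).X p) : (postcomp X n z).v p q h x = DGCategory.comp h x z := rfl

lemma postcomp_d (X : C) {Y Z : C} {n n' : ℤ} (hn : n + 1 = n') (z : (dgHom R Y Z).X n) :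
    postcomp X n' ((dgHom R Y Z).d n n' z) = δ n n' (postcomp X n z) := by
  refine Cochain.ext _ _ fun p q h => ModuleCat.hom_ext (LinearMap.ext fun x => ?_)
  rw [δ_v n n' hn _ p q h (q - 1) (p + 1) rfl rfl]
  have e := DGCategory.d_comp (p := p) (q := n) (n := q - 1) (n' := q) (by lia) rfl hn (by lia)
    (by lia) (by lia) x z
  have hs : n'.negOnePow = - n.negOnePow := by rw [← hn, Int.negOnePow_succ]
  rw [hs]
  change DGCategory.comp h x ((dgHom R Y Z).d n n' z) =
    (dgHom R X Z).d (q - 1) q (DGCategory.comp (by lia) x z) +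
      (-n.negOnePow) • DGCategory.comp (by lia) ((dgHom R X Y).d p (p + 1) x) z
  rw [e, Units.neg_smul]
  abel

lemma postcomp_ofHom_comp (X : C) {Y Z T : C} {p q n : ℤ} (h : p + q = n)
    (f : (dgHom R Y Z).X p) (g : (dgHom R Z T).X q) :
    postcomp X n (DGCategory.comp h f g) = (postcomp X p f).comp (postcomp X q g) h := by
  refine Cochain.ext _ _ fun i j hij => ModuleCat.hom_ext (LinearMap.ext fun x => ?_)
  rw [Cochain.comp_v _ _ h i (i + p) j rfl (by lia)]
  exact (DGCategory.assoc rfl h (by lia) hij x f g).symm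

lemma postcomp_mem (X : C) {Y Z : C} {n : ℤ} (z : (dgHom R Y Z).X n) :
    postcomp X n z ∈ DGModule.linearCochain (homModule R X Y) (homModule R X Z) n := by
  intro p q r p' r' hp hr h h' x a
  exact DGCategory.assoc _ _ _ _ a x z

/-- The morphism of complexes `Hom(X, Y) ⟶ Hom(X, Z)` given by postcomposition with `f`. -/
def postcompHom (R : Type u) [CommRing R] {C : Type w} [Category.{v} C] [DGCategory R C]
    (X : C) {Y Z : C} (f : Y ⟶ Z) : dgHom R X Y ⟶ dgHom R X Z where
  f n := ModuleCat.ofHom ((DGCategory.comp (add_zero n)).flip (DGCategory.ofHom f))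
  comm' n m (hnm : n + 1 = m) := by
    refine ModuleCat.hom_ext (LinearMap.ext fun x => ?_)
    have e := DGCategory.d_comp (add_zero n) hnm (zero_add 1) hnm hnm (add_zero m) x
      (DGCategory.ofHom (R := R) f)
    rw [DGCategory.d_ofHom, map_zero, zero_add, Int.negOnePow_zero, one_smul] at e
    exact e

lemma ofHom_postcompHom (X : C) {Y Z : C} (f : Y ⟶ Z) :
    Cochain.ofHom (postcompHom R X f) = postcomp X 0 (DGCategory.ofHom f) := by
  ext n x
  rw [Cochain.ofHom_v]
  rfl

/-- The dg functor `Y ↦ Hom(X, Y)` to complexes of `R`-modules. -/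
def homFunctor (R : Type u) [CommRing R] {C : Type w} [Category.{v} C] [DGCategory R C] (X : C) :
    DGFunctor R C (CochainComplex (ModuleCat.{u} R) ℤ) where
  obj Y := dgHom R X Y
  map f := postcompHom R X f
  map_id Y := by
    ext n x
    exact DGCategory.comp_id x
  map_comp f g := by
    ext n x
    change DGCategory.comp (add_zero n) x (DGCategory.ofHom (f ≫ g)) = _
    rw [DGCategory.ofHom_comp]
    exact (DGCategory.assoc _ _ (add_zero n) _ x (DGCategory.ofHom f) (DGCategory.ofHom g)).symm
  mapHom n := postcomp X n
  mapHom_d hn z := postcomp_d X hn z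
  mapHom_ofHom f := (ofHom_postcompHom X f).symm
  mapHom_comp h f g := postcomp_ofHom_comp X h f g

/-- The dg functor `Y ↦ Hom(X, Y)` to right dg modules over `End(X)`. -/
def homModuleFunctor (R : Type u) [CommRing R] {C : Type w} [Category.{v} C] [DGCategory R C]
    (X : C) : DGFunctor R C (DGModule (endDGA R X)) where
  obj Y := homModule R X Y
  map f := ⟨postcompHom R X f, fun _ x a => DGCategory.assoc _ _ _ _ a x (DGCategory.ofHom f)⟩
  map_id Y := DGModule.Hom.ext ((homFunctor R X).map_id Y)
  map_comp f g := DGModule.Hom.ext ((homFunctor R X).map_comp f g)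
  mapHom {Y Z} n := (postcomp X n).codRestrict
    (DGModule.linearCochain (homModule R X Y) (homModule R X Z) n) (postcomp_mem X)
  mapHom_d hn z := Subtype.ext (postcomp_d X hn z)
  mapHom_ofHom f := Subtype.ext (ofHom_postcompHom X f).symm
  mapHom_comp h f g := Subtype.ext (postcomp_ofHom_comp X h f g)

end Corepresentable

/-! ### The completed symmetric algebra, perfect complexes and coherent dg modules -/

section Koszul

variable (k : Type u) [Field k] (V : Type u) [AddCommGroup V] [Module k V]

/-- The augmentation ideal of `Sym(V)`, the kernel of `Sym(V) → k`, `V ↦ 0`. -/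
abbrev augmentationIdeal : Ideal (SymmetricAlgebra k V) :=
  RingHom.ker (SymmetricAlgebra.algebraMapInv : SymmetricAlgebra k V →ₐ[k] k)

/-- The completion of `Sym(V)` at its augmentation ideal. -/
abbrev CompletedSym : Type u := AdicCompletion (augmentationIdeal k V) (SymmetricAlgebra k V)

/-- The augmentation of the completed symmetric algebra. -/
def augmentation : CompletedSym k V →+* k :=
  (Ideal.Quotient.lift (augmentationIdeal k V)
    (SymmetricAlgebra.algebraMapInv : SymmetricAlgebra k V →ₐ[k] k).toRingHom
    (fun _ h => h)).comp (AdicCompletion.evalOneₐ (augmentationIdeal k V)).toRingHom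

/-- The residue field `k` as a module over the completed symmetric algebra. -/
def residueModule : ModuleCat.{u} (CompletedSym k V) :=
  (ModuleCat.restrictScalars (augmentation k V)).obj (ModuleCat.of k k)

/-- The base change of `⋀^d V` to the completed symmetric algebra `S`, for `d = dim V`.  For an
`S`-module `M` one has `M ⊗_S topExterior = M ⊗_k ⋀^d V`. -/
def topExterior : ModuleCat.{u} (CompletedSym k V) :=
  ModuleCat.of _ (TensorProduct k (CompletedSym k V) (⋀[k]^(Module.finrank k V) V))

/-- The dg functor `M ↦ M[d] ⊗_k ⋀^d V` on complexes of `S`-modules, for `d = dim V`. -/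
def twist : DGFunctor (CompletedSym k V) (CochainComplex (ModuleCat.{u} (CompletedSym k V)) ℤ)
    (CochainComplex (ModuleCat.{u} (CompletedSym k V)) ℤ) :=
  (shiftDG (CompletedSym k V) (Module.finrank k V)).comp (tensorDG (topExterior k V))

end Koszul

/-- The perfect objects of the derived category of `R`: the smallest triangulated subcategory
that contains `R` and is closed under retracts. -/
def perfect (R : Type u) [CommRing R] [HasDerivedCategory.{v} (ModuleCat.{u} R)] :
    ObjectProperty (DerivedCategory (ModuleCat.{u} R)) :=
  (ObjectProperty.singleton
    ((DerivedCategory.singleFunctor (ModuleCat.{u} R) 0).obj (ModuleCat.of R R))).triangEnvelope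

section Coherent

variable (k : Type u) [Field k] {R : Type u} [CommRing R] [Algebra k R] {A : DGAlgebra R}

/-- A dg module is coherent if its total cohomology is finite-dimensional over `k`. -/
def IsCoherent (M : DGModule A) : Prop :=
  {n : ℤ | ¬ Limits.IsZero (M.cx.homology n)}.Finite ∧
    ∀ n : ℤ, Module.Finite k ((ModuleCat.restrictScalars (algebraMap k R)).obj (M.cx.homology n))

variable (A) in
/-- The coherent objects of the derived category of `A`. -/
def coherent : ObjectProperty (DGModule.Derived A) :=
  ObjectProperty.map (IsCoherent k : ObjectProperty (DGModule A)) (DGModule.toDerived A)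

end Coherent

/-- A dg module is a model of the `R`-module `L` (placed in degree `0`) if its cohomology is
concentrated in degree `0`, where it is isomorphic to `L`. -/
def IsModelOf {R : Type u} [CommRing R] {A : DGAlgebra R} (M : DGModule A) (L : ModuleCat.{u} R) :
    Prop :=
  Nonempty (M.cx.homology 0 ≅ L) ∧ ∀ n : ℤ, n ≠ 0 → Limits.IsZero (M.cx.homology n)

/-! ### The functors `F = RHom_S(k, -)` and `G = RHom_E(k, -)[d] ⊗_k ⋀^d V` -/

section Functors

variable {k : Type u} [Field k] {V : Type u} [AddCommGroup V] [Module k V]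

/-- The category of complexes of modules over the completed symmetric algebra `S` of `V`. -/
abbrev SComplex (k : Type u) [Field k] (V : Type u) [AddCommGroup V] [Module k V] :=
  CochainComplex (ModuleCat.{u} (CompletedSym k V)) ℤ

/-- For a K-projective resolution `P` of `k` over `S`, this dg algebra is `RHom_S(k, k)`. -/
abbrev extAlgebra (P : SComplex k V) : DGAlgebra (CompletedSym k V) :=
  endDGA (CompletedSym k V) P

/-- For a K-projective resolution `P` of `k` over `S`, this is `RHom_S(k, -)`, with values in right
dg modules over `E = RHom_S(k, k)`. -/
abbrev functorF (P : SComplex k V) :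
    DGFunctor (CompletedSym k V) (SComplex k V) (DGModule (extAlgebra P)) :=
  homModuleFunctor (CompletedSym k V) P

/-- For a K-projective model `κ` of `k` over `E`, this is `RHom_E(k, -)[d] ⊗_k ⋀^d V`, where
`d = dim V`. -/
abbrev functorG {P : SComplex k V} (κ : DGModule (extAlgebra P)) :
    DGFunctor (CompletedSym k V) (DGModule (extAlgebra P)) (SComplex k V) :=
  (homFunctor (CompletedSym k V) κ).comp (twist k V)

end Functors

end

end BGG

/-! Write `S` for the completed symmetric algebra, `E` for `End(P)` and `F = Hom_S(P, -)`. The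
kernel of the augmentation is generated by a regular sequence `x_1, ..., x_d` along which `S` is
complete (`exists_parameters`). Iterated cones of multiplication by the `x_i` on `S` form the Koszul
complex `K`, which is homotopy equivalent to `P` (`exists_koszul`). Its self-duality shows that
`F(S)` has cohomology `k`, in degree `d` only (`concAt_homModule`). So `F(S)[d]` is a model of `k`,
and after trivialising the line `⋀^d V` the functor `G` is `RHom_E(F(S), -)`.

At `S` the unit is then the double centraliser map from `S` to `RHom_E(F(S), F(S))`. The same map
with `K` in place of the first `S` is bijective by Yoneda, since `F(K)` is homotopy equivalent to
the free module `E`. One climbs from `K` to `S` one cone at a time: kernel and cokernel of the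
comparison are `x_i`-divisible, and both sides are derived complete along `x_i`, so a Nakayama
argument applies (`cmpr_bijective_of_chain`). This is where the completion enters.

Two facts about `E`-modules are needed, and both come from telescopes, the homotopy fibres of `t -
x` on a countable sum of copies of `M`. The telescope is quasi-isomorphic to `M` when `x` kills the
cohomology of `M`, and it is K-projective as soon as the cone of `x` on `M` is. Iterating over the
`x_i` yields a K-projective replacement of `F(S)`, because `F(K)` is K-projective
(`exists_telescope_functor`). Since each `x_i` vanishes in the cohomology of `E`, telescopes also
show that morphisms out of any K-projective `E`-module are derived complete (`KProj.dc`).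

Nakayama along the Koszul cones gives more: there is a map from `E` to the model `κ` along which
every class in the top cohomology of a bounded above `N` extends to a shifted map from `κ` to `N`
(`exists_model`, `IsTopGenerator`). With Schur's lemma it follows that every K-projective model is
homotopy equivalent to the constructed one (`exists_generator`), and that every coherent module is
built by finitely many extensions from shifts of `κ` and acyclic modules (`devissage`).

The conclusion is formal. The unit is a quasi-isomorphism at `S`, hence at all perfect complexes
(`quasiIso_of_perfect`). The transformation `id → FG` is manufactured from the unit by Yoneda, and
at `F(M)` it is `F` of the unit at `M`. Hence it is a quasi-isomorphism at `F(S)`, then at `κ`, then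
at all coherent modules. Perfectness of `G(N)` follows the same route (`counit_of_coherent`).
Passing to localizations gives the equivalence (`exists_equivalence_of_localization`). -/

namespace BGG

noncomputable section

/-! ### Cohomology of complexes of modules, elementwise -/

namespace Cx

variable {R : Type u} [CommRing R]

/-- The cocycles of degree `n`. -/
def cyc (M : CochainComplex (ModuleCat.{u} R) ℤ) (n : ℤ) : Submodule R (M.X n) :=
  LinearMap.ker (M.d n (n + 1)).hom

/-- The coboundaries of degree `n`. -/
def bdry (M : CochainComplex (ModuleCat.{u} R) ℤ) (n : ℤ) : Submodule R (M.X n) :=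
  LinearMap.range (M.d (n - 1) n).hom

variable {M N L : CochainComplex (ModuleCat.{u} R) ℤ}

lemma d_d_apply {i j l : ℤ} (z : M.X i) : M.d j l (M.d i j z) = 0 := by
  rw [← ModuleCat.comp_apply, M.d_comp_d]
  rfl

lemma mem_cyc_iff {n m : ℤ} (h : n + 1 = m) (z : M.X n) : z ∈ cyc M n ↔ M.d n m z = 0 := by
  subst h
  rfl

lemma d_of_mem_cyc {n m : ℤ} {z : M.X n} (hz : z ∈ cyc M n) : M.d n m z = 0 := by
  by_cases h : n + 1 = m
  · exact (mem_cyc_iff h z).1 hz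
  · rw [M.shape n m h]
    rfl

lemma mem_bdry_iff {m n : ℤ} (h : m + 1 = n) (z : M.X n) :
    z ∈ bdry M n ↔ ∃ w : M.X m, M.d m n w = z := by
  obtain rfl : m = n - 1 := by lia
  rfl

lemma d_mem_bdry {m n : ℤ} (w : M.X m) : M.d m n w ∈ bdry M n := by
  by_cases h : m + 1 = n
  · exact (mem_bdry_iff h _).2 ⟨w, rfl⟩
  · rw [M.shape m n h]
    exact Submodule.zero_mem _

lemma bdry_le_cyc (n : ℤ) : bdry M n ≤ cyc M n := by
  rintro z ⟨w, rfl⟩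
  exact d_d_apply w

variable (M) in
/-- The cohomology of degree `n`, as the quotient of cocycles by coboundaries. -/
abbrev H (n : ℤ) : Type u := cyc M n ⧸ (bdry M n).submoduleOf (cyc M n)

/-- The class of a cocycle. -/
def cls {n : ℤ} (z : M.X n) (hz : z ∈ cyc M n) : H M n := Submodule.Quotient.mk ⟨z, hz⟩

lemma cls_surj {n : ℤ} (a : H M n) : ∃ z hz, a = cls (M := M) z hz := by
  obtain ⟨⟨z, hz⟩, rfl⟩ := Submodule.Quotient.mk_surjective _ a
  exact ⟨z, hz, rfl⟩

lemma cls_eq_zero_iff {n : ℤ} (z : M.X n) (hz : z ∈ cyc M n) :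
    cls z hz = 0 ↔ z ∈ bdry M n := by
  rw [cls, Submodule.Quotient.mk_eq_zero]
  rfl

lemma cls_eq_iff {n : ℤ} {z z' : M.X n} (hz : z ∈ cyc M n) (hz' : z' ∈ cyc M n) :
    cls z hz = cls z' hz' ↔ z - z' ∈ bdry M n := by
  rw [cls, cls, Submodule.Quotient.eq]
  rfl

lemma cls_smul {n : ℤ} (r : R) {z : M.X n} (hz : z ∈ cyc M n) :
    r • cls z hz = cls (r • z) (Submodule.smul_mem _ r hz) := rfl

lemma cls_congr {n : ℤ} {z z' : M.X n} (h : z = z') (hz : z ∈ cyc M n) :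
    cls z hz = cls z' (h ▸ hz) := by
  subst h
  rfl

/-- The map induced on cohomology by a linear map that preserves cocycles and coboundaries. -/
def Hlift {n m : ℤ} (φ : M.X n →ₗ[R] N.X m) (h₁ : cyc M n ≤ (cyc N m).comap φ)
    (h₂ : bdry M n ≤ (bdry N m).comap φ) : H M n →ₗ[R] H N m :=
  Submodule.mapQ _ _ (φ.restrict h₁) fun _ hz => h₂ hz

lemma f_mem_cyc (f : M ⟶ N) {n : ℤ} {z : M.X n} (hz : z ∈ cyc M n) : f.f n z ∈ cyc N n := by
  rw [mem_cyc_iff rfl] at hz ⊢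
  rw [← ModuleCat.comp_apply, f.comm, ModuleCat.comp_apply, hz, map_zero]

lemma f_mem_bdry (f : M ⟶ N) {n : ℤ} {z : M.X n} (hz : z ∈ bdry M n) : f.f n z ∈ bdry N n := by
  obtain ⟨w, rfl⟩ := hz
  refine ⟨f.f _ w, ?_⟩
  change N.d _ _ (f.f _ w) = f.f n (M.d _ _ w)
  rw [← ModuleCat.comp_apply, f.comm, ModuleCat.comp_apply]

/-- The map induced on cohomology by a morphism of complexes. -/
def Hmap (f : M ⟶ N) (n : ℤ) : H M n →ₗ[R] H N n :=
  Hlift (f.f n).hom (fun _ hz => f_mem_cyc f hz) (fun _ hz => f_mem_bdry f hz)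

lemma Hmap_cls (f : M ⟶ N) {n : ℤ} (z : M.X n) (hz : z ∈ cyc M n) :
    Hmap f n (cls z hz) = cls (f.f n z) (f_mem_cyc f hz) := rfl

variable (M) in
/-- The projection from cocycles to the homology object. -/
def toHomology (n : ℤ) : ModuleCat.of R (cyc M n) ⟶ M.homology n :=
  M.liftCycles (ModuleCat.ofHom (cyc M n).subtype) (n + 1) (by simp)
    (by ext z; exact z.2) ≫ M.homologyπ n

lemma iCycles_liftCycles {n : ℤ} (z : cyc M n) :
    M.iCycles n (M.liftCycles (ModuleCat.ofHom (cyc M n).subtype) (n + 1) (by simp)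
      (by ext z; exact z.2) z) = (z : M.X n) := by
  rw [← ModuleCat.comp_apply, M.liftCycles_i]
  rfl

lemma toHomology_surjective (n : ℤ) : Function.Surjective (toHomology M n) := by
  intro a
  obtain ⟨c, rfl⟩ := (ModuleCat.epi_iff_surjective (M.homologyπ n)).1 inferInstance a
  have hc : M.iCycles n c ∈ cyc M n := by
    rw [mem_cyc_iff rfl, ← ModuleCat.comp_apply, M.iCycles_d]
    rfl
  refine ⟨⟨_, hc⟩, ?_⟩
  rw [toHomology, ModuleCat.comp_apply]
  congr 1
  apply (ModuleCat.mono_iff_injective (M.iCycles n)).1 inferInstance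
  rw [← ModuleCat.comp_apply, M.liftCycles_i]
  rfl

lemma toHomology_eq_zero_iff {n : ℤ} (z : cyc M n) :
    toHomology M n z = 0 ↔ (z : M.X n) ∈ bdry M n := by
  have hex : (ShortComplex.mk (M.toCycles (n - 1) n) (M.homologyπ n) (by simp)).Exact :=
    ShortComplex.exact_of_g_is_cokernel _ (M.homologyIsCokernel (n - 1) n (by simp))
  rw [toHomology, ModuleCat.comp_apply]
  constructor
  · intro h
    obtain ⟨w, hw⟩ := (ShortComplex.moduleCat_exact_iff _).1 hex _ h
    refine ⟨w, ?_⟩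
    have e := congrArg (M.iCycles n) hw
    dsimp only at e
    rw [← ModuleCat.comp_apply, ← ModuleCat.comp_apply, M.toCycles_i, M.liftCycles_i] at e
    exact e
  · rintro ⟨w, hw⟩
    have : M.liftCycles (ModuleCat.ofHom (cyc M n).subtype) (n + 1) (by simp)
        (by ext z; exact z.2) z = M.toCycles (n - 1) n w := by
      apply (ModuleCat.mono_iff_injective (M.iCycles n)).1 inferInstance
      rw [← ModuleCat.comp_apply, ← ModuleCat.comp_apply, M.toCycles_i, M.liftCycles_i]
      exact hw.symm
    rw [this, ← ModuleCat.comp_apply, M.toCycles_comp_homologyπ]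
    rfl

lemma toHomology_naturality (f : M ⟶ N) {n : ℤ} (z : cyc M n) :
    HomologicalComplex.homologyMap f n (toHomology M n z) =
      toHomology N n ⟨f.f n z, f_mem_cyc f z.2⟩ := by
  rw [toHomology, toHomology, ModuleCat.comp_apply, ModuleCat.comp_apply, ← ModuleCat.comp_apply,
    HomologicalComplex.homologyπ_naturality, ModuleCat.comp_apply]
  congr 1
  apply (ModuleCat.mono_iff_injective (N.iCycles n)).1 inferInstance
  rw [iCycles_liftCycles, ← ModuleCat.comp_apply, HomologicalComplex.cyclesMap_i,
    ModuleCat.comp_apply, iCycles_liftCycles]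

variable (M) in
/-- The comparison of the two definitions of cohomology. -/
def Hequiv (n : ℤ) : H M n ≃ₗ[R] M.homology n :=
  LinearEquiv.ofBijective
    (Submodule.liftQ _ (toHomology M n).hom fun z hz => (toHomology_eq_zero_iff z).2 hz) (by
      refine ⟨?_, fun a => ?_⟩
      · rw [injective_iff_map_eq_zero]
        intro a ha
        obtain ⟨z, hz, rfl⟩ := cls_surj a
        exact (cls_eq_zero_iff z hz).2 ((toHomology_eq_zero_iff ⟨z, hz⟩).1 ha)
      · obtain ⟨z, rfl⟩ := toHomology_surjective n a
        exact ⟨cls z.1 z.2, rfl⟩)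

lemma Hequiv_naturality (f : M ⟶ N) (n : ℤ) (a : H M n) :
    HomologicalComplex.homologyMap f n (Hequiv M n a) = Hequiv N n (Hmap f n a) := by
  obtain ⟨z, hz, rfl⟩ := cls_surj a
  exact toHomology_naturality f ⟨z, hz⟩

lemma isZero_homology_iff (n : ℤ) : Limits.IsZero (M.homology n) ↔ Subsingleton (H M n) := by
  rw [ModuleCat.isZero_iff_subsingleton]
  exact (Hequiv M n).toEquiv.symm.subsingleton_congr

lemma acyclic_iff : M.Acyclic ↔ ∀ n, Subsingleton (H M n) := by
  refine forall_congr' fun n => ?_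
  rw [HomologicalComplex.exactAt_iff_isZero_homology, isZero_homology_iff]

lemma quasiIso_iff_bijective (f : M ⟶ N) : QuasiIso f ↔ ∀ n, Function.Bijective (Hmap f n) := by
  rw [_root_.quasiIso_iff]
  refine forall_congr' fun n => ?_
  rw [quasiIsoAt_iff_isIso_homologyMap, ConcreteCategory.isIso_iff_bijective]
  have e : (HomologicalComplex.homologyMap f n : M.homology n → N.homology n) ∘ (Hequiv M n) =
      (Hequiv N n) ∘ (Hmap f n) := funext fun a => Hequiv_naturality f n a
  rw [← Function.Bijective.of_comp_iff _ (Hequiv M n).bijective, e,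
    Function.Bijective.of_comp_iff' (Hequiv N n).bijective]

lemma subsingleton_H_iff {n : ℤ} : Subsingleton (H M n) ↔ cyc M n ≤ bdry M n := by
  constructor
  · intro h z hz
    exact (cls_eq_zero_iff z hz).1 (Subsingleton.elim _ _)
  · intro h
    refine subsingleton_of_forall_eq 0 fun a => ?_
    obtain ⟨z, hz, rfl⟩ := cls_surj a
    exact (cls_eq_zero_iff z hz).2 (h hz)

end Cx

end

end BGG

namespace BGG

noncomputable section

/-! ### Calculus in a dg category -/

lemma map_units_smul {M N : Type*} [AddCommGroup M] [AddCommGroup N] {F : Type*} [FunLike F M N]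
    [AddMonoidHomClass F M N] (f : F) (a : ℤˣ) (z : M) : f (a • z) = a • f z := by
  obtain rfl | rfl := Int.units_eq_one_or a
  · rw [one_smul, one_smul]
  · rw [Units.neg_smul, one_smul, map_neg, Units.neg_smul, one_smul]

section DGCalculus

open Cx

variable {R : Type u} [CommRing R] {C : Type w} [Category.{v} C] [DGCategory R C]

/-- Composition in a dg category, with the degree computed automatically. -/
abbrev dgc {X Y Z : C} {p q n : ℤ} (f : (dgHom R X Y).X p) (g : (dgHom R Y Z).X q)
    (h : p + q = n := by lia) : (dgHom R X Z).X n :=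
  DGCategory.comp h f g

variable (R) in
/-- The identity, as an element of degree `0`. -/
abbrev idE (X : C) : (dgHom R X X).X 0 := DGCategory.ofHom (𝟙 X)

section

variable {X Y Z T : C} {p q r n m l : ℤ}

lemma dgc_add (f : (dgHom R X Y).X p) (g g' : (dgHom R Y Z).X q) (h : p + q = n) :
    dgc f (g + g') h = dgc f g h + dgc f g' h := map_add _ _ _

lemma add_dgc (f f' : (dgHom R X Y).X p) (g : (dgHom R Y Z).X q) (h : p + q = n) :
    dgc (f + f') g h = dgc f g h + dgc f' g h := LinearMap.map_add₂ _ _ _ _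

lemma dgc_sub (f : (dgHom R X Y).X p) (g g' : (dgHom R Y Z).X q) (h : p + q = n) :
    dgc f (g - g') h = dgc f g h - dgc f g' h := map_sub _ _ _

lemma sub_dgc (f f' : (dgHom R X Y).X p) (g : (dgHom R Y Z).X q) (h : p + q = n) :
    dgc (f - f') g h = dgc f g h - dgc f' g h := LinearMap.map_sub₂ _ _ _ _

lemma dgc_neg (f : (dgHom R X Y).X p) (g : (dgHom R Y Z).X q) (h : p + q = n) :
    dgc f (-g) h = -dgc f g h := map_neg _ _

lemma neg_dgc (f : (dgHom R X Y).X p) (g : (dgHom R Y Z).X q) (h : p + q = n) :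
    dgc (-f) g h = -dgc f g h := LinearMap.map_neg₂ _ _ _

lemma dgc_smul (a : R) (f : (dgHom R X Y).X p) (g : (dgHom R Y Z).X q) (h : p + q = n) :
    dgc f (a • g) h = a • dgc f g h := map_smul _ _ _

lemma smul_dgc (a : R) (f : (dgHom R X Y).X p) (g : (dgHom R Y Z).X q) (h : p + q = n) :
    dgc (a • f) g h = a • dgc f g h := LinearMap.map_smul₂ _ _ _ _

lemma dgc_zero (f : (dgHom R X Y).X p) (h : p + q = n) :
    dgc f (0 : (dgHom R Y Z).X q) h = 0 := map_zero _

lemma zero_dgc (g : (dgHom R Y Z).X q) (h : p + q = n) :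
    dgc (0 : (dgHom R X Y).X p) g h = 0 := LinearMap.map_zero₂ _ _

lemma dgc_units (a : ℤˣ) (f : (dgHom R X Y).X p) (g : (dgHom R Y Z).X q) (h : p + q = n) :
    dgc f (a • g) h = a • dgc f g h := by
  obtain rfl | rfl := Int.units_eq_one_or a
  · simp
  · simp

lemma units_dgc (a : ℤˣ) (f : (dgHom R X Y).X p) (g : (dgHom R Y Z).X q) (h : p + q = n) :
    dgc (a • f) g h = a • dgc f g h := by
  obtain rfl | rfl := Int.units_eq_one_or a
  · simp
  · rw [Units.neg_smul, one_smul, neg_dgc, Units.neg_smul, one_smul]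

lemma idE_dgc (f : (dgHom R X Y).X n) (h : 0 + n = n := by lia) : dgc (idE R X) f h = f :=
  DGCategory.id_comp f

lemma dgc_idE (f : (dgHom R X Y).X n) (h : n + 0 = n := by lia) : dgc f (idE R Y) h = f :=
  DGCategory.comp_id f

lemma dgc_assoc {a b : ℤ} (f : (dgHom R X Y).X p) (g : (dgHom R Y Z).X q)
    (k : (dgHom R Z T).X r) (hpq : p + q = a) (hqr : q + r = b) (har : a + r = n)
    (hpb : p + b = n) : dgc (dgc f g hpq) k har = dgc f (dgc g k hqr) hpb :=
  DGCategory.assoc hpq hqr har hpb f g k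

lemma d_dgc {p' q' n' : ℤ} (f : (dgHom R X Y).X p) (g : (dgHom R Y Z).X q) (h : p + q = n)
    (hp : p + 1 = p') (hq : q + 1 = q') (hn : n + 1 = n') :
    (dgHom R X Z).d n n' (dgc f g h) =
      dgc f ((dgHom R Y Z).d q q' g) + q.negOnePow • dgc ((dgHom R X Y).d p p' f) g :=
  DGCategory.d_comp h hp hq hn (by lia) (by lia) f g

lemma d_dgc_of_cyc_left {q' n' : ℤ} {f : (dgHom R X Y).X p} (hf : f ∈ cyc _ p)
    (g : (dgHom R Y Z).X q) (h : p + q = n) (hq : q + 1 = q') (hn : n + 1 = n') :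
    (dgHom R X Z).d n n' (dgc f g h) = dgc f ((dgHom R Y Z).d q q' g) := by
  rw [d_dgc f g h rfl hq hn, d_of_mem_cyc hf, zero_dgc, smul_zero, add_zero]

lemma d_dgc_of_cyc_right {p' n' : ℤ} (f : (dgHom R X Y).X p)
    {g : (dgHom R Y Z).X q} (hg : g ∈ cyc _ q) (h : p + q = n) (hp : p + 1 = p')
    (hn : n + 1 = n') :
    (dgHom R X Z).d n n' (dgc f g h) = q.negOnePow • dgc ((dgHom R X Y).d p p' f) g := by
  rw [d_dgc f g h hp rfl hn, d_of_mem_cyc hg, dgc_zero, zero_add]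

lemma idE_mem_cyc (X : C) : idE R X ∈ cyc (dgHom R X X) 0 :=
  (mem_cyc_iff (zero_add 1) _).2 (DGCategory.d_ofHom _)

lemma ofHom_mem_cyc (f : X ⟶ Y) : DGCategory.ofHom (R := R) f ∈ cyc (dgHom R X Y) 0 :=
  (mem_cyc_iff (zero_add 1) _).2 (DGCategory.d_ofHom _)

lemma units_smul_mem (a : ℤˣ) {M : Type u} [AddCommGroup M] [Module R M] (S : Submodule R M)
    {z : M} (hz : z ∈ S) : a • z ∈ S := by
  obtain rfl | rfl := Int.units_eq_one_or a
  · simpa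
  · rw [Units.neg_smul, one_smul]
    exact neg_mem hz

lemma dgc_mem_cyc {f : (dgHom R X Y).X p} (hf : f ∈ cyc _ p) {g : (dgHom R Y Z).X q}
    (hg : g ∈ cyc _ q) (h : p + q = n) : dgc f g h ∈ cyc _ n := by
  rw [mem_cyc_iff rfl, d_dgc_of_cyc_left hf g h rfl rfl, d_of_mem_cyc hg, dgc_zero]

lemma dgc_mem_bdry_right {f : (dgHom R X Y).X p} (hf : f ∈ cyc _ p) {g : (dgHom R Y Z).X q}
    (hg : g ∈ bdry _ q) (h : p + q = n) : dgc f g h ∈ bdry _ n := by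
  obtain ⟨w, rfl⟩ := (mem_bdry_iff (sub_add_cancel q 1) g).1 hg
  exact (mem_bdry_iff (m := n - 1) (by lia) _).2
    ⟨dgc f w, d_dgc_of_cyc_left hf w (by lia) (by lia) (by lia)⟩

lemma dgc_mem_bdry_left {f : (dgHom R X Y).X p} (hf : f ∈ bdry _ p) {g : (dgHom R Y Z).X q}
    (hg : g ∈ cyc _ q) (h : p + q = n) : dgc f g h ∈ bdry _ n := by
  obtain ⟨w, rfl⟩ := (mem_bdry_iff (sub_add_cancel p 1) f).1 hf
  -- The Leibniz rule puts the sign `(-1)^q` on the differential of the left factor; the primitive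
  -- carries the same sign to cancel it.
  refine (mem_bdry_iff (m := n - 1) (by lia) _).2 ⟨q.negOnePow • dgc w g, ?_⟩
  have e := d_dgc_of_cyc_right (n := n - 1) (n' := n) w hg (by lia) (sub_add_cancel p 1) (by lia)
  rw [map_units_smul, e, smul_smul, ← Int.negOnePow_add, Int.negOnePow_even _ ⟨q, rfl⟩, one_smul]

end

variable (R) in
/-- The cohomology of the complex of morphisms. -/
abbrev HH (X Y : C) (n : ℤ) : Type u := H (dgHom R X Y) n

/-- Precomposition with a cocycle, on cohomology. -/
def pre {X Y : C} {e : ℤ} (g : (dgHom R X Y).X e) (hg : g ∈ cyc _ e) (N : C) {n m : ℤ}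
    (h : e + n = m) : HH R Y N n →ₗ[R] HH R X N m :=
  Hlift (DGCategory.comp h g) (fun _ hz => dgc_mem_cyc hg hz h)
    (fun _ hz => dgc_mem_bdry_right hg hz h)

/-- Postcomposition with a cocycle, on cohomology. -/
def post (X : C) {Y Z : C} {e : ℤ} (g : (dgHom R Y Z).X e) (hg : g ∈ cyc _ e) {n m : ℤ}
    (h : n + e = m) : HH R X Y n →ₗ[R] HH R X Z m :=
  Hlift ((DGCategory.comp h).flip g) (fun _ hz => dgc_mem_cyc hz hg h)
    (fun _ hz => dgc_mem_bdry_left hz hg h)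

section

variable {X Y Z N : C} {e n m : ℤ}

lemma pre_cls {g : (dgHom R X Y).X e} (hg : g ∈ cyc _ e) (h : e + n = m)
    {z : (dgHom R Y N).X n} (hz : z ∈ cyc _ n) :
    pre g hg N h (cls z hz) = cls (dgc g z h) (dgc_mem_cyc hg hz h) := rfl

lemma post_cls {g : (dgHom R Y Z).X e} (hg : g ∈ cyc _ e) (h : n + e = m)
    {z : (dgHom R X Y).X n} (hz : z ∈ cyc _ n) :
    post X g hg h (cls z hz) = cls (dgc z g h) (dgc_mem_cyc hz hg h) := rfl

lemma pre_congr {g g' : (dgHom R X Y).X e} (hg : g ∈ cyc _ e) (hg' : g' ∈ cyc _ e)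
    (hgg : g - g' ∈ bdry _ e) (h : e + n = m) : pre g hg N h = pre g' hg' N h := by
  refine LinearMap.ext fun a => ?_
  obtain ⟨z, hz, rfl⟩ := cls_surj a
  rw [pre_cls, pre_cls, cls_eq_iff, ← sub_dgc]
  exact dgc_mem_bdry_left hgg hz h

lemma post_congr {g g' : (dgHom R Y Z).X e} (hg : g ∈ cyc _ e) (hg' : g' ∈ cyc _ e)
    (hgg : g - g' ∈ bdry _ e) (h : n + e = m) : post X g hg h = post X g' hg' h := by
  refine LinearMap.ext fun a => ?_
  obtain ⟨z, hz, rfl⟩ := cls_surj a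
  rw [post_cls, post_cls, cls_eq_iff, ← dgc_sub]
  exact dgc_mem_bdry_right hz hgg h

lemma pre_idE (a : HH R X N n) : pre (idE R X) (idE_mem_cyc X) N (zero_add n) a = a := by
  obtain ⟨z, hz, rfl⟩ := cls_surj a
  rw [pre_cls]
  exact cls_congr (idE_dgc z) _

lemma post_idE (a : HH R X N n) : post X (idE R N) (idE_mem_cyc N) (add_zero n) a = a := by
  obtain ⟨z, hz, rfl⟩ := cls_surj a
  rw [post_cls]
  exact cls_congr (dgc_idE z) _

lemma pre_pre {e' s l : ℤ} {g : (dgHom R X Y).X e} (hg : g ∈ cyc _ e)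
    {g' : (dgHom R Y Z).X e'} (hg' : g' ∈ cyc _ e') (h' : e' + n = m) (h : e + m = l)
    (hs : e + e' = s) (a : HH R Z N n) :
    pre g hg N h (pre g' hg' N h' a) =
      pre (dgc g g' hs) (dgc_mem_cyc hg hg' hs) N (by lia : s + n = l) a := by
  obtain ⟨z, hz, rfl⟩ := cls_surj a
  rw [pre_cls, pre_cls, pre_cls]
  exact cls_congr (dgc_assoc _ _ _ _ _ _ _).symm _

lemma post_post {e' s l : ℤ} {g : (dgHom R X Y).X e} (hg : g ∈ cyc _ e)
    {g' : (dgHom R Y Z).X e'} (hg' : g' ∈ cyc _ e') (h : n + e = m) (h' : m + e' = l)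
    (hs : e + e' = s) (a : HH R N X n) :
    post N g' hg' h' (post N g hg h a) =
      post N (dgc g g' hs) (dgc_mem_cyc hg hg' hs) (by lia : n + s = l) a := by
  obtain ⟨z, hz, rfl⟩ := cls_surj a
  rw [post_cls, post_cls, post_cls]
  exact cls_congr (dgc_assoc _ _ _ _ _ _ _) _

end

/-- A cocycle that has an inverse up to coboundaries. -/
structure HInv {X Y : C} {e e' : ℤ} (g : (dgHom R X Y).X e) (g' : (dgHom R Y X).X e') : Prop where
  left : g ∈ cyc _ e
  right : g' ∈ cyc _ e'
  add : e + e' = 0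
  left_right : dgc g g' add - idE R X ∈ bdry _ 0
  right_left : dgc g' g ((add_comm _ _).trans add) - idE R Y ∈ bdry _ 0

namespace HInv

variable {X Y Z : C} {e e' : ℤ} {g : (dgHom R X Y).X e} {g' : (dgHom R Y X).X e'}

lemma symm (h : HInv g g') : HInv g' g :=
  ⟨h.right, h.left, (add_comm _ _).trans h.add, h.right_left, h.left_right⟩

lemma pre_bijective (h : HInv g g') (N : C) {n m : ℤ} (hm : e + n = m) :
    Function.Bijective (pre g h.left N hm) := by
  have hadd := h.add
  refine Function.bijective_iff_has_inverse.2
    ⟨pre g' h.right N (by lia : e' + m = n), fun a => ?_, fun a => ?_⟩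
  · rw [pre_pre h.right h.left hm _ ((add_comm _ _).trans h.add),
      pre_congr _ (idE_mem_cyc _) h.right_left, pre_idE]
  · rw [pre_pre h.left h.right _ hm h.add, pre_congr _ (idE_mem_cyc _) h.left_right, pre_idE]

lemma post_bijective (h : HInv g g') (N : C) {n m : ℤ} (hm : n + e = m) :
    Function.Bijective (post N g h.left hm) := by
  have hadd := h.add
  refine Function.bijective_iff_has_inverse.2
    ⟨post N g' h.right (by lia : m + e' = n), fun a => ?_, fun a => ?_⟩
  · rw [post_post h.left h.right hm _ h.add, post_congr _ (idE_mem_cyc _) h.left_right, post_idE]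
  · rw [post_post h.right h.left _ hm ((add_comm _ _).trans h.add),
      post_congr _ (idE_mem_cyc _) h.right_left, post_idE]

end HInv

/-! ### Cones -/

/-- The data exhibiting `Z` as the cone of the cocycle `f`. -/
structure ConeData {X Y : C} (f : (dgHom R X Y).X 0) (Z : C) where
  inl : (dgHom R X Z).X (-1)
  inr : (dgHom R Y Z).X 0
  fst : (dgHom R Z X).X 1
  snd : (dgHom R Z Y).X 0
  inl_fst : dgc inl fst (by lia) = idE R X
  inl_snd : dgc inl snd (add_zero (-1)) = 0
  inr_fst : dgc inr fst (zero_add 1) = 0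
  inr_snd : dgc inr snd (add_zero 0) = idE R Y
  total : dgc fst inl (by lia) + dgc snd inr (add_zero 0) = idE R Z
  d_inl : (dgHom R X Z).d (-1) 0 inl = dgc f inr (add_zero 0)
  inr_mem : inr ∈ cyc _ 0
  fst_mem : fst ∈ cyc _ 1
  d_snd : (dgHom R Z Y).d 0 1 snd = -dgc fst f (add_zero 1)

namespace ConeData

variable {X Y Z : C} {f : (dgHom R X Y).X 0} (c : ConeData f Z)

lemma decomp_left {N : C} {n : ℤ} (z : (dgHom R Z N).X n) :
    z = dgc c.fst (dgc c.inl z (by lia : -1 + n = n - 1)) (by lia) +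
      dgc c.snd (dgc c.inr z (zero_add n)) (zero_add n) := by
  rw [← dgc_assoc c.fst c.inl z (by lia) _ (zero_add n), ← dgc_assoc c.snd c.inr z (add_zero 0) _ (zero_add n),
    ← add_dgc, c.total, idE_dgc]

lemma decomp_right {N : C} {n : ℤ} (z : (dgHom R N Z).X n) :
    z = dgc (dgc z c.fst rfl) c.inl (by lia) +
      dgc (dgc z c.snd (add_zero n)) c.inr (add_zero n) := by
  rw [dgc_assoc z c.fst c.inl rfl (by lia) _ (add_zero n), dgc_assoc z c.snd c.inr _ (add_zero 0) _ (add_zero n),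
    ← dgc_add, c.total, dgc_idE]

lemma f_inr_mem_bdry : dgc f c.inr (add_zero 0) ∈ bdry (dgHom R X Z) 0 := by
  rw [← c.d_inl]
  exact d_mem_bdry _

lemma fst_f_mem_bdry : dgc c.fst f (add_zero 1) ∈ bdry (dgHom R Z Y) 1 := by
  rw [← neg_mem_iff, ← c.d_snd]
  exact d_mem_bdry _

lemma inl_dgc {N : C} {n m : ℤ} (a : (dgHom R X N).X m) (b : (dgHom R Y N).X n)
    (h : m + 1 = n) :
    dgc c.inl (dgc c.fst a (by lia) + dgc c.snd b (zero_add n)) (by lia : -1 + n = m) = a := by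
  rw [dgc_add, ← dgc_assoc c.inl c.fst a (by lia) _ (zero_add m), c.inl_fst, idE_dgc,
    ← dgc_assoc c.inl c.snd b (add_zero (-1)) _ (by lia), c.inl_snd, zero_dgc, add_zero]

lemma inr_dgc {N : C} {n m : ℤ} (a : (dgHom R X N).X m) (b : (dgHom R Y N).X n)
    (h : m + 1 = n) :
    dgc c.inr (dgc c.fst a (by lia) + dgc c.snd b (zero_add n)) (zero_add n) = b := by
  rw [dgc_add, ← dgc_assoc c.inr c.fst a (zero_add 1) _ (by lia), c.inr_fst, zero_dgc,
    ← dgc_assoc c.inr c.snd b (add_zero 0) _ (zero_add n), c.inr_snd, idE_dgc, zero_add]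

lemma d_inl_dgc {N : C} {n m l : ℤ} (z : (dgHom R Z N).X n) (hn : n + 1 = l) (hm : m + 1 = n) :
    (dgHom R X N).d m n (dgc c.inl z) = dgc c.inl ((dgHom R Z N).d n l z) +
      n.negOnePow • dgc f (dgc c.inr z (zero_add n)) (zero_add n) := by
  rw [d_dgc c.inl z (by lia) (neg_add_cancel 1) hn hm, c.d_inl,
    dgc_assoc f c.inr z (add_zero 0) (zero_add n)]

/-- A morphism out of the cone is a pair `(a, b)`. By this formula it is closed when `b` is closed
and `a` is, up to sign, a null-homotopy of `b ∘ f`. -/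
lemma d_dgc_fst_add_snd {N : C} {n m l : ℤ} (a : (dgHom R X N).X m) (b : (dgHom R Y N).X n)
    (hm : m + 1 = n) (hn : n + 1 = l) :
    (dgHom R Z N).d n l (dgc c.fst a (by lia) + dgc c.snd b (zero_add n)) =
      dgc c.fst ((dgHom R X N).d m n a - n.negOnePow • dgc f b (zero_add n)) (by lia) +
        dgc c.snd ((dgHom R Y N).d n l b) (zero_add l) := by
  rw [map_add, d_dgc_of_cyc_left c.fst_mem a (by lia) hm hn,
    d_dgc c.snd b (zero_add n) (zero_add 1) hn hn, c.d_snd, neg_dgc, dgc_sub, dgc_units,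
    dgc_assoc c.fst f b (add_zero 1) (zero_add n) _ (by lia), smul_neg]
  abel

section Exact

variable (N : C)

/-- This and the next five lemmas are the long exact sequences of morphisms out of a cone and into a
cone. Composites vanish because `inr ∘ f` and `f ∘ fst` are coboundaries and `fst ∘ inr` is zero. -/
lemma exact_pre_inr_f (hf : f ∈ cyc _ 0) (n : ℤ) : Function.Exact (pre c.inr c.inr_mem N (zero_add n))
    (pre f hf N (zero_add n)) := by
  intro a
  obtain ⟨y, hy, rfl⟩ := cls_surj a
  constructor
  · intro h
    rw [pre_cls, cls_eq_zero_iff, mem_bdry_iff (sub_add_cancel n 1)] at h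
    obtain ⟨w, hw⟩ := h
    -- The null-homotopy `w` of `y ∘ f` is exactly what is needed to extend `y` over the cone.
    have hz : dgc c.fst (n.negOnePow • w) (by lia) + dgc c.snd y (zero_add n) ∈
        cyc (dgHom R Z N) n := by
      rw [mem_cyc_iff rfl, c.d_dgc_fst_add_snd _ _ (sub_add_cancel n 1) rfl,
        map_units_smul, hw, sub_self, dgc_zero, d_of_mem_cyc hy, dgc_zero, add_zero]
    refine ⟨cls _ hz, ?_⟩
    rw [pre_cls]
    exact cls_congr (c.inr_dgc _ _ (sub_add_cancel n 1)) _
  · rintro ⟨b, hb⟩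
    rw [← hb, pre_pre hf c.inr_mem (zero_add n) (zero_add n) (add_zero 0)]
    obtain ⟨z, hz, rfl⟩ := cls_surj b
    rw [pre_cls, cls_eq_zero_iff]
    exact dgc_mem_bdry_left c.f_inr_mem_bdry hz _

lemma exact_pre_f_fst (hf : f ∈ cyc _ 0) {n m : ℤ} (h : 1 + n = m) : Function.Exact (pre f hf N (zero_add n))
    (pre c.fst c.fst_mem N h) := by
  intro a
  obtain ⟨x, hx, rfl⟩ := cls_surj a
  constructor
  · intro h0
    rw [pre_cls, cls_eq_zero_iff, mem_bdry_iff (m := n) (by lia)] at h0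
    obtain ⟨z, hz⟩ := h0
    have hy : dgc c.inr z (zero_add n) ∈ cyc (dgHom R Y N) n := by
      rw [mem_cyc_iff (m := m) (by lia), d_dgc_of_cyc_left c.inr_mem z (zero_add n)
        (by lia : n + 1 = m) (by lia), hz, ← dgc_assoc c.inr c.fst x (zero_add 1) _ (by lia),
        c.inr_fst, zero_dgc]
    refine ⟨cls _ (neg_mem (units_smul_mem n.negOnePow _ hy)), ?_⟩
    rw [pre_cls, cls_eq_iff, mem_bdry_iff (sub_add_cancel n 1)]
    have e := c.d_inl_dgc z (by lia : n + 1 = m) (sub_add_cancel n 1)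
    rw [hz, ← dgc_assoc c.inl c.fst x (by lia) _ (zero_add n), c.inl_fst, idE_dgc] at e
    refine ⟨-dgc c.inl z, ?_⟩
    rw [map_neg, e, dgc_neg, dgc_units]
    abel
  · rintro ⟨b, hb⟩
    rw [← hb, pre_pre c.fst_mem hf _ h (add_zero 1)]
    obtain ⟨z, hz, rfl⟩ := cls_surj b
    rw [pre_cls, cls_eq_zero_iff]
    exact dgc_mem_bdry_left c.fst_f_mem_bdry hz _

lemma exact_pre_fst_inr {n m : ℤ} (h : 1 + n = m) : Function.Exact (pre c.fst c.fst_mem N h)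
    (pre c.inr c.inr_mem N (zero_add m)) := by
  intro a
  obtain ⟨z, hz, rfl⟩ := cls_surj a
  constructor
  · intro h0
    rw [pre_cls, cls_eq_zero_iff, mem_bdry_iff (m := n) (by lia)] at h0
    obtain ⟨w, hw⟩ := h0
    -- Subtracting a coboundary makes the restriction to `Y` vanish strictly, so that the cocycle
    -- factors through `fst`.
    set z' := z - (dgHom R Z N).d n m (dgc c.snd w (zero_add n)) with hz'
    have hz'c : z' ∈ cyc _ m := sub_mem hz (bdry_le_cyc _ (d_mem_bdry _))
    have h1 : dgc c.inr z' (zero_add m) = 0 := by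
      rw [hz', dgc_sub, ← hw, ← d_dgc_of_cyc_left c.inr_mem (dgc c.snd w (zero_add n))
        (zero_add n) (by lia) (by lia), ← dgc_assoc c.inr c.snd w (add_zero 0) _ (zero_add n),
        c.inr_snd, idE_dgc, sub_self]
    have h2 : dgc c.inl z' (by lia : -1 + m = n) ∈ cyc (dgHom R X N) n := by
      rw [mem_cyc_iff (m := m) (by lia), c.d_inl_dgc z' rfl (by lia), h1, d_of_mem_cyc hz'c,
        dgc_zero, dgc_zero, smul_zero, add_zero]
    refine ⟨cls _ h2, ?_⟩
    rw [pre_cls, cls_eq_iff]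
    have h3 := c.decomp_left z'
    rw [h1, dgc_zero, add_zero] at h3
    obtain rfl : n = m - 1 := by lia
    rw [← h3, hz', sub_sub_cancel_left]
    exact neg_mem (d_mem_bdry _)
  · rintro ⟨b, hb⟩
    rw [← hb, pre_pre c.inr_mem c.fst_mem h (zero_add m) (zero_add 1)]
    obtain ⟨z, hz, rfl⟩ := cls_surj b
    rw [pre_cls, cls_eq_zero_iff, c.inr_fst, zero_dgc]
    exact Submodule.zero_mem _

lemma exact_post_f_inr (hf : f ∈ cyc _ 0) (n : ℤ) : Function.Exact (post N f hf (add_zero n))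
    (post N c.inr c.inr_mem (add_zero n)) := by
  intro a
  obtain ⟨y, hy, rfl⟩ := cls_surj a
  constructor
  · intro h
    rw [post_cls, cls_eq_zero_iff, mem_bdry_iff (sub_add_cancel n 1)] at h
    obtain ⟨z, hz⟩ := h
    have hx : dgc z c.fst (sub_add_cancel n 1) ∈ cyc (dgHom R N X) n := by
      rw [mem_cyc_iff rfl, d_dgc_of_cyc_right z c.fst_mem (sub_add_cancel n 1)
        (sub_add_cancel n 1) rfl, hz, dgc_assoc y c.inr c.fst (add_zero n) (zero_add 1) _ rfl,
        c.inr_fst, dgc_zero, smul_zero]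
    refine ⟨cls _ hx, ?_⟩
    rw [post_cls, cls_eq_iff, mem_bdry_iff (sub_add_cancel n 1)]
    refine ⟨-dgc z c.snd (add_zero _), ?_⟩
    rw [map_neg, d_dgc z c.snd (add_zero _) (sub_add_cancel n 1) (zero_add 1) (sub_add_cancel n 1),
      c.d_snd, hz, dgc_neg, ← dgc_assoc z c.fst f (sub_add_cancel n 1) _ (add_zero n) (by lia),
      dgc_assoc y c.inr c.snd (add_zero n) (add_zero 0) _ (add_zero n), c.inr_snd, dgc_idE,
      Int.negOnePow_zero, one_smul]
    abel
  · rintro ⟨b, hb⟩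
    rw [← hb, post_post hf c.inr_mem (add_zero n) (add_zero n) (add_zero 0)]
    obtain ⟨z, hz, rfl⟩ := cls_surj b
    rw [post_cls, cls_eq_zero_iff]
    exact dgc_mem_bdry_right hz c.f_inr_mem_bdry _

lemma exact_post_inr_fst (hf : f ∈ cyc _ 0) {n m : ℤ} (h : n + 1 = m) :
    Function.Exact (post N c.inr c.inr_mem (add_zero n)) (post N c.fst c.fst_mem h) := by
  intro a
  obtain ⟨z, hz, rfl⟩ := cls_surj a
  constructor
  · intro h0
    rw [post_cls, cls_eq_zero_iff, mem_bdry_iff h] at h0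
    obtain ⟨x, hx⟩ := h0
    -- The component of `z` in `Y` is not closed; its defect is compensated by `f` applied to the
    -- primitive `x` of the other component.
    have hy : dgc z c.snd (add_zero n) + dgc x f (add_zero n) ∈ cyc (dgHom R N Y) n := by
      rw [mem_cyc_iff h, map_add, d_dgc_of_cyc_left hz c.snd (add_zero n) (zero_add 1) h, c.d_snd,
        d_dgc_of_cyc_right x hf (add_zero n) h h, hx, Int.negOnePow_zero, one_smul, dgc_neg,
        dgc_assoc z c.fst f h (add_zero 1) _ h, neg_add_cancel]
    refine ⟨cls _ hy, ?_⟩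
    rw [post_cls, cls_eq_iff, mem_bdry_iff (sub_add_cancel n 1)]
    refine ⟨dgc x c.inl (by lia), ?_⟩
    rw [d_dgc x c.inl (by lia) h (neg_add_cancel 1) (sub_add_cancel n 1), c.d_inl, hx, add_dgc]
    have e := c.decomp_right z
    rw [← dgc_assoc x f c.inr (add_zero n) _ (add_zero n)]
    subst h
    rw [Int.negOnePow_neg, Int.negOnePow_one, Units.neg_smul, one_smul,
      eq_sub_of_add_eq e.symm]
    abel
  · rintro ⟨b, hb⟩
    rw [← hb, post_post c.inr_mem c.fst_mem _ h (zero_add 1)]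
    obtain ⟨z, hz, rfl⟩ := cls_surj b
    rw [post_cls, cls_eq_zero_iff, c.inr_fst, dgc_zero]
    exact Submodule.zero_mem _

lemma exact_post_fst_f (hf : f ∈ cyc _ 0) {n m : ℤ} (h : n + 1 = m) :
    Function.Exact (post N c.fst c.fst_mem h) (post N f hf (add_zero m)) := by
  intro a
  obtain ⟨x, hx, rfl⟩ := cls_surj a
  constructor
  · intro h0
    rw [post_cls, cls_eq_zero_iff, mem_bdry_iff h] at h0
    obtain ⟨y, hy⟩ := h0
    have hz : dgc x c.inl (by lia) - dgc y c.inr (add_zero n) ∈ cyc (dgHom R N Z) n := by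
      rw [mem_cyc_iff h, map_sub, d_dgc_of_cyc_left hx c.inl (by lia) (neg_add_cancel 1) h,
        c.d_inl, d_dgc_of_cyc_right y c.inr_mem (add_zero n) h h, hy, Int.negOnePow_zero, one_smul,
        dgc_assoc x f c.inr (add_zero m) (add_zero 0) _ (add_zero m), sub_self]
    refine ⟨cls _ hz, ?_⟩
    rw [post_cls]
    refine cls_congr ?_ _
    rw [sub_dgc, dgc_assoc x c.inl c.fst (by lia) (by lia) _ (add_zero m), c.inl_fst, dgc_idE,
      dgc_assoc y c.inr c.fst (add_zero n) (zero_add 1) _ h, c.inr_fst, dgc_zero, sub_zero]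
  · rintro ⟨b, hb⟩
    rw [← hb, post_post c.fst_mem hf h _ (add_zero 1)]
    obtain ⟨z, hz, rfl⟩ := cls_surj b
    rw [post_cls, cls_eq_zero_iff]
    exact dgc_mem_bdry_right hz c.fst_f_mem_bdry _

end Exact

end ConeData

/-! ### Action of a dg functor on cohomology and on cones -/

section

variable {D : Type w'} [Category.{v'} D] [DGCategory R D] (F : DGFunctor R C D)

lemma mapHom_dgc {X Y Z : C} {p q n : ℤ} (f : (dgHom R X Y).X p) (g : (dgHom R Y Z).X q)
    (h : p + q = n) : F.mapHom n (dgc f g h) = dgc (F.mapHom p f) (F.mapHom q g) h :=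
  F.mapHom_comp h f g

lemma mapHom_idE (X : C) : F.mapHom 0 (idE R X) = idE R (F.obj X) := by
  rw [F.mapHom_ofHom, F.map_id]

lemma mapHom_mem_cyc {X Y : C} {n : ℤ} {f : (dgHom R X Y).X n} (hf : f ∈ cyc _ n) :
    F.mapHom n f ∈ cyc _ n := by
  rw [mem_cyc_iff rfl, ← F.mapHom_d rfl, d_of_mem_cyc hf, map_zero]

lemma mapHom_mem_bdry {X Y : C} {n : ℤ} {f : (dgHom R X Y).X n} (hf : f ∈ bdry _ n) :
    F.mapHom n f ∈ bdry _ n := by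
  obtain ⟨w, rfl⟩ := (mem_bdry_iff (sub_add_cancel n 1) f).1 hf
  rw [F.mapHom_d (sub_add_cancel n 1)]
  exact d_mem_bdry _

/-- The action of a dg functor on cohomology. -/
def mapHH (X Y : C) (n : ℤ) : HH R X Y n →ₗ[R] HH R (F.obj X) (F.obj Y) n :=
  Hlift (F.mapHom n) (fun _ hz => mapHom_mem_cyc F hz) (fun _ hz => mapHom_mem_bdry F hz)

lemma HInv.map {X Y : C} {e e' : ℤ} {g : (dgHom R X Y).X e} {g' : (dgHom R Y X).X e'}
    (h : HInv g g') : HInv (F.mapHom e g) (F.mapHom e' g') where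
  left := mapHom_mem_cyc F h.left
  right := mapHom_mem_cyc F h.right
  add := h.add
  left_right := by
    rw [← mapHom_dgc, ← mapHom_idE, ← map_sub]
    exact mapHom_mem_bdry F h.left_right
  right_left := by
    rw [← mapHom_dgc, ← mapHom_idE, ← map_sub]
    exact mapHom_mem_bdry F h.right_left

/-- A dg functor preserves cones. -/
def ConeData.map {X Y Z : C} {f : (dgHom R X Y).X 0} (c : ConeData f Z) :
    ConeData (F.mapHom 0 f) (F.obj Z) where
  inl := F.mapHom _ c.inl
  inr := F.mapHom _ c.inr
  fst := F.mapHom _ c.fst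
  snd := F.mapHom _ c.snd
  inl_fst := by rw [← mapHom_dgc, c.inl_fst, mapHom_idE]
  inl_snd := by rw [← mapHom_dgc, c.inl_snd, map_zero]
  inr_fst := by rw [← mapHom_dgc, c.inr_fst, map_zero]
  inr_snd := by rw [← mapHom_dgc, c.inr_snd, mapHom_idE]
  total := by rw [← mapHom_dgc, ← mapHom_dgc, ← map_add, c.total, mapHom_idE]
  d_inl := by rw [← mapHom_dgc, ← F.mapHom_d (neg_add_cancel 1), c.d_inl]
  inr_mem := mapHom_mem_cyc F c.inr_mem
  fst_mem := mapHom_mem_cyc F c.fst_mem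
  d_snd := by rw [← mapHom_dgc, ← F.mapHom_d (zero_add 1), c.d_snd, map_neg]

end

end DGCalculus

end

end BGG

namespace BGG

noncomputable section

section Projective

open Cx

variable {R : Type u} [CommRing R] {C : Type w} [Category.{v} C] [DGCategory R C]

/-! ### Acyclic and K-projective objects relative to a unit object -/

lemma smul_idE_mem_cyc (x : R) (X : C) : x • idE R X ∈ cyc (dgHom R X X) 0 :=
  Submodule.smul_mem _ x (idE_mem_cyc X)

lemma pre_smul_idE (x : R) {X N : C} {n : ℤ} (a : HH R X N n) :
    pre (x • idE R X) (smul_idE_mem_cyc x X) N (zero_add n) a = x • a := by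
  obtain ⟨z, hz, rfl⟩ := cls_surj a
  rw [pre_cls, cls_smul]
  exact cls_congr (by rw [smul_dgc, idE_dgc]) _

lemma post_smul_idE (x : R) {X N : C} {n : ℤ} (a : HH R N X n) :
    post N (x • idE R X) (smul_idE_mem_cyc x X) (add_zero n) a = x • a := by
  obtain ⟨z, hz, rfl⟩ := cls_surj a
  rw [post_cls, cls_smul]
  exact cls_congr (by rw [dgc_smul, dgc_idE]) _

variable (R) in
/-- Acyclicity of `N`, tested by morphisms from `U`. -/
def Acy (U N : C) : Prop := ∀ n, Subsingleton (HH R U N n)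

variable (R) in
/-- K-projectivity relative to the acyclic objects tested by `U`. -/
def KProj (U X : C) : Prop := ∀ N, Acy R U N → ∀ n, Subsingleton (HH R X N n)

/-- Acyclicity is itself defined by morphisms from `U`. Taking for `U` the ring in degree `0`, or a
dg algebra as a module over itself, treats complexes and dg modules by the same arguments. -/
lemma kProj_self (U : C) : KProj R U U := fun _ h => h

/-- Quasi-isomorphisms of degree `e`, tested by morphisms from `U`. -/
def QIs (U : C) {X Y : C} {e : ℤ} (g : (dgHom R X Y).X e) : Prop :=
  ∃ hg : g ∈ cyc _ e, ∀ ⦃n m : ℤ⦄ (h : n + e = m), Function.Bijective (post U g hg h)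

lemma HInv.qis {X Y : C} {e e' : ℤ} {g : (dgHom R X Y).X e} {g' : (dgHom R Y X).X e'}
    (h : HInv g g') (U : C) : QIs U g :=
  ⟨h.left, fun _ _ hm => h.post_bijective U hm⟩

lemma QIs.comp {U X Y Z : C} {e e' s : ℤ} {g : (dgHom R X Y).X e} {g' : (dgHom R Y Z).X e'}
    (hg : QIs U g) (hg' : QIs U g') (h : e + e' = s) : QIs U (dgc g g' h) := by
  obtain ⟨hg, H⟩ := hg
  obtain ⟨hg', H'⟩ := hg'
  refine ⟨dgc_mem_cyc hg hg' h, fun n m hm => ?_⟩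
  have e : ⇑(post U (dgc g g' h) (dgc_mem_cyc hg hg' h) hm) =
      post U g' hg' (by lia : n + e + e' = m) ∘ post U g hg rfl :=
    funext fun a => (post_post hg hg' rfl _ h a).symm
  rw [e]
  exact (H' _).comp (H _)

variable (R C) in
/-- Existence of cones in a dg category. -/
def HasCones : Prop := ∀ ⦃X Y : C⦄ (f : (dgHom R X Y).X 0), f ∈ cyc _ 0 →
  ∃ Z, Nonempty (ConeData f Z)

lemma bijective_of_exact_of_subsingleton {A B Z Z' : Type*} [AddCommGroup A] [AddCommGroup B]
    [AddCommGroup Z] [AddCommGroup Z'] [Module R A] [Module R B] [Module R Z] [Module R Z']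
    {i : Z' →ₗ[R] A} {f : A →ₗ[R] B} {j : B →ₗ[R] Z} [Subsingleton Z] [Subsingleton Z']
    (h₁ : Function.Exact i f) (h₂ : Function.Exact f j) : Function.Bijective f := by
  constructor
  · rw [injective_iff_map_eq_zero]
    intro a ha
    obtain ⟨z, rfl⟩ := (h₁ a).1 ha
    rw [Subsingleton.elim z 0, map_zero]
  · intro b
    exact (h₂ b).1 (Subsingleton.elim _ _)

lemma subsingleton_of_exact {A B Z A' B' : Type*} [AddCommGroup A] [AddCommGroup B]
    [AddCommGroup Z] [AddCommGroup A'] [AddCommGroup B'] [Module R A] [Module R B] [Module R Z]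
    [Module R A'] [Module R B'] {f : A →ₗ[R] B} {j : B →ₗ[R] Z} {k : Z →ₗ[R] A'}
    {f' : A' →ₗ[R] B'} (hf : Function.Surjective f) (hf' : Function.Injective f')
    (h₁ : Function.Exact f j) (h₂ : Function.Exact j k) (h₃ : Function.Exact k f') :
    Subsingleton Z := by
  refine subsingleton_of_forall_eq 0 fun z => ?_
  have hk : k z = 0 := hf' (by rw [map_zero]; exact (h₃ _).2 ⟨z, rfl⟩)
  obtain ⟨b, rfl⟩ := (h₂ z).1 hk
  obtain ⟨a, rfl⟩ := hf b
  exact (h₁ _).2 ⟨a, rfl⟩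

namespace ConeData

variable {X Y Z : C} {f : (dgHom R X Y).X 0}

lemma post_bijective (c : ConeData f Z) (N : C) (hf : f ∈ cyc _ 0) (h : ∀ n, Subsingleton (HH R N Z n)) (n : ℤ) :
    Function.Bijective (post N f hf (add_zero n)) :=
  haveI := h n
  haveI := h (n - 1)
  bijective_of_exact_of_subsingleton (c.exact_post_fst_f N hf (sub_add_cancel n 1))
    (c.exact_post_f_inr N hf n)

lemma subsingleton_post (c : ConeData f Z) (N : C) (hf : f ∈ cyc _ 0)
    (h : ∀ n, Function.Bijective (post N f hf (add_zero n))) (n : ℤ) :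
    Subsingleton (HH R N Z n) :=
  subsingleton_of_exact (h n).2 (h (n + 1)).1 (c.exact_post_f_inr N hf n)
    (c.exact_post_inr_fst N hf rfl) (c.exact_post_fst_f N hf rfl)

lemma pre_bijective (c : ConeData f Z) (N : C) (hf : f ∈ cyc _ 0) (h : ∀ n, Subsingleton (HH R Z N n)) (n : ℤ) :
    Function.Bijective (pre f hf N (zero_add n)) :=
  haveI := h n
  haveI := h (n + 1)
  bijective_of_exact_of_subsingleton (c.exact_pre_inr_f N hf n)
    (c.exact_pre_f_fst N hf (add_comm 1 n))

lemma subsingleton_pre (c : ConeData f Z) (N : C) (hf : f ∈ cyc _ 0)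
    (h : ∀ n, Function.Bijective (pre f hf N (zero_add n))) (n : ℤ) :
    Subsingleton (HH R Z N n) :=
  subsingleton_of_exact (h (n - 1)).2 (h n).1 (c.exact_pre_f_fst N hf (by lia))
    (c.exact_pre_fst_inr N (by lia)) (c.exact_pre_inr_f N hf n)

lemma acy (c : ConeData f Z) (U : C) (hf : QIs U f) : Acy R U Z :=
  c.subsingleton_post U hf.1 fun _ => hf.2 _

lemma kProj (c : ConeData f Z) {U : C} (hf : f ∈ cyc _ 0) (hX : KProj R U X) (hY : KProj R U Y) :
    KProj R U Z := fun N hN n =>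
  c.subsingleton_pre N hf (fun m => by
    haveI := hX N hN m
    haveI := hY N hN m
    exact ⟨fun _ _ _ => Subsingleton.elim _ _, fun b => ⟨0, Subsingleton.elim _ _⟩⟩) n

end ConeData

/-- The cone of a quasi-isomorphism is acyclic, so a K-projective object has no morphisms to it, and
the long exact sequence gives bijectivity. -/
lemma KProj.post_bijective {U X N N' : C} (hC : HasCones R C) (hX : KProj R U X)
    {g : (dgHom R N N').X 0} (hg : QIs U g) (n : ℤ) :
    Function.Bijective (post X g hg.1 (add_zero n)) := by
  obtain ⟨Z, ⟨c⟩⟩ := hC g hg.1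
  exact c.post_bijective X hg.1 (hX Z (c.acy U hg)) n

/-- A quasi-isomorphism between K-projective objects is a homotopy equivalence. -/
lemma exists_hInv {U X Y : C} (hC : HasCones R C) (hX : KProj R U X) (hY : KProj R U Y)
    {g : (dgHom R X Y).X 0} (hg : QIs U g) : ∃ g' : (dgHom R Y X).X 0, HInv g g' := by
  -- Lifting the identity of `Y` along `g` gives a one-sided inverse.
  obtain ⟨a, ha⟩ := (hY.post_bijective hC hg 0).2 (cls (idE R Y) (idE_mem_cyc Y))
  obtain ⟨g', hg', rfl⟩ := cls_surj a
  rw [post_cls, cls_eq_iff] at ha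
  refine ⟨g', hg.1, hg', add_zero 0, ?_, ha⟩
  rw [← cls_eq_iff (dgc_mem_cyc hg.1 hg' _) (idE_mem_cyc X)]
  -- It is an inverse on the other side too: both candidates agree after composition with `g`, which
  -- is injective on morphisms from `X`.
  apply (hX.post_bijective hC hg 0).1
  rw [post_cls, post_cls, cls_eq_iff, dgc_assoc g g' g _ (add_zero 0) _ (add_zero 0), idE_dgc]
  have := dgc_mem_bdry_right hg.1 ha (add_zero 0)
  rwa [dgc_sub, dgc_idE] at this

lemma HInv.kProj {U X Y : C} {e e' : ℤ} {g : (dgHom R X Y).X e} {g' : (dgHom R Y X).X e'}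
    (h : HInv g g') (hX : KProj R U X) : KProj R U Y := fun N hN n =>
  haveI := hX N hN (e + n)
  (h.pre_bijective N rfl).1.subsingleton

/-! ### Telescopes -/

/-- The sequence shifted to the right. -/
def prev {A : Type*} [Zero A] (f : ℕ → A) : ℕ → A
  | 0 => 0
  | i + 1 => f i

/-- The data exhibiting `T` as the fibre of `t - x` on the sum of countably many copies of `M`,
where `t` is the left translation. -/
structure TelData (x : R) (M T : C) where
  u : ℕ → (dgHom R M T).X 0
  v : ℕ → (dgHom R M T).X 1
  d_u (i : ℕ) : (dgHom R M T).d 0 1 (u i) = prev v i - x • v i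
  v_mem (i : ℕ) : v i ∈ cyc _ 1
  lift {N : C} {n : ℤ} (a : ℕ → (dgHom R M N).X n) (b : ℕ → (dgHom R M N).X (n + 1)) :
    (dgHom R T N).X n
  u_lift {N : C} {n : ℤ} (a : ℕ → (dgHom R M N).X n) (b : ℕ → (dgHom R M N).X (n + 1)) (i : ℕ) :
    dgc (u i) (lift a b) (zero_add n) = a i
  v_lift {N : C} {n : ℤ} (a : ℕ → (dgHom R M N).X n) (b : ℕ → (dgHom R M N).X (n + 1)) (i : ℕ) :
    dgc (v i) (lift a b) (add_comm 1 n) = b i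
  ext {N : C} {n : ℤ} {z z' : (dgHom R T N).X n}
    (h : ∀ i, dgc (u i) z (zero_add n) = dgc (u i) z' (zero_add n))
    (h' : ∀ i, dgc (v i) z (add_comm 1 n) = dgc (v i) z' (add_comm 1 n)) : z = z'

namespace TelData

variable {x : R} {M T N M' T' M'' T'' : C} (t : TelData x M T) (t' : TelData x M' T')
  (t'' : TelData x M'' T'')

lemma d_u_dgc {n : ℤ} (z : (dgHom R T N).X n) (i : ℕ) :
    dgc ((dgHom R M T).d 0 1 (t.u i)) z (add_comm 1 n) =
      prev (fun j => dgc (t.v j) z (add_comm 1 n)) i - x • dgc (t.v i) z (add_comm 1 n) := by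
  rw [t.d_u, sub_dgc, smul_dgc]
  cases i with
  | zero => rw [prev, prev, zero_dgc]
  | succ i => rfl

/-- Together with `v_d` this is the differential of `Hom(T, N)` in the coordinates given by the `u
i` and `v i`. All computations with telescopes take place in these coordinates. -/
lemma u_d {n m : ℤ} (h : n + 1 = m) (z : (dgHom R T N).X n) (i : ℕ) :
    dgc (t.u i) ((dgHom R T N).d n m z) (zero_add m) =
      (dgHom R M N).d n m (dgc (t.u i) z (zero_add n)) - n.negOnePow •
        (prev (fun j => dgc (t.v j) z (by lia : 1 + n = m)) i - x • dgc (t.v i) z) := by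
  subst h
  rw [d_dgc (t.u i) z (zero_add n) (zero_add 1) rfl rfl, t.d_u_dgc, add_sub_cancel_right]

lemma v_d {n m l : ℤ} (h : n + 1 = m) (hm : m + 1 = l) (z : (dgHom R T N).X n) (i : ℕ) :
    dgc (t.v i) ((dgHom R T N).d n m z) (by lia : 1 + m = l) =
      (dgHom R M N).d m l (dgc (t.v i) z) :=
  (d_dgc_of_cyc_left (t.v_mem i) z (by lia) h hm).symm

/-- The projection to the first summand. -/
def pr : (dgHom R T M).X 0 := t.lift (fun i => if i = 0 then idE R M else 0) (fun _ => 0)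

lemma u_pr (i : ℕ) : dgc (t.u i) t.pr (add_zero 0) = if i = 0 then idE R M else 0 :=
  t.u_lift _ _ i

lemma v_pr (i : ℕ) : dgc (t.v i) t.pr (add_zero 1) = 0 := t.v_lift _ _ i

lemma prev_zero {A : Type*} [Zero A] (i : ℕ) : prev (fun _ => (0 : A)) i = 0 := by
  cases i <;> rfl

lemma pr_mem : t.pr ∈ cyc _ 0 := by
  rw [mem_cyc_iff (zero_add 1)]
  refine t.ext (fun i => ?_) (fun i => ?_)
  · rw [t.u_d (zero_add 1), t.u_pr]
    simp only [t.v_pr, prev_zero, smul_zero, sub_zero, dgc_zero]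
    split_ifs
    · exact d_of_mem_cyc (idE_mem_cyc M)
    · exact map_zero _
  · rw [t.v_d (zero_add 1) (l := 2) rfl, t.v_pr, map_zero, dgc_zero]

/-- Functoriality of telescopes. -/
def tmap {n : ℤ} (z : (dgHom R M M').X n) : (dgHom R T T').X n :=
  -- The sign is the Koszul sign for moving `z` past `v i`, which has degree `1`.
  t.lift (fun i => dgc z (t'.u i) (add_zero n)) (fun i => n.negOnePow • dgc z (t'.v i) rfl)

lemma u_tmap {n : ℤ} (z : (dgHom R M M').X n) (i : ℕ) :
    dgc (t.u i) (t.tmap t' z) (zero_add n) = dgc z (t'.u i) (add_zero n) := t.u_lift _ _ i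

lemma v_tmap {n : ℤ} (z : (dgHom R M M').X n) (i : ℕ) :
    dgc (t.v i) (t.tmap t' z) (add_comm 1 n) = n.negOnePow • dgc z (t'.v i) rfl :=
  t.v_lift _ _ i

lemma tmap_add {n : ℤ} (z z' : (dgHom R M M').X n) :
    t.tmap t' (z + z') = t.tmap t' z + t.tmap t' z' := by
  refine t.ext (fun i => ?_) (fun i => ?_)
  · rw [dgc_add, u_tmap, u_tmap, u_tmap, add_dgc]
  · rw [dgc_add, v_tmap, v_tmap, v_tmap, add_dgc, smul_add]

lemma tmap_smul {n : ℤ} (r : R) (z : (dgHom R M M').X n) :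
    t.tmap t' (r • z) = r • t.tmap t' z := by
  refine t.ext (fun i => ?_) (fun i => ?_)
  · rw [dgc_smul, u_tmap, u_tmap, smul_dgc]
  · rw [dgc_smul, v_tmap, v_tmap, smul_dgc, smul_comm]

lemma tmap_idE : t.tmap t (idE R M) = idE R T := by
  refine t.ext (fun i => ?_) (fun i => ?_)
  · rw [u_tmap, idE_dgc, dgc_idE]
  · rw [v_tmap, idE_dgc _ (zero_add 1), dgc_idE, Int.negOnePow_zero, one_smul]

lemma tmap_dgc {p q n : ℤ} (z : (dgHom R M M').X p) (z' : (dgHom R M' M'').X q)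
    (h : p + q = n) :
    t.tmap t'' (dgc z z' h) = dgc (t.tmap t' z) (t'.tmap t'' z') h := by
  refine t.ext (fun i => ?_) (fun i => ?_)
  · rw [u_tmap, ← dgc_assoc (t.u i) (t.tmap t' z) (t'.tmap t'' z') (zero_add p) h h, u_tmap,
      dgc_assoc z (t'.u i) _ (add_zero p) (zero_add q) h h, u_tmap,
      dgc_assoc z z' _ h (add_zero q)]
  · rw [v_tmap, ← dgc_assoc (t.v i) (t.tmap t' z) (t'.tmap t'' z') (add_comm 1 p) h (by lia),
      v_tmap, units_dgc, dgc_assoc z (t'.v i) _ rfl (add_comm 1 q) _ (by lia), v_tmap,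
      dgc_units, dgc_assoc z z' _ h rfl _ (by lia), smul_smul, ← Int.negOnePow_add, h]

lemma d_tmap {n m : ℤ} (h : n + 1 = m) (z : (dgHom R M M').X n) :
    t.tmap t' ((dgHom R M M').d n m z) = (dgHom R T T').d n m (t.tmap t' z) := by
  subst h
  refine t.ext (fun i => ?_) (fun i => ?_)
  · rw [u_tmap, t.u_d rfl, u_tmap, d_dgc z (t'.u i) (add_zero n) rfl (zero_add 1) rfl, t'.d_u,
      Int.negOnePow_zero, one_smul]
    have e : prev (fun j => dgc (t.v j) (t.tmap t' z) (add_comm 1 n)) i -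
        x • dgc (t.v i) (t.tmap t' z) (add_comm 1 n) =
        n.negOnePow • dgc z (prev t'.v i - x • t'.v i) rfl := by
      rw [dgc_sub, dgc_smul, smul_sub, smul_comm _ x, v_tmap]
      congr 1
      cases i with
      | zero => rw [prev, prev, dgc_zero, smul_zero]
      | succ i => exact t.v_tmap t' z i
    rw [e, smul_smul, ← Int.negOnePow_add, Int.negOnePow_even _ ⟨n, rfl⟩, one_smul,
      add_sub_cancel_left]
  · rw [v_tmap, t.v_d rfl rfl, v_tmap, map_units_smul,
      d_dgc_of_cyc_right z (t'.v_mem i) rfl rfl rfl, smul_smul, ← Int.negOnePow_add]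

/-- Naturality of the projection in all degrees is what lets the comparison maps for a telescope be
computed on the object itself. -/
lemma tmap_pr {n : ℤ} (z : (dgHom R M M').X n) :
    dgc (t.tmap t' z) t'.pr (add_zero n) = dgc t.pr z (zero_add n) := by
  refine t.ext (fun i => ?_) (fun i => ?_)
  · rw [← dgc_assoc (t.u i) _ t'.pr (zero_add n) _ (add_zero n), u_tmap,
      dgc_assoc z _ t'.pr _ (add_zero 0) _ (add_zero n), u_pr,
      ← dgc_assoc (t.u i) t.pr z (add_zero 0) _ (zero_add n), u_pr]
    split_ifs
    · rw [dgc_idE, idE_dgc]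
    · rw [dgc_zero, zero_dgc]
  · rw [← dgc_assoc (t.v i) _ t'.pr (add_comm 1 n) _ (add_zero _), v_tmap, units_dgc,
      dgc_assoc z _ t'.pr _ (add_zero 1) _ rfl, v_pr,
      ← dgc_assoc (t.v i) t.pr z (add_zero 1) _ (add_comm 1 n), v_pr, dgc_zero, smul_zero,
      zero_dgc]

/-- If `x` acts bijectively on morphisms from `M` to `N` then there are no morphisms from the
telescope to `N`. -/
lemma subsingleton_of_bijective (t : TelData x M T)
    (h : ∀ n, Function.Bijective fun a : HH R M N n => x • a) (n : ℤ) :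
    Subsingleton (HH R T N n) := by
  rw [subsingleton_H_iff]
  intro z hz
  obtain ⟨m, rfl⟩ : ∃ m, m + 1 = n := ⟨n - 1, sub_add_cancel n 1⟩
  set s := (m + 1).negOnePow with hs
  set a : ℕ → (dgHom R M N).X (m + 1) := fun i => dgc (t.u i) z (zero_add _) with ha
  set b : ℕ → (dgHom R M N).X (m + 1 + 1) := fun i => dgc (t.v i) z (add_comm 1 _) with hb
  have hb' (i) : (b i) ∈ cyc _ _ := dgc_mem_cyc (t.v_mem i) hz _
  have hda (i) : (dgHom R M N).d _ _ (a i) = s • (prev b i - x • b i) := by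
    have := t.u_d rfl z i
    rwa [d_of_mem_cyc hz, dgc_zero, eq_comm, sub_eq_zero] at this
  -- Primitives of the `b i` are chosen recursively. Since `x b_i` is exact and `x` is injective on
  -- cohomology, `b_i` has a primitive. Surjectivity of `x` then allows the primitive to be
  -- corrected by a cocycle so that it fits with `a_i` and the previous primitive `p`.
  have key (i : ℕ) (p : (dgHom R M N).X (m + 1)) (hp : (dgHom R M N).d _ _ p = prev b i) :
      ∃ q : (dgHom R M N).X (m + 1), (dgHom R M N).d _ _ q = b i ∧
        ∃ r : (dgHom R M N).X m, (dgHom R M N).d _ _ r = a i - s • (p - x • q) := by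
    have h1 : b i ∈ bdry _ _ := by
      rw [← cls_eq_zero_iff _ (hb' i)]
      apply (h _).1
      dsimp only
      rw [smul_zero, cls_smul, cls_eq_zero_iff, mem_bdry_iff rfl]
      refine ⟨p - s • a i, ?_⟩
      rw [map_sub, hp, map_units_smul, hda, smul_smul, hs, ← Int.negOnePow_add,
        Int.negOnePow_even _ ⟨_, rfl⟩, one_smul, sub_sub_cancel]
    obtain ⟨c, hc⟩ := (mem_bdry_iff rfl _).1 h1
    have he : a i - s • (p - x • c) ∈ cyc _ (m + 1) := by
      rw [mem_cyc_iff rfl, map_sub, hda, map_units_smul, map_sub, map_smul, hp, hc, sub_self]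
    obtain ⟨y, hy⟩ := (h _).2 (cls _ he)
    obtain ⟨y, hyc, rfl⟩ := cls_surj y
    dsimp only at hy
    rw [cls_smul, eq_comm, cls_eq_iff, mem_bdry_iff rfl] at hy
    obtain ⟨r, hr⟩ := hy
    refine ⟨c - s • y, by rw [map_sub, hc, map_units_smul, d_of_mem_cyc hyc, smul_zero, sub_zero],
      r, ?_⟩
    rw [hr, smul_sub x, smul_sub, smul_sub, smul_sub, smul_comm x s y, smul_smul s s, hs,
      ← Int.negOnePow_add, Int.negOnePow_even _ ⟨_, rfl⟩, one_smul]
    abel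
  choose! q hq r hr using key
  -- The recursion starts from the zero primitive, in accordance with `prev b 0 = 0`.
  let c : ℕ → (dgHom R M N).X (m + 1) := fun i => Nat.rec (q 0 0) (fun i p => q (i + 1) p) i
  have hc (i) : (dgHom R M N).d _ _ (c i) = b i := by
    induction i with
    | zero => exact hq 0 0 (map_zero _)
    | succ i ih => exact hq (i + 1) (c i) ih
  have hc' (i) : (dgHom R M N).d _ _ (prev c i) = prev b i := by
    cases i with
    | zero => exact map_zero _
    | succ i => exact hc i
  have hqc (i) : q i (prev c i) = c i := by cases i <;> rfl
  refine (mem_bdry_iff rfl z).2 ⟨t.lift (fun i => r i (prev c i)) c, t.ext (fun i => ?_)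
    (fun i => ?_)⟩
  · rw [t.u_d rfl, u_lift, hr i _ (hc' i), hqc]
    simp only [v_lift]
    rw [hs, Int.negOnePow_succ, Units.neg_smul, sub_neg_eq_add, add_sub_cancel_right]
  · rw [t.v_d rfl rfl, v_lift, hc]

end TelData

end Projective

end

end BGG

namespace BGG

noncomputable section

/-! ### Derived completeness along an element -/

section Complete

variable {R : Type u} [CommRing R] (x : R) {A B : Type*} [AddCommGroup A] [Module R A]
  [AddCommGroup B] [Module R B]

/-- The endomorphism `(c_n) ↦ (c_n - x c_{n+1})` of sequences. -/
def shiftMap (A : Type*) [AddCommGroup A] [Module R A] : (ℕ → A) →ₗ[R] (ℕ → A) where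
  toFun c n := c n - x • c (n + 1)
  map_add' c c' := by
    ext n
    simp only [Pi.add_apply, smul_add]
    abel
  map_smul' r c := by
    ext n
    simp only [Pi.smul_apply, smul_sub, RingHom.id_apply, smul_comm x r]

lemma shiftMap_apply (c : ℕ → A) (n : ℕ) : shiftMap x A c n = c n - x • c (n + 1) := rfl

/-- A module is derived complete along `x` if `(c_n) ↦ (c_n - x c_{n+1})` is bijective. -/
def DC (A : Type*) [AddCommGroup A] [Module R A] : Prop := Function.Bijective (shiftMap x A)

variable {x}

/-- Such a sequence lies in the kernel of `shiftMap`. This is the form in which the injectivity half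
of completeness is applied. -/
lemma DC.eq_zero (h : DC x A) (c : ℕ → A) (hc : ∀ n, c n = x • c (n + 1)) (n : ℕ) : c n = 0 := by
  have : c = 0 := h.1 (by
    rw [map_zero]
    ext n
    rw [shiftMap_apply, ← hc n, sub_self]
    rfl)
  rw [this]
  rfl

/-- Nakayama's lemma without finiteness: iterating a choice of division by `x` produces a compatible
sequence starting at any given element. -/
lemma DC.subsingleton (h : DC x A) (hx : ∀ a : A, ∃ b, x • b = a) : Subsingleton A := by
  choose s hs using hx
  refine subsingleton_of_forall_eq 0 fun a => ?_
  exact h.eq_zero (fun n => s^[n] a)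
    (fun n => by rw [Function.iterate_succ_apply', hs]) 0

lemma DC.of_subsingleton [Subsingleton A] : DC x A :=
  ⟨fun _ _ _ => Subsingleton.elim _ _, fun _ => ⟨0, Subsingleton.elim _ _⟩⟩

lemma DC.of_linearEquiv (h : DC x A) (e : A ≃ₗ[R] B) : DC x B := by
  have h1 : (shiftMap x B) ∘ (fun c n => e (c n)) = (fun c n => e (c n)) ∘ (shiftMap x A) := by
    ext c n
    simp [shiftMap_apply]
  have he : Function.Bijective (fun (c : ℕ → A) n => e (c n)) :=
    (Equiv.arrowCongr (Equiv.refl ℕ) e.toEquiv).bijective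
  rw [DC, ← Function.Bijective.of_comp_iff _ he, h1]
  exact he.comp h

/-- The map on sequences induced by a linear map. -/
def seqMap (f : A →ₗ[R] B) : (ℕ → A) →ₗ[R] (ℕ → B) := f.compLeft ℕ

lemma seqMap_exact {C : Type*} [AddCommGroup C] [Module R C] {f : A →ₗ[R] B} {g : B →ₗ[R] C}
    (h : Function.Exact f g) : Function.Exact (seqMap f) (seqMap g) := by
  intro b
  constructor
  · intro hb
    choose a ha using fun n => (h (b n)).1 (congrFun hb n)
    exact ⟨a, funext ha⟩
  · rintro ⟨a, rfl⟩
    ext n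
    exact (h _).2 ⟨a n, rfl⟩

lemma shiftMap_seqMap (f : A →ₗ[R] B) :
    (seqMap f).comp (shiftMap x A) = (shiftMap x B).comp (seqMap f) := by
  ext c n
  simp [seqMap, shiftMap_apply]

/-- Countable products are exact, so the five lemma applies to the maps `shiftMap`. -/
lemma DC.of_exact {A₁ A₂ A₃ A₄ A₅ : Type*} [AddCommGroup A₁] [AddCommGroup A₂] [AddCommGroup A₃]
    [AddCommGroup A₄] [AddCommGroup A₅] [Module R A₁] [Module R A₂] [Module R A₃] [Module R A₄]
    [Module R A₅] {f₁ : A₁ →ₗ[R] A₂} {f₂ : A₂ →ₗ[R] A₃} {f₃ : A₃ →ₗ[R] A₄} {f₄ : A₄ →ₗ[R] A₅}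
    (h₁ : Function.Exact f₁ f₂) (h₂ : Function.Exact f₂ f₃) (h₃ : Function.Exact f₃ f₄)
    (d₁ : DC x A₁) (d₂ : DC x A₂) (d₄ : DC x A₄) (d₅ : DC x A₅) : DC x A₃ :=
  LinearMap.bijective_of_surjective_of_bijective_of_bijective_of_injective
    (seqMap f₁) (seqMap f₂) (seqMap f₃) (seqMap f₄) (seqMap f₁) (seqMap f₂) (seqMap f₃) (seqMap f₄)
    (shiftMap x A₁) (shiftMap x A₂) (shiftMap x A₃) (shiftMap x A₄) (shiftMap x A₅)
    (shiftMap_seqMap f₁) (shiftMap_seqMap f₂) (shiftMap_seqMap f₃) (shiftMap_seqMap f₄)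
    (seqMap_exact h₁) (seqMap_exact h₂) (seqMap_exact h₃)
    (seqMap_exact h₁) (seqMap_exact h₂) (seqMap_exact h₃) d₁.2 d₂ d₄ d₅.1

end Complete

section Chains

open Cx

variable {R : Type u} [CommRing R] {C : Type w} [Category.{v} C] [DGCategory R C]

/-! ### Cones of multiplication by an element -/

section XCone

variable {x : R} {X Z : C} (c : ConeData (x • idE R X) Z) (N : C)

lemma ConeData.x_exact_inr {n : ℤ} : Function.Exact (pre c.inr c.inr_mem N (zero_add n))
    (LinearMap.lsmul R (HH R X N n) x) := by
  have := c.exact_pre_inr_f N (smul_idE_mem_cyc x X) n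
  intro a
  rw [← this a, pre_smul_idE]
  rfl

lemma ConeData.x_exact_fst {n m : ℤ} (h : 1 + n = m) :
    Function.Exact (LinearMap.lsmul R (HH R X N n) x) (pre c.fst c.fst_mem N h) := by
  have := c.exact_pre_f_fst N (smul_idE_mem_cyc x X) h
  intro a
  rw [this a, Set.mem_range, Set.mem_range]
  simp only [pre_smul_idE]
  rfl

lemma ConeData.x_exact_post_inr {n : ℤ} : Function.Exact (LinearMap.lsmul R (HH R N X n) x)
    (post N c.inr c.inr_mem (add_zero n)) := by
  have := c.exact_post_f_inr N (smul_idE_mem_cyc x X) n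
  intro a
  rw [this a, Set.mem_range, Set.mem_range]
  simp only [post_smul_idE]
  rfl

lemma ConeData.x_exact_post_fst {n m : ℤ} (h : n + 1 = m) :
    Function.Exact (post N c.fst c.fst_mem h) (LinearMap.lsmul R (HH R N X m) x) := by
  have := c.exact_post_fst_f N (smul_idE_mem_cyc x X) h
  intro a
  rw [← this a, post_smul_idE]
  rfl

lemma ConeData.dc_pre (c : ConeData (x • idE R X) Z) (N : C) {y : R} (h : ∀ n, DC y (HH R X N n)) (n : ℤ) : DC y (HH R Z N n) :=
  DC.of_exact (c.x_exact_fst N (by lia : 1 + (n - 1) = n))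
    (c.exact_pre_fst_inr N (by lia : 1 + (n - 1) = n)) (c.x_exact_inr N)
    (h _) (h _) (h _) (h _)

end XCone

/-- Iterated cones of multiplication by the elements of a list. -/
inductive ConeChain : List R → C → C → Prop
  | nil (X : C) : ConeChain [] X X
  | cons {x : R} {L : List R} {X Y Z : C} (c : ConeData (x • idE R X) Y) :
      ConeChain L Y Z → ConeChain (x :: L) X Z

namespace ConeChain

lemma map {D : Type w'} [Category.{v'} D] [DGCategory R D] (F : DGFunctor R C D) {L : List R}
    {X Z : C} (h : ConeChain L X Z) : ConeChain L (F.obj X) (F.obj Z) := by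
  induction h with
  | nil X => exact .nil _
  | @cons x L X Y Z c _ ih =>
    have e : F.mapHom 0 (x • idE R X) = x • idE R (F.obj X) := by
      rw [map_smul, mapHom_idE]
    exact .cons (e ▸ c.map F) ih

lemma kProj {L : List R} {U X Z : C} (h : ConeChain L X Z) (hX : KProj R U X) :
    KProj R U Z := by
  induction h with
  | nil X => exact hX
  | @cons x L X Y Z c _ ih => exact ih (c.kProj (smul_idE_mem_cyc x X) hX hX)

lemma exists_of_hasCones (hC : HasCones R C) (L : List R) (X : C) : ∃ Z, ConeChain L X Z := by
  induction L generalizing X with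
  | nil => exact ⟨X, .nil X⟩
  | cons x L ih =>
    obtain ⟨Y, ⟨c⟩⟩ := hC _ (smul_idE_mem_cyc x X)
    obtain ⟨Z, hZ⟩ := ih Y
    exact ⟨Z, .cons c hZ⟩

/-- If the morphisms from the end of a chain vanish in degrees above `m`, then the morphisms from
its start vanish above `m - length`, and in the top degree the former are a quotient of the
latter. -/
lemma exists_surjective {L : List R} {U Z Z' : C} (h : ConeChain L Z Z') (hZ : KProj R U Z)
    (hDC : ∀ X, KProj R U X → ∀ x ∈ L, ∀ (N : C) (n : ℤ), DC x (HH R X N n)) :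
    ∃ (f : (dgHom R Z' Z).X L.length) (hf : f ∈ cyc _ _), ∀ (N : C) (n m : ℤ)
      (hm : L.length + n = m), (∀ i, m < i → Subsingleton (HH R Z' N i)) →
        (∀ i, n < i → Subsingleton (HH R Z N i)) ∧ Function.Surjective (pre f hf N hm) := by
  induction h with
  | nil X =>
    refine ⟨idE R X, idE_mem_cyc X, fun N n m hm hN => ?_⟩
    obtain rfl : n = m := by simpa using hm
    exact ⟨hN, fun a => ⟨a, pre_idE a⟩⟩
  | @cons x L X Y Z c h' ih =>
    obtain ⟨f, hf, H⟩ := ih (c.kProj (smul_idE_mem_cyc x X) hZ hZ)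
      (fun X hX y hy => hDC X hX y (List.mem_cons_of_mem _ hy))
    have hl : ((x :: L).length : ℤ) = L.length + 1 := by simp
    refine ⟨dgc f c.fst hl.symm, dgc_mem_cyc hf c.fst_mem _, fun N n m hm hN => ?_⟩
    obtain ⟨h1, h2⟩ := H N (1 + n) m (by lia) hN
    -- The morphisms from the cone vanish in degree `1 + i`, so `x` is surjective on this group,
    -- which is zero by Nakayama.
    have h3 (i : ℤ) (hi : n < i) : Subsingleton (HH R X N i) := by
      refine (hDC X hZ x (by simp) N i).subsingleton fun a => ?_
      have := h1 (1 + i) (by lia)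
      exact (c.x_exact_fst N rfl a).1 (Subsingleton.elim _ _)
    refine ⟨h3, fun a => ?_⟩
    obtain ⟨b, rfl⟩ := h2 a
    -- The obstruction to lifting `b` along `fst` lives one degree above `n`, where the group has
    -- just been seen to vanish.
    have := h3 (1 + n) (by lia)
    obtain ⟨b', rfl⟩ := (c.exact_pre_fst_inr N rfl b).1 (Subsingleton.elim _ _)
    exact ⟨b', (pre_pre hf c.fst_mem rfl _ hl.symm b').symm⟩

end ConeChain

/-! ### Comparison along a chain -/

section Ladder

variable {D : Type w'} [Category.{v'} D] [DGCategory R D] (F : DGFunctor R C D)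

/-- The map `z ↦ ρ ∘ F(z)` on cohomology. -/
def cmpr {S : C} {W : D} (ρ : (dgHom R (F.obj S) W).X 0) (hρ : ρ ∈ cyc _ 0) (M : C) (n : ℤ) :
    HH R M S n →ₗ[R] HH R (F.obj M) W n :=
  (post _ ρ hρ (add_zero n)).comp (mapHH F M S n)

lemma cmpr_cls {S : C} {W : D} (ρ : (dgHom R (F.obj S) W).X 0) (hρ : ρ ∈ cyc _ 0) {M : C}
    {n : ℤ} {z : (dgHom R M S).X n} (hz : z ∈ cyc _ n) :
    cmpr F ρ hρ M n (cls z hz) =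
      cls (dgc (F.mapHom n z) ρ (add_zero n)) (dgc_mem_cyc (mapHom_mem_cyc F hz) hρ _) := rfl

lemma cmpr_pre {S : C} {W : D} (ρ : (dgHom R (F.obj S) W).X 0) (hρ : ρ ∈ cyc _ 0) {M M' : C}
    {e n m : ℤ} {g : (dgHom R M M').X e} (hg : g ∈ cyc _ e) (h : e + n = m) (a : HH R M' S n) :
    cmpr F ρ hρ M m (pre g hg S h a) =
      pre (F.mapHom e g) (mapHom_mem_cyc F hg) W h (cmpr F ρ hρ M' n a) := by
  obtain ⟨z, hz, rfl⟩ := cls_surj a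
  rw [pre_cls, cmpr_cls, cmpr_cls, pre_cls]
  exact cls_congr (by rw [mapHom_dgc, dgc_assoc _ _ _ h _ (add_zero m)]) _

/-- Bijectivity on the cone of `x` is bijectivity modulo `x` in the derived sense. Derived
completeness of both sides removes the reduction, as in Nakayama's lemma. -/
lemma cmpr_bijective_of_cone {S : C} {W : D} {ρ : (dgHom R (F.obj S) W).X 0} (hρ : ρ ∈ cyc _ 0)
    {x : R} {X Y : C} (c : ConeData (x • idE R X) Y) (hA : ∀ n, DC x (HH R X S n))
    (hB : ∀ n, DC x (HH R (F.obj X) W n)) (h : ∀ n, Function.Bijective (cmpr F ρ hρ Y n))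
    (n : ℤ) : Function.Bijective (cmpr F ρ hρ X n) := by
  have e : F.mapHom 0 (x • idE R X) = x • idE R (F.obj X) := by
    rw [map_smul, mapHom_idE]
  let c' : ConeData (x • idE R (F.obj X)) (F.obj Y) := by
    exact { c.map F with
      d_inl := by rw [← e]; exact (c.map F).d_inl
      d_snd := by rw [← e]; exact (c.map F).d_snd }
  have hinr (n : ℤ) (a : HH R Y S n) : cmpr F ρ hρ X n (pre c.inr c.inr_mem S (zero_add n) a) =
      pre c'.inr c'.inr_mem W (zero_add n) (cmpr F ρ hρ Y n a) := cmpr_pre F ρ hρ _ _ a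
  have hfst (n : ℤ) (a : HH R X S n) : cmpr F ρ hρ Y (1 + n) (pre c.fst c.fst_mem S rfl a) =
      pre c'.fst c'.fst_mem W rfl (cmpr F ρ hρ X n a) := cmpr_pre F ρ hρ _ _ a
  have inj (n : ℤ) : Function.Injective (cmpr F ρ hρ X n) := by
    rw [injective_iff_map_eq_zero]
    -- Every element of the kernel is `x` times another element of the kernel.
    have step (a : HH R X S n) (ha : cmpr F ρ hρ X n a = 0) :
        ∃ a', cmpr F ρ hρ X n a' = 0 ∧ x • a' = a := by
      have h1 : pre c.fst c.fst_mem S rfl a = 0 := by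
        apply (h _).1
        rw [hfst, ha, map_zero, map_zero]
      obtain ⟨a₀, rfl⟩ := (c.x_exact_fst S rfl a).1 h1
      have h2 : LinearMap.lsmul R _ x (cmpr F ρ hρ X n a₀) = 0 := by
        rw [← ha]
        exact (map_smul _ _ _).symm
      obtain ⟨b₁, hb₁⟩ := (c'.x_exact_inr W _).1 h2
      obtain ⟨a₁, rfl⟩ := (h _).2 b₁
      rw [← hinr] at hb₁
      refine ⟨a₀ - pre c.inr c.inr_mem S (zero_add n) a₁, by rw [map_sub, hb₁, sub_self], ?_⟩
      have h3 := (c.x_exact_inr S (pre c.inr c.inr_mem S (zero_add n) a₁)).2 ⟨a₁, rfl⟩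
      rw [smul_sub, show x • pre c.inr c.inr_mem S (zero_add n) a₁ = 0 from h3, sub_zero]
      rfl
    intro a ha
    choose! s hs hs' using step
    have h0 (i : ℕ) : cmpr F ρ hρ X n (s^[i] a) = 0 := by
      induction i with
      | zero => exact ha
      | succ i ih => rw [Function.iterate_succ_apply']; exact hs _ ih
    exact (hA n).eq_zero (fun i => s^[i] a)
      (fun i => by rw [Function.iterate_succ_apply', hs' _ (h0 i)]) 0
  refine ⟨inj n, fun b => ?_⟩
  -- Surjectivity modulo `x`. Injectivity, one degree higher, shows that the preimage of the image
  -- of `b` on the cone comes from `X`.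
  have step (b : HH R (F.obj X) W n) : ∃ a b', b = cmpr F ρ hρ X n a + x • b' := by
    obtain ⟨a₁, ha₁⟩ := (h _).2 (pre c'.fst c'.fst_mem W rfl b)
    have h1 : pre c.inr c.inr_mem S (zero_add _) a₁ = 0 := by
      apply inj
      rw [hinr, ha₁, map_zero]
      exact (c'.exact_pre_fst_inr W rfl _).2 ⟨b, rfl⟩
    obtain ⟨a, rfl⟩ := (c.exact_pre_fst_inr S rfl a₁).1 h1
    have h2 : pre c'.fst c'.fst_mem W rfl (b - cmpr F ρ hρ X n a) = 0 := by
      rw [map_sub, ← ha₁, hfst, sub_self]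
    obtain ⟨b', hb'⟩ := (c'.x_exact_fst W rfl _).1 h2
    exact ⟨a, b', eq_add_of_sub_eq' hb'.symm⟩
  choose r s hrs using step
  -- The successive approximations are summed: completeness of the source makes sense of the series
  -- of `x^i r(s^i b)`. The error terms form a compatible sequence in the target and hence vanish.
  obtain ⟨a', ha'⟩ := (hA n).2 (fun i => r (s^[i] b))
  refine ⟨a' 0, (sub_eq_zero.1 ?_).symm⟩
  refine (hB n).eq_zero (fun i => s^[i] b - cmpr F ρ hρ X n (a' i)) (fun i => ?_) 0
  have e1 : r (s^[i] b) = a' i - x • a' (i + 1) := (congrFun ha' i).symm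
  have e2 := hrs (s^[i] b)
  rw [e1, map_sub, map_smul] at e2
  rw [Function.iterate_succ_apply', smul_sub]
  conv_lhs => rw [e2]
  abel

/-- Descends from the end of the chain to its start. Completeness along the later elements passes to
each cone by `ConeData.dc_pre`. -/
lemma cmpr_bijective_of_chain {S : C} {W : D} {ρ : (dgHom R (F.obj S) W).X 0} (hρ : ρ ∈ cyc _ 0)
    {L : List R} {X Z : C} (h : ConeChain L X Z) (hA : ∀ x ∈ L, ∀ n, DC x (HH R X S n))
    (hB : ∀ x ∈ L, ∀ n, DC x (HH R (F.obj X) W n))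
    (hZ : ∀ n, Function.Bijective (cmpr F ρ hρ Z n)) (n : ℤ) :
    Function.Bijective (cmpr F ρ hρ X n) := by
  induction h generalizing n with
  | nil X => exact hZ n
  | @cons x L X Y Z c _ ih =>
    have e : F.mapHom 0 (x • idE R X) = x • idE R (F.obj X) := by
      rw [map_smul, mapHom_idE]
    have c' : ConeData (x • idE R (F.obj X)) (F.obj Y) := e ▸ c.map F
    exact cmpr_bijective_of_cone F hρ c (hA x (by simp)) (hB x (by simp))
      (ih (fun y hy => c.dc_pre S (hA y (List.mem_cons_of_mem _ hy)))
        (fun y hy => c'.dc_pre W (hB y (List.mem_cons_of_mem _ hy))) hZ) n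

end Ladder

/-! ### Cohomology of Koszul complexes of regular sequences -/

open scoped Pointwise in
lemma nonempty_equiv_quotSMulTop {x : R} {A B M : Type*} [AddCommGroup A] [Module R A]
    [AddCommGroup B] [Module R B] [AddCommGroup M] [Module R M] (e : A ≃ₗ[R] M) {j : A →ₗ[R] B}
    (h : Function.Exact (LinearMap.lsmul R A x) j) (hj : Function.Surjective j) :
    Nonempty (B ≃ₗ[R] QuotSMulTop x M) := by
  have hk : LinearMap.ker j = x • (⊤ : Submodule R A) := by
    ext a
    rw [LinearMap.mem_ker, h a, Submodule.mem_smul_pointwise_iff_exists]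
    simp
  exact ⟨(j.quotKerEquivOfSurjective hj).symm ≪≫ₗ Submodule.quotEquivOfEq _ _ hk ≪≫ₗ
    QuotSMulTop.congr x e⟩

open RingTheory.Sequence in
-- Regularity makes each multiplication injective, so the long exact sequence of each cone breaks up
-- and replaces `M` by `M / xM` in the same degree.
lemma ConeChain.covariant {L : List R} {X Z : C} (h : ConeChain L X Z) (U : C) (M : Type u)
    [AddCommGroup M] [Module R M] (hM : IsWeaklyRegular M L)
    (h₀ : ∀ n, n ≠ 0 → Subsingleton (HH R U X n)) (e : HH R U X 0 ≃ₗ[R] M) :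
    (∀ n, n ≠ 0 → Subsingleton (HH R U Z n)) ∧
      Nonempty (HH R U Z 0 ≃ₗ[R] M ⧸ (Ideal.ofList L • ⊤ : Submodule R M)) := by
  induction h generalizing M with
  | nil X =>
    refine ⟨h₀, ⟨e ≪≫ₗ (Submodule.quotEquivOfEqBot _ ?_).symm⟩⟩
    simp
  | @cons x L X Y Z c _ ih =>
    rw [isWeaklyRegular_cons_iff] at hM
    have hx : Function.Injective (LinearMap.lsmul R (HH R U X 0) x) :=
      (e.isSMulRegular_congr x).2 hM.1
    have inj (n : ℤ) : Function.Injective (LinearMap.lsmul R (HH R U X n) x) := by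
      obtain rfl | hn := eq_or_ne n 0
      · exact hx
      · have := h₀ n hn
        exact fun _ _ _ => Subsingleton.elim _ _
    obtain ⟨e'⟩ := nonempty_equiv_quotSMulTop e (c.x_exact_post_inr U (n := 0)) (fun b =>
      (c.exact_post_inr_fst U (smul_idE_mem_cyc x X) rfl b).1 (inj _ (by
        rw [map_zero]; exact (c.x_exact_post_fst U rfl _).2 ⟨b, rfl⟩)))
    obtain ⟨h1, ⟨e''⟩⟩ := ih (QuotSMulTop x M) hM.2 (fun n hn => by
      have := h₀ n hn
      exact subsingleton_of_exact (fun _ => ⟨0, Subsingleton.elim _ _⟩) (inj (n + 1))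
        (c.x_exact_post_inr U) (c.exact_post_inr_fst U (smul_idE_mem_cyc x X) rfl)
        (c.x_exact_post_fst U rfl)) e'
    exact ⟨h1, ⟨e'' ≪≫ₗ (Submodule.quotOfListConsSMulTopEquivQuotSMulTopInner M x L).symm⟩⟩

open RingTheory.Sequence in
-- The dual computation: the quotient `M / xM` now arises through `fst`, which has degree `1`, so
-- each cone moves the cohomology up by one degree.
lemma ConeChain.contravariant {L : List R} {X Z : C} (h : ConeChain L X Z) (N : C) (M : Type u)
    [AddCommGroup M] [Module R M] (hM : IsWeaklyRegular M L) (s t : ℤ) (ht : t = s + L.length)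
    (h₀ : ∀ n, n ≠ s → Subsingleton (HH R X N n)) (e : HH R X N s ≃ₗ[R] M) :
    (∀ n, n ≠ t → Subsingleton (HH R Z N n)) ∧
      Nonempty (HH R Z N t ≃ₗ[R] M ⧸ (Ideal.ofList L • ⊤ : Submodule R M)) := by
  induction h generalizing M s t with
  | nil X =>
    obtain rfl : t = s := by simpa using ht
    refine ⟨h₀, ⟨e ≪≫ₗ (Submodule.quotEquivOfEqBot _ ?_).symm⟩⟩
    simp
  | @cons x L X Y Z c _ ih =>
    rw [isWeaklyRegular_cons_iff] at hM
    have hx : Function.Injective (LinearMap.lsmul R (HH R X N s) x) :=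
      (e.isSMulRegular_congr x).2 hM.1
    have inj (n : ℤ) : Function.Injective (LinearMap.lsmul R (HH R X N n) x) := by
      obtain rfl | hn := eq_or_ne n s
      · exact hx
      · have := h₀ n hn
        exact fun _ _ _ => Subsingleton.elim _ _
    obtain ⟨e'⟩ := nonempty_equiv_quotSMulTop e (c.x_exact_fst N rfl) (fun b =>
      (c.exact_pre_fst_inr N rfl b).1 (inj _ (by
        rw [map_zero]; exact (c.x_exact_inr N _).2 ⟨b, rfl⟩)))
    have hl : s + ((x :: L).length : ℤ) = 1 + s + L.length := by
      simp only [List.length_cons]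
      push_cast
      ring
    obtain ⟨h1, ⟨e''⟩⟩ := ih (QuotSMulTop x M) hM.2 (1 + s) t (ht.trans hl) (fun n hn => by
      have := h₀ (n - 1) (by lia)
      exact subsingleton_of_exact (fun _ => ⟨0, Subsingleton.elim _ _⟩) (inj n)
        (c.x_exact_fst N (by lia : 1 + (n - 1) = n))
        (c.exact_pre_fst_inr N (by lia : 1 + (n - 1) = n)) (c.x_exact_inr N)) e'
    exact ⟨h1, ⟨e'' ≪≫ₗ (Submodule.quotOfListConsSMulTopEquivQuotSMulTopInner M x L).symm⟩⟩

end Chains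

end

end BGG

namespace BGG

noncomputable section

/-! ### Completeness of morphisms and K-projectivity via telescopes -/

section Telescopes

open Cx

variable {R : Type u} [CommRing R] {C : Type w} [Category.{v} C] [DGCategory R C]

lemma neg_one_sq_smul (n : ℤ) {A : Type*} [AddCommGroup A] (a : A) :
    n.negOnePow • n.negOnePow • a = a := by
  rw [smul_smul, ← Int.negOnePow_add, Int.negOnePow_even _ ⟨n, rfl⟩, one_smul]

/-- Morphisms out of `M` are derived complete along `x` if the telescope of `x` on `M` is
equivalent to `M`. -/
lemma TelData.dc {x : R} {M T : C} (t : TelData x M T) {e : ℤ} {g : (dgHom R M T).X e}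
    (hg : HInv t.pr g) (N : C) (n : ℤ) : DC x (HH R M N n) := by
  have hpr := hg.pre_bijective N (zero_add n)
  obtain ⟨m, rfl⟩ : ∃ m, m + 1 = n := ⟨n - 1, sub_add_cancel n 1⟩
  constructor
  -- A compatible sequence extends `c 0`, pulled back to the telescope, to a null-homotopic map; as
  -- `pr` is an equivalence, `c 0` is zero.
  · have key (c : ℕ → HH R M N (m + 1)) (hc : ∀ i, c i = x • c (i + 1)) : c 0 = 0 := by
      choose z hz hcz using fun i => cls_surj (c i)
      have h1 (i : ℕ) : ∃ w : (dgHom R M N).X m,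
          (dgHom R M N).d m (m + 1) w = z i - x • z (i + 1) := by
        have := hc i
        rwa [hcz i, hcz (i + 1), cls_smul, cls_eq_iff, mem_bdry_iff rfl] at this
      choose w hw using h1
      apply hpr.1
      rw [hcz 0, map_zero, pre_cls, cls_eq_zero_iff, mem_bdry_iff rfl]
      -- The null-homotopy has the chosen homotopies between `z i` and `x z (i + 1)` on the first
      -- family of summands, and the sequence itself, moved by one index, on the second.
      refine ⟨t.lift w (fun i => m.negOnePow • z (i + 1)), t.ext (fun i => ?_) (fun i => ?_)⟩
      · rw [t.u_d rfl, t.u_lift, hw, ← dgc_assoc (t.u i) t.pr (z 0) (add_zero 0) _ (zero_add _),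
          t.u_pr]
        simp only [t.v_lift]
        cases i with
        | zero =>
          rw [if_pos rfl, idE_dgc, prev, zero_sub, smul_neg, smul_comm x, neg_one_sq_smul]
          abel
        | succ i =>
          rw [if_neg (Nat.succ_ne_zero i), zero_dgc, prev, smul_sub, smul_comm x, neg_one_sq_smul,
            neg_one_sq_smul]
          abel
      · rw [t.v_d rfl rfl, t.v_lift, map_units_smul, d_of_mem_cyc (hz _), smul_zero,
          ← dgc_assoc (t.v i) t.pr (z 0) (add_zero 1) _ (by lia), t.v_pr, zero_dgc]
    rw [injective_iff_map_eq_zero]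
    intro c hc
    have hc' (i : ℕ) : c i = x • c (i + 1) := sub_eq_zero.1 (congrFun hc i)
    ext i
    have := key (fun j => c (j + i)) fun j => by rw [hc' (j + i), add_right_comm]
    simpa using this
  · intro β
    choose b hb hβ using fun i => cls_surj (β i)
    -- The prescribed sequence is moved up by one index because the component at `0` is the only one
    -- seen by `pr`, and there the equation is left free for the map `h` found below.
    have hz : t.lift (n := m + 1) (prev b) (fun _ => 0) ∈ cyc _ _ := by
      rw [mem_cyc_iff rfl]
      refine t.ext (fun i => ?_) (fun i => ?_)
      · rw [t.u_d rfl, t.u_lift]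
        simp only [t.v_lift, TelData.prev_zero, smul_zero, sub_zero, dgc_zero]
        cases i with
        | zero => exact map_zero _
        | succ i => exact d_of_mem_cyc (hb i)
      · rw [t.v_d rfl rfl, t.v_lift, map_zero, dgc_zero]
    obtain ⟨h, hh⟩ := hpr.2 (cls _ hz)
    obtain ⟨h, hhc, rfl⟩ := cls_surj h
    rw [pre_cls, eq_comm, cls_eq_iff, mem_bdry_iff rfl] at hh
    obtain ⟨w, hw⟩ := hh
    have hv (i : ℕ) : dgc (t.v i) w (add_comm 1 m) ∈ cyc _ (m + 1) := by
      have := congrArg (fun y => dgc (t.v i) y (by lia : 1 + (m + 1) = m + 1 + 1)) hw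
      dsimp only at this
      rw [t.v_d rfl rfl, dgc_sub, t.v_lift, zero_sub,
        ← dgc_assoc (t.v i) t.pr h (add_zero 1) _ (by lia), t.v_pr, zero_dgc, neg_zero] at this
      rwa [mem_cyc_iff rfl]
    -- The homotopy between the cocycle and a map factoring through `pr` has closed components along
    -- the `v i`; up to sign these solve the equation.
    refine ⟨fun i => cls (-m.negOnePow • dgc (t.v i) w (add_comm 1 m))
      (units_smul_mem _ _ (hv i)), funext fun i => ?_⟩
    rw [shiftMap_apply, hβ, cls_smul]
    refine (cls_eq_iff (sub_mem (units_smul_mem _ _ (hv i)) (Submodule.smul_mem _ _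
      (units_smul_mem _ _ (hv (i + 1)))) ) (hb i)).2 ((mem_bdry_iff rfl _).2
      ⟨-dgc (t.u (i + 1)) w (zero_add m), ?_⟩)
    have := congrArg (fun y => dgc (t.u (i + 1)) y (zero_add (m + 1))) hw
    dsimp only at this
    rw [t.u_d rfl, dgc_sub, t.u_lift, prev, prev,
      ← dgc_assoc (t.u (i + 1)) t.pr h (add_zero 0) _ (zero_add _), t.u_pr,
      if_neg (Nat.succ_ne_zero i), zero_dgc, sub_zero] at this
    rw [map_neg, eq_add_of_sub_eq this, smul_sub, smul_comm _ x, Units.neg_smul, Units.neg_smul, smul_neg]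
    abel

lemma TelData.kProj {x : R} {M T U : C} (t : TelData x M T) (hM : KProj R U M) : KProj R U T :=
  fun N hN => t.subsingleton_of_bijective fun n => by
    have := hM N hN n
    exact ⟨fun _ _ _ => Subsingleton.elim _ _, fun b => ⟨0, Subsingleton.elim _ _⟩⟩

variable (R) in
/-- Existence of telescopes whose projection is a quasi-isomorphism. -/
def HasTel (U : C) (x : R) : Prop :=
  ∀ M : C, ∃ T, ∃ t : TelData x M T, QIs U t.pr

/-- The telescope of a K-projective object is K-projective, so its projection, being a
quasi-isomorphism, is a homotopy equivalence and `TelData.dc` applies. -/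
lemma KProj.dc {U X : C} (hC : HasCones R C) {x : R} (h : HasTel R U x) (hX : KProj R U X) (N : C)
    (n : ℤ) : DC x (HH R X N n) := by
  obtain ⟨T, t, ht⟩ := h X
  obtain ⟨g, hg⟩ := exists_hInv hC (t.kProj hX) hX ht
  exact t.dc hg N n

/-- The morphism given by a cocycle of degree `0`. -/
def toHom {X Y : C} (z : (dgHom R X Y).X 0) (hz : z ∈ cyc _ 0) : X ⟶ Y :=
  (DGCategory.existsUnique_ofHom z ((mem_cyc_iff (zero_add 1) z).1 hz)).choose

lemma ofHom_toHom {X Y : C} (z : (dgHom R X Y).X 0) (hz : z ∈ cyc _ 0) :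
    DGCategory.ofHom (toHom z hz) = z :=
  (DGCategory.existsUnique_ofHom z ((mem_cyc_iff (zero_add 1) z).1 hz)).choose_spec.1

variable (R) in
lemma ofHom_inj {X Y : C} {f g : X ⟶ Y}
    (h : DGCategory.ofHom (R := R) f = DGCategory.ofHom g) : f = g :=
  (DGCategory.existsUnique_ofHom _ (DGCategory.d_ofHom (R := R) g)).unique h rfl

lemma TelData.tmap_mem {x : R} {M T M' T' : C} (t : TelData x M T) (t' : TelData x M' T')
    {n : ℤ} {z : (dgHom R M M').X n} (hz : z ∈ cyc _ n) : t.tmap t' z ∈ cyc _ n := by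
  rw [mem_cyc_iff rfl, ← t.d_tmap t' rfl, d_of_mem_cyc hz]
  have := t.tmap_smul t' 0 (0 : (dgHom R M M').X (n + 1))
  rwa [zero_smul, zero_smul] at this

/-- Telescopes as a dg functor. -/
def telFunctor {x : R} {T : C → C} (t : ∀ M, TelData x M (T M)) : DGFunctor R C C where
  obj := T
  map {M M'} f := toHom ((t M).tmap (t M') (DGCategory.ofHom f))
    ((t M).tmap_mem (t M') (ofHom_mem_cyc f))
  map_id M := ofHom_inj R (by rw [ofHom_toHom, (t M).tmap_idE])
  map_comp f g := ofHom_inj R (by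
    rw [ofHom_toHom, DGCategory.ofHom_comp, DGCategory.ofHom_comp, ofHom_toHom, ofHom_toHom]
    exact (t _).tmap_dgc (t _) (t _) _ _ _)
  mapHom {M M'} n :=
    { toFun := (t M).tmap (t M')
      map_add' := (t M).tmap_add (t M')
      map_smul' := (t M).tmap_smul (t M') }
  mapHom_d hn z := (t _).d_tmap (t _) hn z
  mapHom_ofHom f := (ofHom_toHom _ _).symm
  mapHom_comp h f g := (t _).tmap_dgc (t _) (t _) f g h

/-- Iterated telescopes turn the start of a chain with K-projective end into a K-projective
object. -/
lemma exists_telescope_functor (U : C) (L : List R) (h : ∀ x ∈ L, HasTel R U x) :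
    ∃ (F : DGFunctor R C C) (pr : ∀ M, (dgHom R (F.obj M) M).X 0), (∀ M, QIs U (pr M)) ∧
      (∀ (M M' : C) (n : ℤ) (z : (dgHom R M M').X n),
        dgc (F.mapHom n z) (pr M') (add_zero n) = dgc (pr M) z (zero_add n)) ∧
      ∀ M M', ConeChain L M M' → KProj R U M' → KProj R U (F.obj M) := by
  induction L with
  | nil =>
    refine ⟨DGFunctor.id R C, fun M => idE R M, fun M => ⟨idE_mem_cyc M, fun n m hm => ?_⟩,
      fun M M' n z => ?_, fun M M' hc hM => ?_⟩
    · obtain rfl : n = m := by lia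
      have e : ⇑(post U (idE R M) (idE_mem_cyc M) hm) = id := funext fun a => post_idE a
      exact e.symm ▸ Function.bijective_id
    · exact (dgc_idE z).trans (idE_dgc z).symm
    · cases hc
      exact hM
  | cons x L ih =>
    obtain ⟨F, pr, h1, h2, h3⟩ := ih fun y hy => h y (List.mem_cons_of_mem _ hy)
    choose T t ht using h x List.mem_cons_self
    refine ⟨F.comp (telFunctor t), fun M => dgc (t (F.obj M)).pr (pr M) (add_zero 0),
      fun M => (ht _).comp (h1 M) _, fun M M' n z => ?_, fun M M' hc hM => ?_⟩
    · change dgc ((t _).tmap (t _) (F.mapHom n z)) (dgc (t _).pr (pr M') _) _ = _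
      rw [← dgc_assoc _ _ (pr M') (add_zero n) _ (add_zero n), TelData.tmap_pr,
        dgc_assoc _ _ (pr M') (zero_add n) (add_zero n) _ (zero_add n), h2]
      exact (dgc_assoc _ (pr M) z (add_zero 0) (zero_add n) _ _).symm
    · cases hc with
      | cons c hc =>
        intro N hN
        -- For acyclic `N` the cone of `x` on `F M` has no morphisms to `N`, by induction. Hence `x`
        -- is bijective on morphisms from `F M`, and the telescope has none.
        refine (t (F.obj M)).subsingleton_of_bijective fun n => ?_
        have h4 := (c.map F).pre_bijective N (mapHom_mem_cyc F (smul_idE_mem_cyc x M))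
          (h3 _ _ hc hM N hN) n
        have e : F.mapHom 0 (x • idE R M) = x • idE R (F.obj M) := by rw [map_smul, mapHom_idE]
        simp only [e] at h4
        convert h4 using 1
        exact funext fun a => (pre_smul_idE x a).symm

/-! ### Construction of telescopes -/

/-- A closed element that has an inverse. -/
structure SInv {X Y : C} {e e' : ℤ} (g : (dgHom R X Y).X e) (g' : (dgHom R Y X).X e') : Prop where
  left : g ∈ cyc _ e
  right : g' ∈ cyc _ e'
  add : e + e' = 0
  left_right : dgc g g' add = idE R X
  right_left : dgc g' g ((add_comm _ _).trans add) = idE R Y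

lemma SInv.hInv {X Y : C} {e e' : ℤ} {g : (dgHom R X Y).X e} {g' : (dgHom R Y X).X e'}
    (h : SInv g g') : HInv g g' where
  left := h.left
  right := h.right
  add := h.add
  left_right := by rw [h.left_right, sub_self]; exact Submodule.zero_mem _
  right_left := by rw [h.right_left, sub_self]; exact Submodule.zero_mem _

variable (R C) in
/-- Existence of shifts. -/
def HasShifts : Prop := ∀ (X : C) (e : ℤ), ∃ (Y : C) (g : (dgHom R X Y).X e)
  (g' : (dgHom R Y X).X (-e)), SInv g g'

/-- The data exhibiting `W` as the sum of countably many copies of `M`. -/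
structure CopData (M W : C) where
  ι : ℕ → (dgHom R M W).X 0
  ι_mem (i : ℕ) : ι i ∈ cyc _ 0
  desc {N : C} {n : ℤ} (a : ℕ → (dgHom R M N).X n) : (dgHom R W N).X n
  ι_desc {N : C} {n : ℤ} (a : ℕ → (dgHom R M N).X n) (i : ℕ) :
    dgc (ι i) (desc a) (zero_add n) = a i
  ext {N : C} {n : ℤ} {z z' : (dgHom R W N).X n}
    (h : ∀ i, dgc (ι i) z (zero_add n) = dgc (ι i) z' (zero_add n)) : z = z'

namespace CopData

variable {M W : C}

lemma desc_mem (c : CopData (R := R) M W) {N : C} {n : ℤ} {a : ℕ → (dgHom R M N).X n} (ha : ∀ i, a i ∈ cyc _ n) :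
    c.desc a ∈ cyc _ n := by
  rw [mem_cyc_iff rfl]
  refine c.ext fun i => ?_
  rw [← d_dgc_of_cyc_left (c.ι_mem i) _ (zero_add n) rfl rfl, c.ι_desc, d_of_mem_cyc (ha i),
    dgc_zero]

/-- The difference of `x` and the left translation. -/
def trans (c : CopData (R := R) M W) (x : R) : (dgHom R W W).X 0 :=
  c.desc fun i => x • c.ι i - prev c.ι i

lemma ι_trans (c : CopData (R := R) M W) (x : R) (i : ℕ) :
    dgc (c.ι i) (c.trans x) (add_zero 0) = x • c.ι i - prev c.ι i := c.ι_desc _ i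

lemma trans_mem (c : CopData (R := R) M W) (x : R) : c.trans x ∈ cyc _ 0 :=
  c.desc_mem fun i => sub_mem (Submodule.smul_mem _ x (c.ι_mem i)) (by
    cases i with
    | zero => exact Submodule.zero_mem _
    | succ i => exact c.ι_mem i)

/-- The telescope, as a shift of the cone of `x` minus the left translation. -/
def telData (c : CopData (R := R) M W) {x : R} {Z T : C} (k : ConeData (c.trans x) Z)
    {s : (dgHom R Z T).X 1} {s' : (dgHom R T Z).X (-1)} (hs : SInv s s') : TelData x M T where
  u i := dgc (dgc (c.ι i) k.inl (zero_add (-1))) s (by lia)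
  v i := dgc (dgc (c.ι i) k.inr (add_zero 0)) s (by lia)
  d_u i := by
    rw [d_dgc_of_cyc_right _ hs.left (by lia) (by lia : -1 + 1 = 0) (by lia),
      d_dgc_of_cyc_left (c.ι_mem i) _ _ (by lia : -1 + 1 = 0) (by lia), k.d_inl,
      ← dgc_assoc (c.ι i) _ k.inr (add_zero 0) _ (add_zero 0), c.ι_trans,
      Int.negOnePow_one, Units.neg_smul, one_smul, sub_dgc, sub_dgc, smul_dgc, smul_dgc,
      neg_sub]
    cases i with
    | zero => rw [prev, prev, zero_dgc, zero_dgc]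
    | succ i => rfl
  v_mem i := dgc_mem_cyc (dgc_mem_cyc (c.ι_mem i) k.inr_mem _) hs.left _
  lift {N n} a b := dgc s' (dgc k.fst (c.desc a) (add_comm 1 n) +
    dgc k.snd (c.desc b) (zero_add _)) (by lia)
  u_lift {N n} a b i := by
    rw [← dgc_assoc _ s' _ (by lia : (0 : ℤ) + -1 = -1) (by lia) (by lia) (by lia),
      dgc_assoc _ s s' _ (by lia : (1 : ℤ) + -1 = 0) _ (by lia), hs.left_right, dgc_idE,
      dgc_assoc (c.ι i) k.inl _ _ (by lia : -1 + (n + 1) = n) _ (zero_add n),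
      k.inl_dgc _ _ rfl, c.ι_desc]
  v_lift {N n} a b i := by
    rw [← dgc_assoc _ s' _ (by lia : (1 : ℤ) + -1 = 0) (by lia) (by lia) (by lia),
      dgc_assoc _ s s' _ (by lia : (1 : ℤ) + -1 = 0) _ (by lia), hs.left_right, dgc_idE,
      dgc_assoc (c.ι i) k.inr _ _ (zero_add (n + 1)) _ (zero_add (n + 1)),
      k.inr_dgc _ _ rfl, c.ι_desc]
  ext {N n z z'} h h' := by
    have key (y : (dgHom R T N).X n) : y = dgc s' (dgc s y (add_comm 1 n)) (by lia) := by
      rw [← dgc_assoc s' s y (by lia : (-1 : ℤ) + 1 = 0) _ (zero_add n), hs.right_left, idE_dgc]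
    rw [key z, key z', k.decomp_left (dgc s z (add_comm 1 n)),
      k.decomp_left (dgc s z' (add_comm 1 n))]
    have e₁ : dgc k.inl (dgc s z (add_comm 1 n)) (by lia : -1 + (n + 1) = n + 1 - 1) =
        dgc k.inl (dgc s z' (add_comm 1 n)) (by lia) := by
      obtain ⟨l, rfl⟩ : ∃ l, n = l := ⟨n, rfl⟩
      have e : n + 1 - 1 = n := by lia
      -- The degree `n + 1 - 1` is replaced by a variable equal to `n`, so that it can be
      -- substituted.
      suffices ∀ l (hl : l = n), dgc k.inl (dgc s z (add_comm 1 n)) (by lia : -1 + (n + 1) = l) =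
        dgc k.inl (dgc s z' (add_comm 1 n)) (by lia) from this _ e
      rintro l rfl
      refine c.ext fun i => ?_
      have := h i
      rwa [dgc_assoc _ s _ _ (add_comm 1 l) _ (by lia), dgc_assoc _ s _ _ (add_comm 1 l) _ (by lia),
        dgc_assoc (c.ι i) k.inl _ _ (by lia : -1 + (l + 1) = l) _ (zero_add l),
        dgc_assoc (c.ι i) k.inl _ _ (by lia : -1 + (l + 1) = l) _ (zero_add l)] at this
    have e₂ : dgc k.inr (dgc s z (add_comm 1 n)) (zero_add _) =
        dgc k.inr (dgc s z' (add_comm 1 n)) (zero_add _) := by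
      refine c.ext fun i => ?_
      have := h' i
      rwa [dgc_assoc _ s _ _ (add_comm 1 n) _ (by lia), dgc_assoc _ s _ _ (add_comm 1 n) _ (by lia),
        dgc_assoc (c.ι i) k.inr _ _ (zero_add (n + 1)) _ (zero_add (n + 1)),
        dgc_assoc (c.ι i) k.inr _ _ (zero_add (n + 1)) _ (zero_add (n + 1))] at this
    rw [e₁, e₂]

/-- The projections of the sum. -/
def proj (c : CopData (R := R) M W) (j : ℕ) : (dgHom R W M).X 0 :=
  c.desc fun i => if i = j then idE R M else 0

lemma ι_proj (c : CopData (R := R) M W) (i j : ℕ) :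
    dgc (c.ι i) (c.proj j) (add_zero 0) = if i = j then idE R M else 0 := c.ι_desc _ i

lemma proj_mem (c : CopData (R := R) M W) (j : ℕ) : c.proj j ∈ cyc _ 0 :=
  c.desc_mem fun i => by
    split_ifs
    · exact idE_mem_cyc M
    · exact Submodule.zero_mem _

/-- Every morphism from `U` to the sum is a finite sum. -/
def IsCompact (c : CopData (R := R) M W) (U : C) : Prop :=
  ∀ (n : ℤ) (z : (dgHom R U W).X n), ∃ (k : ℕ) (a : ℕ → (dgHom R U M).X n),
    z = ∑ i ∈ Finset.range k, dgc (a i) (c.ι i) (add_zero n)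

lemma sum_dgc {X Y Z : C} {p q n : ℤ} {s : Finset ℕ} (f : ℕ → (dgHom R X Y).X p)
    (g : (dgHom R Y Z).X q) (h : p + q = n) :
    dgc (∑ i ∈ s, f i) g h = ∑ i ∈ s, dgc (f i) g h := LinearMap.map_sum₂ _ _ _ _

/-- The coefficients of the finite sum are recovered by the projections, so they may be taken to
depend on `z` linearly and compatibly with differentials. -/
lemma IsCompact.eq_sum {c : CopData (R := R) M W} {U : C} (h : c.IsCompact U) {n : ℤ}
    (z : (dgHom R U W).X n) : ∃ k : ℕ, z = ∑ i ∈ Finset.range k,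
      dgc (dgc z (c.proj i) (add_zero n)) (c.ι i) (add_zero n) := by
  obtain ⟨k, a, ha⟩ := h n z
  refine ⟨k, ?_⟩
  conv_lhs => rw [ha]
  refine Finset.sum_congr rfl fun i hi => ?_
  congr 1
  rw [ha, sum_dgc, Finset.sum_eq_single i]
  · rw [dgc_assoc _ _ _ _ (add_zero 0) _ (add_zero n), c.ι_proj, if_pos rfl, dgc_idE]
  · intro j _ hj
    rw [dgc_assoc _ _ _ _ (add_zero 0) _ (add_zero n), c.ι_proj, if_neg hj, dgc_zero]
  · exact fun h => (h hi).elim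

lemma trans_proj (c : CopData (R := R) M W) (x : R) (j : ℕ) :
    dgc (c.trans x) (c.proj j) (add_zero 0) = x • c.proj j - c.proj (j + 1) := by
  refine c.ext fun i => ?_
  rw [← dgc_assoc (c.ι i) _ _ (add_zero 0) _ (add_zero 0), c.ι_trans, sub_dgc,
    smul_dgc, dgc_sub, dgc_smul, c.ι_proj, c.ι_proj]
  cases i with
  | zero => rw [prev, zero_dgc, if_neg (Nat.succ_ne_zero j).symm]
  | succ i => rw [prev, c.ι_proj]; simp

/-- On cohomology seen from `U`, where `x` is zero, the map `c.trans x` is minus the left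
translation of a direct sum. That is surjective with kernel the first summand, so the fibre is the
first summand. -/
lemma qis_telData (c : CopData (R := R) M W) {U : C} (hc : c.IsCompact U) {x : R}
    (hx : ∀ n (a : HH R U M n), x • a = 0)
    {Z T : C} (k : ConeData (c.trans x) Z)
    {s : (dgHom R Z T).X 1} {s' : (dgHom R T Z).X (-1)} (hs : SInv s s') :
    QIs U (c.telData k hs).pr := by
  -- Compactness makes a class on the sum a finite sum of its components, so it is detected by the
  -- projections.
  have inj (n : ℤ) (a : HH R U W n)
      (ha : ∀ j, post U (c.proj j) (c.proj_mem j) (add_zero n) a = 0) : a = 0 := by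
    obtain ⟨z, hz, rfl⟩ := cls_surj a
    obtain ⟨l, hl⟩ := hc.eq_sum z
    rw [cls_eq_zero_iff, hl]
    refine Submodule.sum_mem _ fun i _ => dgc_mem_bdry_left ?_ (c.ι_mem i) _
    have := ha i
    rwa [post_cls, cls_eq_zero_iff] at this
  have ht (n : ℤ) (a : HH R U W n) (j : ℕ) : post U (c.proj j) (c.proj_mem j) (add_zero n)
      (post U (c.trans x) (c.trans_mem x) (add_zero n) a) =
        -post U (c.proj (j + 1)) (c.proj_mem _) (add_zero n) a := by
    obtain ⟨z, hz, rfl⟩ := cls_surj a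
    have := hx n (post U (c.proj j) (c.proj_mem j) (add_zero n) (cls z hz))
    rw [post_cls, cls_smul, cls_eq_zero_iff] at this
    rw [post_cls, post_cls, post_cls, ← sub_eq_zero, sub_neg_eq_add]
    refine (cls_eq_zero_iff _ (add_mem (dgc_mem_cyc (dgc_mem_cyc hz (c.trans_mem x) _)
      (c.proj_mem j) _) (dgc_mem_cyc hz (c.proj_mem _) _))).2 ?_
    rwa [dgc_assoc z _ _ _ (add_zero 0) _ (add_zero n), trans_proj, dgc_sub, dgc_smul,
      sub_add_cancel]
  have surj (n : ℤ) : Function.Surjective (post U (c.trans x) (c.trans_mem x) (add_zero n)) := by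
    intro a
    obtain ⟨z, hz, rfl⟩ := cls_surj a
    obtain ⟨l, hl⟩ := hc.eq_sum z
    have hy : ∑ i ∈ Finset.range l, dgc (dgc z (c.proj i) (add_zero n)) (c.ι (i + 1))
        (add_zero n) ∈ cyc _ n := Submodule.sum_mem _ fun i _ =>
      dgc_mem_cyc (dgc_mem_cyc hz (c.proj_mem i) _) (c.ι_mem _) _
    -- The preimage is minus the right translate of `z`.
    refine ⟨-cls _ hy, sub_eq_zero.1 (inj n _ fun j => ?_)⟩
    rw [map_sub, ht, map_neg, neg_neg, sub_eq_zero, post_cls, post_cls]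
    refine cls_congr ?_ _
    rw [sum_dgc]
    conv_rhs => rw [hl, sum_dgc]
    refine Finset.sum_congr rfl fun i _ => ?_
    rw [dgc_assoc _ _ _ _ (add_zero 0) _ (add_zero n),
      dgc_assoc _ _ (c.proj j) _ (add_zero 0) _ (add_zero n), c.ι_proj, c.ι_proj]
    simp
  have hpr : dgc s (c.telData k hs).pr (add_zero 1) = dgc k.fst (c.proj 0) (add_zero 1) := by
    change dgc s (dgc s' _ _) _ = _
    rw [← dgc_assoc s s' _ (by lia : (1 : ℤ) + -1 = 0) _ (by lia), hs.left_right, idE_dgc]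
    have : c.desc (fun _ => (0 : (dgHom R M M).X (0 + 1))) = 0 := c.ext fun i => by
      rw [c.ι_desc, dgc_zero]
    rw [this, dgc_zero, add_zero]
    rfl
  -- By surjectivity of the translation, `fst` identifies the cohomology of the cone with the kernel
  -- of the translation, which the first projection identifies with that of `M`.
  have hbij (n m : ℤ) (h : n + 1 = m) : Function.Bijective (post U (dgc k.fst (c.proj 0)
      (add_zero 1)) (dgc_mem_cyc k.fst_mem (c.proj_mem 0) _) h) := by
    have e (a : HH R U Z n) : post U (dgc k.fst (c.proj 0)
        (add_zero 1)) (dgc_mem_cyc k.fst_mem (c.proj_mem 0) _) h a =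
          post U (c.proj 0) (c.proj_mem 0) (add_zero m) (post U k.fst k.fst_mem h a) :=
      (post_post _ _ _ _ _ _).symm
    constructor
    · rw [injective_iff_map_eq_zero]
      intro a ha
      rw [e] at ha
      have h1 : post U k.fst k.fst_mem h a = 0 := inj _ _ fun j => by
        cases j with
        | zero => exact ha
        | succ j =>
          rw [← neg_eq_zero, ← ht, (k.exact_post_fst_f U (c.trans_mem x) h _).2 ⟨a, rfl⟩, map_zero]
      obtain ⟨b, rfl⟩ := (k.exact_post_inr_fst U (c.trans_mem x) h a).1 h1
      exact (k.exact_post_f_inr U (c.trans_mem x) n b).2 (surj n b)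
    · intro b
      obtain ⟨y, hy, rfl⟩ := cls_surj b
      have h1 : post U (c.trans x) (c.trans_mem x) (add_zero m)
          (post U (c.ι 0) (c.ι_mem 0) (add_zero m) (cls y hy)) = 0 := inj _ _ fun j => by
        rw [ht, post_post _ _ _ _ (add_zero 0), post_cls, neg_eq_zero, cls_eq_zero_iff, c.ι_proj,
          if_neg (Nat.succ_ne_zero j).symm, dgc_zero]
        exact Submodule.zero_mem _
      obtain ⟨a, ha⟩ := (k.exact_post_fst_f U (c.trans_mem x) h _).1 h1
      refine ⟨a, ?_⟩
      rw [e, ha, post_post _ _ _ _ (add_zero 0), post_cls]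
      exact cls_congr (by rw [c.ι_proj, if_pos rfl, dgc_idE]) _
  refine ⟨TelData.pr_mem _, fun n m h => ?_⟩
  have hs1 := hs.hInv.post_bijective U (by lia : (n - 1) + 1 = n)
  rw [← Function.Bijective.of_comp_iff _ hs1]
  convert hbij (n - 1) m (by lia) using 1
  refine funext fun a => (post_post hs.left (TelData.pr_mem _) _ _ (add_zero 1) a).trans ?_
  simp only [hpr]

end CopData

/-- Existence of telescopes in a dg category with cones, shifts and countable sums. -/
lemma hasTel_of_hasCones {U : C} (hC : HasCones R C) (hS : HasShifts R C)
    (hW : ∀ M : C, ∃ (W : C) (c : CopData (R := R) M W), c.IsCompact U) {x : R}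
    (hx : x • idE R U ∈ bdry _ 0) : HasTel R U x := fun M => by
  obtain ⟨W, c, hc⟩ := hW M
  obtain ⟨Z, ⟨k⟩⟩ := hC _ (c.trans_mem x)
  obtain ⟨T, s, s', hs⟩ := hS Z 1
  refine ⟨T, c.telData k hs, c.qis_telData hc (fun n a => ?_) k hs⟩
  rw [← pre_smul_idE]
  obtain ⟨z, hz, rfl⟩ := cls_surj a
  rw [pre_cls, cls_eq_zero_iff]
  exact dgc_mem_bdry_left hx hz _

end Telescopes

end

end BGG

namespace BGG

noncomputable section

open CochainComplex CochainComplex.HomComplex Cx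

variable {R : Type u} [CommRing R]

/-! ### Cones of complexes -/

/-- The mapping cone as cone data. -/
def mappingConeData {M N : CochainComplex (ModuleCat.{u} R) ℤ} (φ : M ⟶ N) :
    ConeData (DGCategory.ofHom (R := R) φ) (mappingCone φ) where
  inl := mappingCone.inl φ
  inr := Cochain.ofHom (mappingCone.inr φ)
  fst := (mappingCone.fst φ).1
  snd := mappingCone.snd φ
  inl_fst := mappingCone.inl_fst φ
  inl_snd := mappingCone.inl_snd φ
  inr_fst := mappingCone.inr_fst φ
  inr_snd := mappingCone.inr_snd φ
  total := mappingCone.id φ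
  d_inl := (mappingCone.δ_inl φ).trans (Cochain.ofHom_comp _ _)
  inr_mem := ofHom_mem_cyc (mappingCone.inr φ)
  fst_mem := (mem_cyc_iff (by lia : (1 : ℤ) + 1 = 2) _).2 ((mappingCone.fst φ).δ_eq_zero 2)
  d_snd := mappingCone.δ_snd φ

lemma hasCones_of_ofHom {C : Type w} [Category.{v} C] [DGCategory R C]
    (h : ∀ ⦃X Y : C⦄ (f : X ⟶ Y), ∃ Z, Nonempty (ConeData (DGCategory.ofHom (R := R) f) Z)) :
    HasCones R C := fun X Y f hf => by
  rw [← ofHom_toHom f hf]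
  exact h _

lemma hasCones_complex : HasCones R (CochainComplex (ModuleCat.{u} R) ℤ) :=
  hasCones_of_ofHom fun _ _ f => ⟨_, ⟨mappingConeData f⟩⟩

/-! ### Shifts of complexes -/

section Shift

variable (K : CochainComplex (ModuleCat.{u} R) ℤ)

/-- The shift of a complex. -/
def shiftCx (a : ℤ) :
    CochainComplex (ModuleCat.{u} R) ℤ where
  X p := K.X (p + a)
  d p q := a.negOnePow • K.d (p + a) (q + a)
  shape p q h := by
    rw [K.shape, smul_zero]
    intro (h' : p + a + 1 = q + a)
    exact h (by change p + 1 = q; lia)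
  d_comp_d' _ _ _ _ _ := by simp

lemma d_XIso {p q p' : ℤ} (h : p = p') (x : K.X p) :
    K.d p' q ((K.XIsoOfEq h).hom x) = K.d p q x := by
  subst h
  rfl

lemma XIso_d {p q q' : ℤ} (h : q = q') (x : K.X p) :
    (K.XIsoOfEq h).hom (K.d p q x) = K.d p q' x := by
  subst h
  rfl

/-- The identity, as an element of degree `e` of the complex of maps to the shift by `-e`. -/
def toShift {e b : ℤ} (h : b = -e) : (dgHom R K (shiftCx K b)).X e :=
  Cochain.mk fun p q _ => (K.XIsoOfEq (by lia : p = q + b)).hom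

/-- The identity, as an element of degree `e` of the complex of maps from the shift by `e`. -/
def ofShift {e b : ℤ} (h : b = e) : (dgHom R (shiftCx K b) K).X e :=
  Cochain.mk fun p q _ => (K.XIsoOfEq (by lia : p + b = q)).hom

lemma toShift_mem {e b : ℤ} (h : b = -e) : toShift K h ∈ cyc _ e := by
  rw [mem_cyc_iff rfl]
  refine Cochain.ext _ _ fun p q hpq => ModuleCat.hom_ext (LinearMap.ext fun x => ?_)
  refine (congrArg (fun f : K.X p ⟶ (shiftCx K b).X q => f x)
    (δ_v e (e + 1) rfl (toShift K h) p q hpq (q - 1) (p + 1) rfl rfl)).trans ?_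
  change b.negOnePow • K.d (q - 1 + b) (q + b)
      ((K.XIsoOfEq (by lia : p = q - 1 + b)).hom x) +
    (e + 1).negOnePow • (K.XIsoOfEq (by lia : p + 1 = q + b)).hom (K.d p (p + 1) x) = 0
  rw [d_XIso, XIso_d, Int.negOnePow_succ, h, Int.negOnePow_neg, Units.neg_smul, add_neg_cancel]

lemma ofShift_mem {e b : ℤ} (h : b = e) : ofShift K h ∈ cyc _ e := by
  rw [mem_cyc_iff rfl]
  refine Cochain.ext _ _ fun p q hpq => ModuleCat.hom_ext
    (LinearMap.ext fun (x : K.X (p + b)) => ?_)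
  refine (congrArg (fun f : (shiftCx K b).X p ⟶ K.X q => f x)
    (δ_v e (e + 1) rfl (ofShift K h) p q hpq (q - 1) (p + 1) rfl rfl)).trans ?_
  change K.d (q - 1) q ((K.XIsoOfEq (by lia : p + b = q - 1)).hom x) +
    (e + 1).negOnePow • (K.XIsoOfEq (by lia : p + 1 + b = q)).hom
      (b.negOnePow • K.d (p + b) (p + 1 + b) x) = 0
  rw [d_XIso, map_units_smul, XIso_d, Int.negOnePow_succ, show e.negOnePow = b.negOnePow by rw [h],
    Units.neg_smul, neg_one_sq_smul, add_neg_cancel]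

lemma sInv_shift (e : ℤ) : SInv (toShift K (rfl : -e = -e)) (ofShift K (rfl : -e = -e)) where
  left := toShift_mem K _
  right := ofShift_mem K _
  add := add_neg_cancel e
  left_right := by
    refine Cochain.ext _ _ fun p q hpq => ?_
    obtain rfl : p = q := by lia
    exact (Cochain.comp_v _ _ (add_neg_cancel e) p (p + e) p rfl (by lia)).trans
      ((K.XIsoOfEq_hom_comp_XIsoOfEq_hom (by lia : p = p + e + -e) (by lia)).trans
        (Cochain.ofHom_v (𝟙 K) p).symm)
  right_left := by
    refine Cochain.ext _ _ fun p q hpq => ?_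
    obtain rfl : p = q := by lia
    exact (Cochain.comp_v _ _ (neg_add_cancel e) p (p - e) p (by lia) (by lia)).trans
      ((K.XIsoOfEq_hom_comp_XIsoOfEq_hom (by lia : p + -e = p - e) (by lia)).trans
        (Cochain.ofHom_v (𝟙 (shiftCx K (-e))) p).symm)

end Shift

lemma hasShifts_complex : HasShifts R (CochainComplex (ModuleCat.{u} R) ℤ) :=
  fun K e => ⟨_, _, _, sInv_shift K e⟩

namespace DGModule

variable {A : DGAlgebra R}

lemma act_congr (M : DGModule A) {p q n : ℤ} (h : p + q = n) {x x' : M.cx.X p} (hx : x = x')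
    (a : A.cx.X q) : M.act h x a = M.act h x' a := by rw [hx]

lemma units_act (M : DGModule A) {p q n : ℤ} (h : p + q = n) (s : ℤˣ) (x : M.cx.X p)
    (a : A.cx.X q) : M.act h (s • x) a = s • M.act h x a :=
  map_units_smul ((M.act h).flip a) s x

/-! ### Cones of dg modules -/

section Cone

variable {M N : DGModule A} (φ : M ⟶ N)

lemma cone_ext {n m : ℤ} (h : n + 1 = m) {x y : (mappingCone φ.f).X n}
    (h₁ : (mappingCone.fst φ.f).1.v n m h x = (mappingCone.fst φ.f).1.v n m h y)
    (h₂ : (mappingCone.snd φ.f).v n n (add_zero n) x =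
      (mappingCone.snd φ.f).v n n (add_zero n) y) : x = y := by
  have := mappingCone.id_X φ.f n m h
  have e (z : (mappingCone φ.f).X n) :
    (mappingCone.inl φ.f).v m n (by lia) ((mappingCone.fst φ.f).1.v n m h z) +
      (mappingCone.inr φ.f).f n ((mappingCone.snd φ.f).v n n (add_zero n) z) = z :=
    congrArg (fun f : (mappingCone φ.f).X n ⟶ _ => f z) this
  rw [← e x, ← e y, h₁, h₂]

/-- The action on the mapping cone. -/
def coneAct {p q n : ℤ} (h : p + q = n) :
    (mappingCone φ.f).X p →ₗ[R] A.cx.X q →ₗ[R] (mappingCone φ.f).X n :=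
  LinearMap.mk₂ R (fun x a =>
    (mappingCone.inl φ.f).v (n + 1) n (by lia)
      (M.act (by lia : p + 1 + q = n + 1) ((mappingCone.fst φ.f).1.v p (p + 1) rfl x) a) +
    (mappingCone.inr φ.f).f n (N.act h ((mappingCone.snd φ.f).v p p (add_zero p) x) a))
    (fun x y a => by simp only [map_add, LinearMap.add_apply]; abel)
    (fun c x a => by simp only [map_smul, LinearMap.smul_apply, smul_add])
    (fun x a b => by simp only [map_add]; abel)
    (fun c x a => by simp only [map_smul, smul_add])

lemma coneAct_apply {p q n : ℤ} (h : p + q = n) (x : (mappingCone φ.f).X p) (a : A.cx.X q) :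
    coneAct φ h x a = (mappingCone.inl φ.f).v (n + 1) n (by lia)
      (M.act (by lia : p + 1 + q = n + 1) ((mappingCone.fst φ.f).1.v p (p + 1) rfl x) a) +
    (mappingCone.inr φ.f).f n (N.act h ((mappingCone.snd φ.f).v p p (add_zero p) x) a) := rfl

lemma inl_fst_apply {p q : ℤ} (h : q + 1 = p) (y : M.cx.X p) :
    (mappingCone.fst φ.f).1.v q p h ((mappingCone.inl φ.f).v p q (by lia) y) = y := by
  rw [← ModuleCat.comp_apply, mappingCone.inl_v_fst_v]
  rfl

lemma inl_snd_apply {p q : ℤ} (h : p + -1 = q) (y : M.cx.X p) :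
    (mappingCone.snd φ.f).v q q (add_zero q) ((mappingCone.inl φ.f).v p q h y) = 0 := by
  rw [← ModuleCat.comp_apply, mappingCone.inl_v_snd_v]
  rfl

lemma inr_fst_apply {p q : ℤ} (h : p + 1 = q) (y : N.cx.X p) :
    (mappingCone.fst φ.f).1.v p q h ((mappingCone.inr φ.f).f p y) = 0 := by
  rw [← ModuleCat.comp_apply, mappingCone.inr_f_fst_v]
  rfl

lemma inr_snd_apply {p : ℤ} (y : N.cx.X p) :
    (mappingCone.snd φ.f).v p p (add_zero p) ((mappingCone.inr φ.f).f p y) = y := by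
  rw [← ModuleCat.comp_apply, mappingCone.inr_f_snd_v]
  rfl

lemma fst_coneAct {p q n p' n' : ℤ} (h : p + q = n) (hp : p + 1 = p') (hn : n + 1 = n')
    (x : (mappingCone φ.f).X p) (a : A.cx.X q) :
    (mappingCone.fst φ.f).1.v n n' hn (coneAct φ h x a) =
      M.act (by lia) ((mappingCone.fst φ.f).1.v p p' hp x) a := by
  subst hp hn
  rw [coneAct_apply, map_add, inl_fst_apply, inr_fst_apply, add_zero]

lemma snd_coneAct {p q n : ℤ} (h : p + q = n) (x : (mappingCone φ.f).X p) (a : A.cx.X q) :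
    (mappingCone.snd φ.f).v n n (add_zero n) (coneAct φ h x a) =
      N.act h ((mappingCone.snd φ.f).v p p (add_zero p) x) a := by
  rw [coneAct_apply, map_add, inl_snd_apply, inr_snd_apply, zero_add]

lemma cone_d_fst {i j k : ℤ} (hij : i + 1 = j) (hjk : j + 1 = k) (x : (mappingCone φ.f).X i) :
    (mappingCone.fst φ.f).1.v j k hjk ((mappingCone φ.f).d i j x) =
      -M.cx.d j k ((mappingCone.fst φ.f).1.v i j hij x) := by
  rw [← ModuleCat.comp_apply, mappingCone.d_fst_v φ.f i j k hij hjk]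
  rfl

lemma cone_d_snd {i j : ℤ} (hij : i + 1 = j) (x : (mappingCone φ.f).X i) :
    (mappingCone.snd φ.f).v j j (add_zero j) ((mappingCone φ.f).d i j x) =
      φ.f.f j ((mappingCone.fst φ.f).1.v i j hij x) +
        N.cx.d i j ((mappingCone.snd φ.f).v i i (add_zero i) x) := by
  rw [← ModuleCat.comp_apply, mappingCone.d_snd_v φ.f i j hij]
  rfl

/-- The mapping cone of a morphism of dg modules. -/
def cone : DGModule A where
  cx := mappingCone φ.f
  act h := coneAct φ h
  act_one {n} x := by
    refine cone_ext φ rfl ?_ ?_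
    · rw [fst_coneAct φ _ rfl rfl, M.act_one]
    · rw [snd_coneAct, N.act_one]
  act_mul {p q r s t n} hpq hqr hsr hpt x a b := by
    refine cone_ext φ rfl ?_ ?_
    · rw [fst_coneAct φ hsr rfl rfl, fst_coneAct φ hpq rfl rfl, fst_coneAct φ hpt rfl rfl]
      exact M.act_mul _ hqr _ _ _ _ _
    · rw [snd_coneAct, snd_coneAct, snd_coneAct]
      exact N.act_mul _ hqr _ _ _ _ _
  d_act {p p' q q' n n'} h hp hq hn h₁ h₂ x a := by
    refine cone_ext φ rfl ?_ ?_
    · rw [cone_d_fst φ hn rfl, fst_coneAct φ h hp hn, map_add, fst_coneAct φ h₁ rfl rfl,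
        map_units_smul, fst_coneAct φ h₂ hp rfl, cone_d_fst φ hp rfl,
        M.d_act (p' := p' + 1) (q' := q') (n' := n' + 1) (by lia) rfl hq rfl (by lia) (by lia), map_neg,
        show p'.negOnePow = -p.negOnePow by rw [← hp, Int.negOnePow_succ]]
      simp only [Units.neg_smul, LinearMap.neg_apply]
      abel
    · rw [cone_d_snd φ hn, fst_coneAct φ h hp hn, snd_coneAct, map_add, snd_coneAct,
        map_units_smul, snd_coneAct, cone_d_snd φ hp, N.d_act h hp hq hn h₁ h₂, φ.map_act,
        map_add, LinearMap.add_apply, add_assoc]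

/-- The inclusion in the mapping cone. -/
def coneInr : N ⟶ cone φ where
  f := mappingCone.inr φ.f
  map_act h x a := by
    refine cone_ext φ rfl ?_ ?_
    · exact (inr_fst_apply φ _ _).trans (((fst_coneAct φ h rfl _ _ _).trans
        ((M.act_congr _ (inr_fst_apply φ _ x) a).trans (by simp))).symm)
    · exact (inr_snd_apply φ _).trans (((snd_coneAct φ h _ _).trans
        (N.act_congr _ (inr_snd_apply φ x) a)).symm)

/-- The mapping cone of dg modules as cone data. -/
def coneData : ConeData (DGCategory.ofHom (R := R) φ) (cone φ) where
  inl := ⟨mappingCone.inl φ.f, fun p q r p' r' hp hr h h' x a => by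
    refine cone_ext φ (by lia : r' + 1 = r) ?_ ?_
    · exact (inl_fst_apply φ _ _).trans (((fst_coneAct φ h' (by lia) _ _ _).trans
        (M.act_congr _ (inl_fst_apply φ (by lia : p' + 1 = p) x) a)).symm)
    · exact (inl_snd_apply φ _ _).trans (((snd_coneAct φ h' _ _).trans
        ((N.act_congr _ (inl_snd_apply φ _ x) a).trans (by simp))).symm)⟩
  inr := DGCategory.ofHom (coneInr φ)
  fst := ⟨(mappingCone.fst φ.f).1, fun p q r p' r' hp hr h h' x a =>
    fst_coneAct φ h hp hr x a⟩
  snd := ⟨mappingCone.snd φ.f, fun p q r p' r' hp hr h h' x a => by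
    obtain rfl : p = p' := by lia
    obtain rfl : r = r' := by lia
    exact snd_coneAct φ h x a⟩
  inl_fst := Subtype.ext (mappingCone.inl_fst φ.f)
  inl_snd := Subtype.ext (mappingCone.inl_snd φ.f)
  inr_fst := Subtype.ext (mappingCone.inr_fst φ.f)
  inr_snd := Subtype.ext (mappingCone.inr_snd φ.f)
  total := Subtype.ext (mappingCone.id φ.f)
  d_inl := Subtype.ext ((mappingCone.δ_inl φ.f).trans (Cochain.ofHom_comp _ _))
  inr_mem := ofHom_mem_cyc (coneInr φ)
  fst_mem := (mem_cyc_iff (by lia : (1 : ℤ) + 1 = 2) _).2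
    (Subtype.ext ((mappingCone.fst φ.f).δ_eq_zero 2))
  d_snd := Subtype.ext (mappingCone.δ_snd φ.f)

end Cone

variable (A) in
lemma hasCones : HasCones R (DGModule A) :=
  hasCones_of_ofHom fun _ _ f => ⟨_, ⟨coneData f⟩⟩

/-! ### Shifts of dg modules -/

section Shift

variable (M : DGModule A) (a : ℤ)

/-- The shift of a dg module. -/
def shift : DGModule A where
  cx := shiftCx M.cx a
  act {p q n} h := M.act (by lia : p + a + q = n + a)
  act_one x := M.act_one x
  act_mul _ hqr _ _ x b c := M.act_mul _ hqr _ _ x b c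
  d_act {p p' q q' n n'} h hp hq hn h₁ h₂ x b := by
    have e := M.d_act (p := p + a) (p' := p' + a) (q := q) (q' := q') (n := n + a)
      (n' := n' + a) (by lia) (by lia) hq (by lia) (by lia) (by lia) x b
    have key (u v : M.cx.X (n' + a)) : a.negOnePow • (u + (p + a).negOnePow • v) =
        a.negOnePow • u + p.negOnePow • v := by
      rw [smul_add, Int.negOnePow_add, mul_comm, mul_smul, neg_one_sq_smul]
    exact (congrArg (fun y => a.negOnePow • y) e).trans ((key _ _).trans
      (congrArg (· + _) (M.units_act _ _ _ _).symm))

lemma XIso_act {p q r p' r' : ℤ} (hp : p = p') (hr : r = r') (h : p + q = r) (h' : p' + q = r')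
    (x : M.cx.X p) (b : A.cx.X q) : (M.cx.XIsoOfEq hr).hom (M.act h x b) =
      M.act h' ((M.cx.XIsoOfEq hp).hom x) b := by
  subst hp hr
  rfl

/-- The identity, as an element of degree `e` of the complex of maps to the shift by `-e`. -/
def toShift {e b : ℤ} (h : b = -e) : (dgHom R M (M.shift b)).X e :=
  ⟨BGG.toShift M.cx h, fun _ _ _ _ _ _ _ _ _ x a => M.XIso_act _ _ _ _ x a⟩

/-- The identity, as an element of degree `e` of the complex of maps from the shift by `e`. -/
def ofShift {e b : ℤ} (h : b = e) : (dgHom R (M.shift b) M).X e :=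
  ⟨BGG.ofShift M.cx h, fun _ _ _ _ _ _ _ _ _ x a => M.XIso_act _ _ _ _ x a⟩

lemma sInv_shift (e : ℤ) : SInv (M.toShift (rfl : -e = -e)) (M.ofShift (rfl : -e = -e)) where
  left := Subtype.ext (BGG.toShift_mem M.cx (rfl : -e = -e))
  right := Subtype.ext (BGG.ofShift_mem M.cx (rfl : -e = -e))
  add := add_neg_cancel e
  left_right := Subtype.ext (BGG.sInv_shift M.cx e).left_right
  right_left := Subtype.ext (BGG.sInv_shift M.cx e).right_left

end Shift

variable (A) in
lemma hasShifts : HasShifts R (DGModule A) := fun M e => ⟨_, _, _, M.sInv_shift e⟩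

end DGModule

end

end BGG

namespace BGG

noncomputable section

open CochainComplex CochainComplex.HomComplex Cx

variable {R : Type u} [CommRing R]

namespace DGModule

variable {A : DGAlgebra R}

/-! ### Sums of dg modules -/

section Copower

variable (M : DGModule A)

/-- The sum of countably many copies of a dg module. -/
def copower : DGModule A where
  cx :=
    { X n := ModuleCat.of R (ℕ →₀ M.cx.X n)
      d n m := ModuleCat.ofHom (Finsupp.mapRange.linearMap (M.cx.d n m).hom)
      shape n m h := by
        ext x i
        simp [M.cx.shape n m h]
      d_comp_d' n m l _ _ := by
        ext x i
        simp [d_d_apply] }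
  act {p q n} h := LinearMap.flip
    { toFun b := Finsupp.mapRange.linearMap ((M.act h).flip b)
      map_add' b c := by ext; simp
      map_smul' r b := by ext; simp }
  act_one x := by
    ext i
    exact M.act_one (x i)
  act_mul hpq hqr hsr hpt x b c := by
    ext i
    exact M.act_mul hpq hqr hsr hpt (x i) b c
  d_act {p p' q q' n n'} h hp hq hn h₁ h₂ x b := by
    refine Finsupp.ext fun i => (M.d_act h hp hq hn h₁ h₂ (x i) b).trans ?_
    have (s : ℤˣ) (y : ℕ →₀ M.cx.X n') : (s • y) i = s • y i :=
      map_units_smul (Finsupp.lapply (R := R) i) s y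
    exact congrArg _ (this p.negOnePow
      (Finsupp.mapRange.linearMap ((M.act h₂).flip (A.cx.d q q' b)) x)).symm

/-- The components of an element of a sum. -/
def copowerApp {n : ℤ} (i : ℕ) : (copower M).cx.X n →ₗ[R] M.cx.X n := Finsupp.lapply i

/-- The inclusion of a summand. -/
def copowerSingle {n : ℤ} (i : ℕ) : M.cx.X n →ₗ[R] (copower M).cx.X n := Finsupp.lsingle i

/-- The linear map out of a sum given by a sequence of linear maps. -/
def copowerLsum {n : ℤ} {Q : Type u} [AddCommGroup Q] [Module R Q] (f : ℕ → M.cx.X n →ₗ[R] Q) :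
    (copower M).cx.X n →ₗ[R] Q := Finsupp.lsum R f

variable {M}

lemma copower_ext {n : ℤ} {x y : (copower M).cx.X n}
    (h : ∀ i, M.copowerApp i x = M.copowerApp i y) : x = y := Finsupp.ext h

lemma copowerLsum_single {n : ℤ} {Q : Type u} [AddCommGroup Q] [Module R Q]
    (f : ℕ → M.cx.X n →ₗ[R] Q) (i : ℕ) (x : M.cx.X n) :
    M.copowerLsum f (M.copowerSingle i x) = f i x := Finsupp.lsum_single _ _ _ _

lemma copower_hom_ext {n : ℤ} {Q : Type u} [AddCommGroup Q] [Module R Q]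
    {f g : (copower M).cx.X n →ₗ[R] Q}
    (h : ∀ i x, f (M.copowerSingle i x) = g (M.copowerSingle i x)) : f = g := Finsupp.lhom_ext h

lemma copowerApp_single {n : ℤ} (i j : ℕ) (x : M.cx.X n) :
    M.copowerApp j (M.copowerSingle i x) = if i = j then x else 0 := Finsupp.single_apply

lemma copowerApp_act {p q n : ℤ} (h : p + q = n) (x : (copower M).cx.X p) (a : A.cx.X q) (i : ℕ) :
    M.copowerApp i ((copower M).act h x a) = M.act h (M.copowerApp i x) a := rfl

lemma copowerApp_d {n m : ℤ} (x : (copower M).cx.X n) (i : ℕ) :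
    M.copowerApp i ((copower M).cx.d n m x) = M.cx.d n m (M.copowerApp i x) := rfl

lemma copower_eq_sum {n : ℤ} (x : (copower M).cx.X n) :
    ∃ k, x = ∑ i ∈ Finset.range k, M.copowerSingle i (M.copowerApp i x) := by
  obtain ⟨y, rfl⟩ : ∃ y : ℕ →₀ M.cx.X n, y = x := ⟨x, rfl⟩
  obtain ⟨k, hk⟩ : ∃ k, y.support ⊆ Finset.range k :=
    ⟨_, fun i hi => Finset.mem_range.2 (Nat.lt_succ_of_le (Finset.le_sup (f := id) hi))⟩
  refine ⟨k, ?_⟩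
  refine (Finsupp.sum_single y).symm.trans ?_
  exact Finsupp.sum_of_support_subset _ hk _ (by simp)

variable (M)

/-- The inclusions in the sum. -/
def copowerι (i : ℕ) : M ⟶ copower M where
  f :=
    { f n := ModuleCat.ofHom (M.copowerSingle i)
      comm' n m _ := by
        refine ModuleCat.hom_ext (LinearMap.ext fun x => copower_ext fun j => ?_)
        change M.copowerApp j ((copower M).cx.d n m (M.copowerSingle i x)) =
          M.copowerApp j (M.copowerSingle i (M.cx.d n m x))
        rw [copowerApp_d, copowerApp_single, copowerApp_single]
        split_ifs
        · rfl
        · exact map_zero _ }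
  map_act {p q n} h x a := by
    refine copower_ext fun j => ?_
    change M.copowerApp j (M.copowerSingle i (M.act h x a)) =
      M.copowerApp j ((copower M).act h (M.copowerSingle i x) a)
    rw [copowerApp_act, copowerApp_single, copowerApp_single]
    split_ifs <;> simp

lemma copowerSingle_act {p q n : ℤ} (h : p + q = n) (i : ℕ) (x : M.cx.X p) (a : A.cx.X q) :
    (copower M).act h (M.copowerSingle i x) a = M.copowerSingle i (M.act h x a) :=
  ((copowerι M i).map_act h x a).symm

/-- The map out of a sum given by a sequence of maps. -/
def copowerDesc {N : DGModule A} {n : ℤ} (a : ℕ → linearCochain M N n) :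
    linearCochain (copower M) N n :=
  ⟨Cochain.mk fun p q h => ModuleCat.ofHom (M.copowerLsum fun i => ((a i).1.v p q h).hom),
    fun p q r p' r' hp hr h h' x b => by
    have : (M.copowerLsum fun i => ((a i).1.v r r' hr).hom) ∘ₗ ((copower M).act h).flip b =
        ((N.act h').flip b) ∘ₗ M.copowerLsum fun i => ((a i).1.v p p' hp).hom := by
      refine copower_hom_ext fun i x => ?_
      rw [LinearMap.comp_apply, LinearMap.comp_apply, LinearMap.flip_apply, LinearMap.flip_apply,
        copowerSingle_act, copowerLsum_single, copowerLsum_single]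
      exact (a i).2 hp hr h h' x b
    exact LinearMap.congr_fun this x⟩

lemma ofHom_dgc_v {M N L : DGModule A} (f : M ⟶ N) {n : ℤ} (z : (dgHom R N L).X n) {p q : ℤ}
    (h : p + n = q) (x : M.cx.X p) :
    (dgc (DGCategory.ofHom (R := R) f) z (zero_add n)).1.v p q h x = z.1.v p q h (f.f.f p x) := by
  refine (congrArg (fun f : M.cx.X p ⟶ L.cx.X q => f x) (Cochain.comp_v
      (Cochain.ofHom f.f) z.1 (zero_add n) p p q (by lia) h)).trans ?_
  rw [Cochain.ofHom_v]
  rfl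

lemma linearCochain_ext {M N : DGModule A} {n : ℤ} {z z' : (dgHom R M N).X n}
    (h : ∀ (p q : ℤ) (hpq : p + n = q) (x : M.cx.X p), z.1.v p q hpq x = z'.1.v p q hpq x) :
    z = z' :=
  Subtype.ext (Cochain.ext _ _ fun p q hpq => ModuleCat.hom_ext (LinearMap.ext fun x => h p q hpq x))

/-- The sum of countably many copies of a dg module, as copower data. -/
def copData : CopData (R := R) M (copower M) where
  ι i := DGCategory.ofHom (copowerι M i)
  ι_mem i := ofHom_mem_cyc _
  desc a := copowerDesc M a
  ι_desc {N n} a i := linearCochain_ext fun p q hpq x => by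
    exact (ofHom_dgc_v (copowerι M i) (copowerDesc M a) hpq x).trans (copowerLsum_single _ _ _)
  ext {N n z z'} hz := by
    refine Subtype.ext (Cochain.ext _ _ fun p q hpq => ModuleCat.hom_ext
      (copower_hom_ext fun i x => ?_))
    exact (ofHom_dgc_v (copowerι M i) z hpq x).symm.trans ((congrArg
      (fun w : linearCochain M N n => w.1.v p q hpq x) (hz i)).trans
      (ofHom_dgc_v (copowerι M i) z' hpq x))

end Copower

/-! ### The free module of rank one -/

variable (A) in
/-- A dg algebra as a right module over itself. -/
def regular : DGModule A where
  cx := A.cx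
  act h := A.mul h
  act_one x := A.mul_one x
  act_mul hpq hqr hsr hpt x b c := A.mul_assoc hpq hqr hsr hpt x b c
  d_act h hp hq hn h₁ h₂ x b := A.d_mul h hp hq hn h₁ h₂ x b

variable (A) in
/-- The generator of the free module. -/
def regularOne : (regular A).cx.X 0 := A.one

lemma regularOne_act {n : ℤ} (a : A.cx.X n) : (regular A).act (zero_add n) (regularOne A) a = a :=
  A.one_mul a

lemma d_regularOne : (regular A).cx.d 0 1 (regularOne A) = 0 := by
  have := A.d_mul (add_zero 0) (zero_add 1) (zero_add 1) (zero_add 1) (add_zero 1) (zero_add 1)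
    A.one A.one
  rw [A.mul_one, A.mul_one, A.one_mul, Int.negOnePow_zero, one_smul] at this
  exact left_eq_add.1 this

/-- The morphism from the free module given by an element. -/
def yo (N : DGModule A) {n : ℤ} : N.cx.X n →ₗ[R] (dgHom R (regular A) N).X n where
  toFun x := ⟨Cochain.mk fun p q h => ModuleCat.ofHom (N.act (by lia : n + p = q) x),
    fun p q r p' r' hp hr h h' b c => (N.act_mul _ h h' (by lia) x b c).symm⟩
  map_add' x y := Subtype.ext (Cochain.ext _ _ fun p q hpq => ModuleCat.hom_ext
    ((N.act (by lia : n + p = q)).map_add x y))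
  map_smul' r x := Subtype.ext (Cochain.ext _ _ fun p q hpq => ModuleCat.hom_ext
    ((N.act (by lia : n + p = q)).map_smul r x))

/-- The value of a morphism from the free module at the generator. -/
def oy (N : DGModule A) {n : ℤ} : (dgHom R (regular A) N).X n →ₗ[R] N.cx.X n where
  toFun z := z.1.v 0 n (zero_add n) (regularOne A)
  map_add' _ _ := rfl
  map_smul' _ _ := rfl

lemma oy_yo (N : DGModule A) {n : ℤ} (x : N.cx.X n) : N.oy (N.yo x) = x := N.act_one x

lemma yo_oy (N : DGModule A) {n : ℤ} (z : (dgHom R (regular A) N).X n) : N.yo (N.oy z) = z := by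
  refine linearCochain_ext fun p q hpq x => ?_
  have h1 : z.1 ∈ linearCochain (regular A) N n := z.2
  have := h1 (p := 0) (q := p) (r := p) (p' := n) (r' := q) (by lia) hpq (by lia) (by lia)
    (regularOne A) x
  exact this.symm.trans (congrArg (fun y => z.1.v p q hpq y) (regularOne_act x))

lemma oy_dgc {N N' : DGModule A} {n e m : ℤ} (z : (dgHom R (regular A) N).X n)
    (g : (dgHom R N N').X e) (h : n + e = m) : N'.oy (dgc z g h) = g.1.v n m h (N.oy z) :=
  congrArg (fun f : (regular A).cx.X 0 ⟶ N'.cx.X m => f (regularOne A))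
    (Cochain.comp_v z.1 g.1 h 0 n m (by lia) (by lia))

lemma oy_ofHom {N N' : DGModule A} {n : ℤ} (z : (dgHom R (regular A) N).X n) (g : N ⟶ N') :
    N'.oy (dgc z (DGCategory.ofHom g) (add_zero n)) = g.f.f n (N.oy z) :=
  (oy_dgc _ _ _).trans (congrArg (fun f : N.cx.X n ⟶ N'.cx.X n => f (N.oy z))
    (Cochain.ofHom_v g.f n))

lemma oy_idE : (regular A).oy (idE R (regular A)) = regularOne A :=
  congrArg (fun f : (regular A).cx.X 0 ⟶ (regular A).cx.X 0 => f (regularOne A))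
    (Cochain.ofHom_v (𝟙 (regular A).cx) 0)

lemma oy_d (N : DGModule A) {n m : ℤ} (z : (dgHom R (regular A) N).X n) :
    N.oy ((dgHom R (regular A) N).d n m z) = N.cx.d n m (N.oy z) := by
  by_cases h : n + 1 = m
  · refine (congrArg (fun f : (regular A).cx.X 0 ⟶ N.cx.X m => f (regularOne A))
      (δ_v n m h z.1 0 m (by lia) n 1 (by lia) rfl)).trans ?_
    obtain ⟨z, hz⟩ := z
    change N.cx.d n m (z.v 0 n _ (regularOne A)) +
      m.negOnePow • z.v 1 m (by lia) ((regular A).cx.d 0 1 (regularOne A)) = _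
    rw [d_regularOne, map_zero, smul_zero, add_zero]
    rfl
  · rw [(dgHom R (regular A) N).shape _ _ h, N.cx.shape _ _ h]
    exact map_zero _

lemma yo_d (N : DGModule A) {n m : ℤ} (x : N.cx.X n) :
    N.yo (N.cx.d n m x) = (dgHom R (regular A) N).d n m (N.yo x) := by
  rw [← N.yo_oy ((dgHom R (regular A) N).d n m (N.yo x)), oy_d, oy_yo]

lemma yo_mem_cyc (N : DGModule A) {n : ℤ} {x : N.cx.X n} (hx : x ∈ cyc _ n) :
    N.yo x ∈ cyc _ n := by
  rw [mem_cyc_iff rfl, ← yo_d, d_of_mem_cyc hx, map_zero]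

lemma oy_mem_cyc (N : DGModule A) {n : ℤ} {z : (dgHom R (regular A) N).X n} (hz : z ∈ cyc _ n) :
    N.oy z ∈ cyc _ n := by
  rw [mem_cyc_iff rfl, ← oy_d, d_of_mem_cyc hz, map_zero]

lemma yo_mem_bdry (N : DGModule A) {n : ℤ} {x : N.cx.X n} (hx : x ∈ bdry _ n) :
    N.yo x ∈ bdry _ n := by
  obtain ⟨w, rfl⟩ := (mem_bdry_iff (sub_add_cancel n 1) _).1 hx
  rw [yo_d]
  exact d_mem_bdry _

lemma oy_mem_bdry (N : DGModule A) {n : ℤ} {z : (dgHom R (regular A) N).X n} (hz : z ∈ bdry _ n) :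
    N.oy z ∈ bdry _ n := by
  obtain ⟨w, rfl⟩ := (mem_bdry_iff (sub_add_cancel n 1) _).1 hz
  rw [oy_d]
  exact d_mem_bdry _

/-- The cohomology of the complex of morphisms from the free module. -/
def oyH (N : DGModule A) (n : ℤ) : HH R (regular A) N n ≃ₗ[R] H N.cx n :=
  LinearEquiv.ofLinearMap
    (Hlift N.oy (fun _ hz => N.oy_mem_cyc hz) (fun _ hz => N.oy_mem_bdry hz))
    (Hlift N.yo (fun _ hz => N.yo_mem_cyc hz) (fun _ hz => N.yo_mem_bdry hz))
    (LinearMap.ext fun a => by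
      obtain ⟨z, hz, rfl⟩ := cls_surj a
      exact cls_congr (N.oy_yo z) _)
    (LinearMap.ext fun a => by
      obtain ⟨z, hz, rfl⟩ := cls_surj a
      exact cls_congr (N.yo_oy z) _)

lemma oyH_cls (N : DGModule A) {n : ℤ} {z : (dgHom R (regular A) N).X n} (hz : z ∈ cyc _ n) :
    N.oyH n (cls z hz) = cls (N.oy z) (N.oy_mem_cyc hz) := rfl

/-- Yoneda: morphisms from the free module of rank one compute cohomology. This links the notions
relative to `regular A` with the usual ones. -/
lemma acy_iff (N : DGModule A) : Acy R (regular A) N ↔ N.cx.Acyclic := by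
  rw [acyclic_iff]
  exact forall_congr' fun n => (N.oyH n).toEquiv.subsingleton_congr

lemma kProj_iff (M : DGModule A) : KProj R (regular A) M ↔ M.IsKProjective := by
  refine forall_congr' fun N => ?_
  rw [acy_iff]
  exact imp_congr_right fun _ => (acyclic_iff (M := homComplex M N)).symm

lemma oyH_post {M N : DGModule A} (f : M ⟶ N) {n : ℤ} (a : HH R (regular A) M n) :
    N.oyH n (post (regular A) (DGCategory.ofHom f) (ofHom_mem_cyc f) (add_zero n) a) =
      Hmap f.f n (M.oyH n a) := by
  obtain ⟨z, hz, rfl⟩ := cls_surj a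
  rw [post_cls, oyH_cls, oyH_cls, Hmap_cls]
  exact cls_congr (oy_ofHom _ _) _

lemma qis_iff {M N : DGModule A} (f : M ⟶ N) :
    QIs (regular A) (DGCategory.ofHom (R := R) f) ↔ quasiIso A f := by
  have key (n : ℤ) : Function.Bijective
      (post (regular A) (DGCategory.ofHom (R := R) f) (ofHom_mem_cyc f) (add_zero n)) ↔
      Function.Bijective (Hmap f.f n) := by
    rw [← Function.Bijective.of_comp_iff' (N.oyH n).bijective,
      ← Function.Bijective.of_comp_iff (Hmap f.f n) (M.oyH n).bijective]
    exact iff_of_eq (congrArg Function.Bijective (funext fun a => oyH_post f a))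
  rw [quasiIso, quasiIso_iff_bijective]
  constructor
  · rintro ⟨_, h⟩ n
    exact (key n).1 (h _)
  · refine fun h => ⟨ofHom_mem_cyc f, fun n m hm => ?_⟩
    obtain rfl : n = m := by lia
    exact (key n).2 (h n)

lemma isCompact_copData (M : DGModule A) : (copData M).IsCompact (regular A) := by
  intro n z
  obtain ⟨k, hk⟩ := copower_eq_sum ((copower M).oy z)
  refine ⟨k, fun i => M.yo (M.copowerApp i ((copower M).oy z)), ?_⟩
  rw [← (copower M).yo_oy z, ← yo_oy _ (∑ i ∈ Finset.range k, _)]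
  congr 1
  rw [map_sum, oy_yo]
  refine hk.trans (Finset.sum_congr rfl fun i _ => ?_)
  exact ((oy_ofHom _ (copowerι M i)).trans
    (congrArg (fun y => M.copowerSingle i y) (M.oy_yo (M.copowerApp i _)))).symm

/-- If `x` dies in the cohomology of `A` it acts by zero on the cohomology of every module, so all
telescopes along `x` project by quasi-isomorphisms. -/
lemma hasTel {x : R} (hx : x • regularOne A ∈ bdry (regular A).cx 0) : HasTel R (regular A) x := by
  refine hasTel_of_hasCones (hasCones A) (hasShifts A)
    (fun M => ⟨copower M, copData M, M.isCompact_copData⟩) ?_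
  have h := yo_mem_bdry (regular A) hx
  have e : (regular A).yo (regularOne A) = idE R (regular A) := by
    rw [← yo_oy _ (idE R (regular A)), oy_idE]
  rwa [map_smul, e] at h

end DGModule

end

end BGG

namespace BGG

noncomputable section

open CochainComplex CochainComplex.HomComplex Cx

variable {R : Type u} [CommRing R]

/-! ### The unit complex -/

section Unit

variable (R) in
/-- The complex `R`, concentrated in degree `0`. -/
abbrev unitCx : CochainComplex (ModuleCat.{u} R) ℤ :=
  (CochainComplex.singleFunctor (ModuleCat.{u} R) 0).obj (ModuleCat.of R R)

variable (R) in
/-- The degree zero part of the unit complex. -/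
def unitIso : (unitCx R).X 0 ≅ ModuleCat.of R R :=
  HomologicalComplex.singleObjXSelf (ComplexShape.up ℤ) 0 (ModuleCat.of R R)

variable (R) in
/-- The generator of the unit complex. -/
def unitOne : (unitCx R).X 0 := (unitIso R).inv (1 : R)

lemma unitIso_unitOne : (unitIso R).hom (unitOne R) = (1 : R) := by
  rw [unitOne, ← ModuleCat.comp_apply, Iso.inv_hom_id]
  rfl

lemma d_unitOne (n : ℤ) : (unitCx R).d 0 n (unitOne R) = 0 := by
  exact congrArg (fun f : (unitCx R).X 0 ⟶ (unitCx R).X n => f (unitOne R))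
    (HomologicalComplex.single_obj_d _ 0 _ 0 n)

variable {N N' : CochainComplex (ModuleCat.{u} R) ℤ}

/-- The value of a cochain on the unit complex at the generator. -/
def oyC {n : ℤ} : (dgHom R (unitCx R) N).X n →ₗ[R] N.X n where
  toFun z := Cochain.v z 0 n (zero_add n) (unitOne R)
  map_add' _ _ := rfl
  map_smul' _ _ := rfl

/-- The cochain on the unit complex with a given value at the generator. -/
def yoCAux {n : ℤ} (x : N.X n) : (dgHom R (unitCx R) N).X n :=
  Cochain.fromSingleMk (ModuleCat.ofHom (LinearMap.toSpanSingleton R (N.X n) x)) (zero_add n)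

lemma oyC_yoCAux {n : ℤ} (x : N.X n) : oyC (yoCAux x) = x := by
  refine (congrArg (fun f : (unitCx R).X 0 ⟶ N.X n => f (unitOne R))
    (Cochain.fromSingleMk_v _ (zero_add n))).trans ?_
  exact (congrArg (fun r : R => LinearMap.toSpanSingleton R (N.X n) x r) unitIso_unitOne).trans
    (one_smul R x)

lemma oyC_injective {n : ℤ} : Function.Injective (oyC (N := N) (n := n)) := by
  intro z z' h
  apply (Cochain.fromSingleEquiv (zero_add n)).injective
  refine ModuleCat.hom_ext (LinearMap.ext_ring ?_)
  exact h

/-- The cochain on the unit complex with a given value at the generator. -/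
def yoC {n : ℤ} : N.X n ≃ₗ[R] (dgHom R (unitCx R) N).X n :=
  (LinearEquiv.ofBijective oyC ⟨oyC_injective, fun x => ⟨yoCAux x, oyC_yoCAux x⟩⟩).symm

lemma oyC_yoC {n : ℤ} (x : N.X n) : oyC (yoC x) = x :=
  LinearEquiv.apply_symm_apply (LinearEquiv.ofBijective oyC _) x

lemma yoC_oyC {n : ℤ} (z : (dgHom R (unitCx R) N).X n) : yoC (oyC z) = z :=
  oyC_injective (oyC_yoC _)

lemma oyC_dgc {n e m : ℤ} (z : (dgHom R (unitCx R) N).X n) (g : (dgHom R N N').X e)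
    (h : n + e = m) : oyC (dgc z g h) = Cochain.v g n m h (oyC z) :=
  congrArg (fun f : (unitCx R).X 0 ⟶ N'.X m => f (unitOne R))
    (Cochain.comp_v z g h 0 n m (by lia) (by lia))

lemma yoC_dgc {n e m : ℤ} (x : N.X n) (g : (dgHom R N N').X e)
    (h : n + e = m) : yoC (Cochain.v g n m h x) = dgc (yoC x) g h :=
  oyC_injective (by rw [oyC_yoC, oyC_dgc, oyC_yoC])

lemma oyC_d {n m : ℤ} (z : (dgHom R (unitCx R) N).X n) :
    oyC ((dgHom R (unitCx R) N).d n m z) = N.d n m (oyC z) := by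
  by_cases h : n + 1 = m
  · refine (congrArg (fun f : (unitCx R).X 0 ⟶ N.X m => f (unitOne R))
      (δ_v n m h z 0 m (by lia) n 1 (by lia) rfl)).trans ?_
    change N.d n m (Cochain.v z 0 n _ (unitOne R)) +
      m.negOnePow • Cochain.v z 1 m (by lia) ((unitCx R).d 0 1 (unitOne R)) = _
    rw [d_unitOne]
    erw [map_zero]
    rw [smul_zero, add_zero]
    rfl
  · rw [(dgHom R (unitCx R) N).shape _ _ h, N.shape _ _ h]
    exact map_zero _

lemma yoC_d {n m : ℤ} (x : N.X n) :
    yoC (N.d n m x) = (dgHom R (unitCx R) N).d n m (yoC x) :=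
  oyC_injective (by rw [oyC_d, oyC_yoC, oyC_yoC])

lemma yoC_mem_cyc {n : ℤ} {x : N.X n} (hx : x ∈ cyc _ n) : yoC x ∈ cyc _ n := by
  rw [mem_cyc_iff rfl, ← yoC_d, d_of_mem_cyc hx, map_zero]

lemma oyC_mem_cyc {n : ℤ} {z : (dgHom R (unitCx R) N).X n} (hz : z ∈ cyc _ n) :
    oyC z ∈ cyc _ n := by
  rw [mem_cyc_iff rfl, ← oyC_d, d_of_mem_cyc hz, map_zero]

lemma yoC_mem_bdry {n : ℤ} {x : N.X n} (hx : x ∈ bdry _ n) : yoC x ∈ bdry _ n := by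
  obtain ⟨w, rfl⟩ := (mem_bdry_iff (sub_add_cancel n 1) _).1 hx
  rw [yoC_d]
  exact d_mem_bdry _

lemma oyC_mem_bdry {n : ℤ} {z : (dgHom R (unitCx R) N).X n} (hz : z ∈ bdry _ n) :
    oyC z ∈ bdry _ n := by
  obtain ⟨w, rfl⟩ := (mem_bdry_iff (sub_add_cancel n 1) _).1 hz
  rw [oyC_d]
  exact d_mem_bdry _

variable (N) in
/-- The cohomology of the complex of morphisms from the unit complex. -/
def oyHC (n : ℤ) : HH R (unitCx R) N n ≃ₗ[R] H N n :=
  LinearEquiv.ofLinearMap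
    (Hlift oyC (fun _ hz => oyC_mem_cyc hz) (fun _ hz => oyC_mem_bdry hz))
    (Hlift yoC.toLinearMap (fun _ hz => yoC_mem_cyc hz) (fun _ hz => yoC_mem_bdry hz))
    (LinearMap.ext fun a => by
      obtain ⟨z, hz, rfl⟩ := cls_surj a
      exact cls_congr (oyC_yoC z) _)
    (LinearMap.ext fun a => by
      obtain ⟨z, hz, rfl⟩ := cls_surj a
      exact cls_congr (yoC_oyC z) _)

lemma oyHC_cls {n : ℤ} {z : (dgHom R (unitCx R) N).X n} (hz : z ∈ cyc _ n) :
    oyHC N n (cls z hz) = cls (oyC z) (oyC_mem_cyc hz) := rfl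

variable (N) in
lemma acy_unitCx_iff : Acy R (unitCx R) N ↔ N.Acyclic := by
  rw [acyclic_iff]
  exact forall_congr' fun n => (oyHC N n).toEquiv.subsingleton_congr

lemma oyC_ofHom {n : ℤ} (z : (dgHom R (unitCx R) N).X n) (g : N ⟶ N') :
    oyC (dgc z (DGCategory.ofHom g) (add_zero n)) = g.f n (oyC z) :=
  (oyC_dgc _ _ _).trans (congrArg (fun f : N.X n ⟶ N'.X n => f (oyC z))
    (Cochain.ofHom_v g n))

lemma oyHC_post (f : N ⟶ N') {n : ℤ} (a : HH R (unitCx R) N n) :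
    oyHC N' n (post (unitCx R) (DGCategory.ofHom f) (ofHom_mem_cyc f) (add_zero n) a) =
      Hmap f n (oyHC N n a) := by
  obtain ⟨z, hz, rfl⟩ := cls_surj a
  rw [post_cls, oyHC_cls, oyHC_cls, Hmap_cls]
  exact cls_congr (oyC_ofHom _ _) _

lemma qis_unitCx_iff (f : N ⟶ N') :
    QIs (unitCx R) (DGCategory.ofHom (R := R) f) ↔ QuasiIso f := by
  have key (n : ℤ) : Function.Bijective
      (post (unitCx R) (DGCategory.ofHom (R := R) f) (ofHom_mem_cyc f) (add_zero n)) ↔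
      Function.Bijective (Hmap f n) := by
    rw [← Function.Bijective.of_comp_iff' (oyHC N' n).bijective,
      ← Function.Bijective.of_comp_iff (Hmap f n) (oyHC N n).bijective]
    exact iff_of_eq (congrArg Function.Bijective (funext fun a => oyHC_post f a))
  rw [quasiIso_iff_bijective]
  constructor
  · rintro ⟨_, h⟩ n
    exact (key n).1 (h _)
  · refine fun h => ⟨ofHom_mem_cyc f, fun n m hm => ?_⟩
    obtain rfl : n = m := by lia
    exact (key n).2 (h n)

lemma kProj_of_isKProjective (P : CochainComplex (ModuleCat.{u} R) ℤ) [P.IsKProjective] :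
    KProj R (unitCx R) P := by
  intro N hN n
  -- K-projectivity provides null-homotopies only for morphisms of degree `0`; shifting the target
  -- reduces degree `n` to this case.
  obtain ⟨N', g, g', hg⟩ := hasShifts_complex (R := R) N (-n)
  have hN' : Acy R (unitCx R) N' := fun m => by
    have := hN (m + n)
    exact (hg.hInv.post_bijective (unitCx R) (by lia : m + n + -n = m)).2.subsingleton
  have : Subsingleton (HH R P N' 0) := by
    refine subsingleton_of_forall_eq 0 fun a => ?_
    obtain ⟨z, hz, rfl⟩ := cls_surj a
    obtain ⟨h⟩ := IsKProjective.nonempty_homotopy_zero (toHom z hz) ((acy_unitCx_iff N').1 hN')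
    rw [cls_eq_zero_iff, mem_bdry_iff (by lia : (-1 : ℤ) + 1 = 0)]
    obtain ⟨w, hw⟩ := Cochain.equivHomotopy _ _ h
    refine ⟨w, ?_⟩
    rw [Cochain.ofHom_zero, add_zero] at hw
    exact hw.symm.trans (ofHom_toHom z hz)
  exact (hg.hInv.post_bijective P (add_neg_cancel n)).1.subsingleton

/-- The cohomology of the endomorphisms of the unit complex. -/
lemma HH_unitCx_unitCx : (∀ n, n ≠ 0 → Subsingleton (HH R (unitCx R) (unitCx R) n)) ∧
    Nonempty (HH R (unitCx R) (unitCx R) 0 ≃ₗ[R] R) := by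
  constructor
  · intro n hn
    have h0 : Subsingleton ((unitCx R).X n) := ModuleCat.subsingleton_of_isZero
      (HomologicalComplex.isZero_single_obj_X (ComplexShape.up ℤ) 0 _ n hn)
    have : Subsingleton (H (unitCx R) n) := subsingleton_H_iff.2 fun z _ => by
      rw [Subsingleton.elim z 0]
      exact Submodule.zero_mem _
    exact (oyHC _ n).injective.subsingleton
  · exact ⟨oyHC _ 0 ≪≫ₗ Hequiv _ 0 ≪≫ₗ
      (HomologicalComplex.singleObjHomologySelfIso (ComplexShape.up ℤ) 0
        (ModuleCat.of R R)).toLinearEquiv⟩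

end Unit

/-! ### Morphisms from a corepresenting object -/

section Corepresented

variable {C : Type w} [Category.{v} C] [DGCategory R C] (P : C)

/-- The value of the functor at `P` is the free module, and on morphisms from `P` the functor is the
inverse of evaluation at the generator. -/
lemma mapHH_homModuleFunctor_bijective (M : C) (n : ℤ) :
    Function.Bijective (mapHH (homModuleFunctor R P) P M n) :=
  (DGModule.oyH (homModule R P M) n).symm.bijective

lemma mapHH_bijective_of_hInv {X M : C} {D : Type w'} [Category.{v'} D] [DGCategory R D]
    (F : DGFunctor R C D) {e e' : ℤ} {g : (dgHom R X P).X e} {g' : (dgHom R P X).X e'}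
    (h : HInv g g') (hF : ∀ n, Function.Bijective (mapHH F P M n)) (n : ℤ) :
    Function.Bijective (mapHH F X M n) := by
  have h1 := h.pre_bijective M (by lia : e + (n - e) = n)
  have h2 := (h.map F).pre_bijective (F.obj M) (by lia : e + (n - e) = n)
  rw [← Function.Bijective.of_comp_iff _ h1]
  convert h2.comp (hF (n - e)) using 1
  funext a
  obtain ⟨z, hz, rfl⟩ := cls_surj a
  exact cls_congr (mapHom_dgc F _ _ _) _

end Corepresented

end

end BGG

namespace BGG

noncomputable section

open RingTheory.Sequence

/-! ### Regular parameters of the completed symmetric algebra -/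

lemma isSMulRegular_quotient_ideal {A : Type*} [CommRing A] {I : Ideal A} {x : A}
    (h : ∀ f, x * f ∈ I → f ∈ I) : IsSMulRegular (A ⧸ I) x := by
  intro a b hab
  obtain ⟨a, rfl⟩ := Submodule.Quotient.mk_surjective _ a
  obtain ⟨b, rfl⟩ := Submodule.Quotient.mk_surjective _ b
  refine (Submodule.Quotient.eq _).2 (h _ ?_)
  have := (Submodule.Quotient.eq _).1 hab
  rwa [← smul_sub, smul_eq_mul] at this

/-- Membership in an ideal generated by variables is tested monomial by monomial, and multiplying by
a variable outside the generating set does not change divisibility by the generators. -/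
lemma isWeaklyRegular_X {σ A : Type*} [CommRing A] {l : List σ} (hl : l.Nodup) :
    IsWeaklyRegular (MvPolynomial σ A) (l.map (MvPolynomial.X (R := A))) := by
  refine ⟨fun i hi => ?_⟩
  have hI : (Ideal.ofList ((l.map (MvPolynomial.X (R := A))).take i) • ⊤ :
      Submodule (MvPolynomial σ A) (MvPolynomial σ A)) =
        Ideal.span (MvPolynomial.X '' {j | j ∈ l.take i}) := by
    rw [smul_eq_mul, Ideal.mul_top, Ideal.ofList]
    congr 1
    ext x
    simp [← List.map_take]
  rw [hI]
  simp only [List.length_map] at hi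
  refine isSMulRegular_quotient_ideal fun f hf => ?_
  rw [MvPolynomial.mem_ideal_span_X_image] at hf ⊢
  intro m hm
  -- The monomial `m` of `f` reappears in the product as `m` times the new variable.
  obtain ⟨j, hj, hmj⟩ := hf (m + Finsupp.single l[i] 1) (by
    rw [List.getElem_map, mul_comm, MvPolynomial.mem_support_iff, MvPolynomial.coeff_mul_X]
    exact MvPolynomial.mem_support_iff.1 hm)
  refine ⟨j, hj, fun h0 => hmj ?_⟩
  have hne : l[i] ≠ j := by
    rintro rfl
    obtain ⟨a, ha, e⟩ := List.mem_take_iff_getElem.1 hj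
    have := (hl.getElem_inj_iff).1 e
    lia
  simp [h0, hne]

/-- The inverse of `shiftMap` sends `c` to the sequence of convergent series with terms `x^m c (n +
m)`; uniqueness is separatedness. -/
lemma DC.of_isAdicComplete {A : Type*} [CommRing A] (I : Ideal A) [IsAdicComplete I A] {x : A}
    (hx : x ∈ I) : DC x A := by
  have hp (n : ℕ) (a : A) : x ^ n * a ∈ (I ^ n • ⊤ : Submodule A A) := by
    rw [smul_eq_mul, Ideal.mul_top]
    exact Ideal.mul_mem_right _ _ (Ideal.pow_mem_pow hx n)
  refine ⟨?_, fun c => ?_⟩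
  · rw [injective_iff_map_eq_zero]
    intro c hc
    have h1 (n : ℕ) : c n = x * c (n + 1) := by
      have := congrFun hc n
      rw [shiftMap_apply] at this
      exact sub_eq_zero.1 this
    have h2 (n m : ℕ) : c n = x ^ m * c (n + m) := by
      induction m with
      | zero => simp
      | succ m ih => rw [ih, h1 (n + m), pow_succ, mul_assoc, add_assoc]
    ext n
    refine IsHausdorff.haus (I := I) inferInstance (c n) fun m => ?_
    rw [SModEq.zero, h2 n m]
    exact hp m _
  · have hb (n : ℕ) : ∃ b : A, ∀ N : ℕ,
        (∑ m ∈ Finset.range N, x ^ m * c (n + m)) ≡ b [SMOD (I ^ N • ⊤ : Submodule A A)] := by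
      refine IsPrecomplete.prec (I := I) inferInstance
        (f := fun N => ∑ m ∈ Finset.range N, x ^ m * c (n + m)) fun {a b} hab => ?_
      obtain ⟨e, rfl⟩ := Nat.exists_eq_add_of_le hab
      rw [SModEq.comm, SModEq.sub_mem, Finset.sum_range_add, add_sub_cancel_left]
      refine Submodule.sum_mem _ fun i _ => ?_
      rw [pow_add, mul_assoc]
      exact hp a _
    choose b hb using hb
    refine ⟨b, ?_⟩
    ext n
    rw [shiftMap_apply, ← sub_eq_zero]
    refine IsHausdorff.haus (I := I) inferInstance _ fun N => ?_
    rw [SModEq.zero]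
    have e1 := SModEq.sub_mem.1 (hb n (N + 1))
    have e2 := SModEq.sub_mem.1 (hb (n + 1) N)
    have e1' : (∑ m ∈ Finset.range (N + 1), x ^ m * c (n + m)) - b n ∈
        (I ^ N • ⊤ : Submodule A A) :=
      Submodule.smul_mono_left (Ideal.pow_le_pow_right (Nat.le_succ N)) e1
    have e2' := Submodule.smul_mem _ x e2
    -- The partial sum of length `N + 1` at `n` is compared with that of length `N` at `n + 1`, the
    -- first term being split off.
    have e3 : (∑ m ∈ Finset.range (N + 1), x ^ m * c (n + m)) =
        x * (∑ m ∈ Finset.range N, x ^ m * c (n + 1 + m)) + c n := by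
      rw [Finset.sum_range_succ', Finset.mul_sum, pow_zero, one_mul, add_zero]
      congr 1
      refine Finset.sum_congr rfl fun m _ => ?_
      rw [pow_succ', mul_assoc, show n + (m + 1) = n + 1 + m by lia]
    rw [e3] at e1'
    have := Submodule.sub_mem _ e2' e1'
    convert this using 1
    simp only [smul_eq_mul]
    ring

section

variable (k : Type u) [Field k] (V : Type u) [AddCommGroup V] [Module k V]

lemma augmentationIdeal_eq_span {σ : Type*} (b : Module.Basis σ k V) :
    augmentationIdeal k V = Ideal.span (Set.range fun i => SymmetricAlgebra.ι k V (b i)) := by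
  refine le_antisymm (fun a ha => ?_) (Ideal.span_le.2 ?_)
  · set J : Ideal (SymmetricAlgebra k V) :=
      Ideal.span (Set.range fun i => SymmetricAlgebra.ι k V (b i))
    -- Modulo the basis elements, the quotient map and the augmentation followed by the structure
    -- map agree on generators, hence everywhere; so an element killed by the augmentation lies in
    -- `J`.
    have key : Ideal.Quotient.mkₐ k J =
        (Algebra.ofId k _).comp (SymmetricAlgebra.algebraMapInv : SymmetricAlgebra k V →ₐ[k] k) := by
      refine SymmetricAlgebra.algHom_ext (b.ext fun i => ?_)
      change Ideal.Quotient.mk J (SymmetricAlgebra.ι k V (b i)) =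
        algebraMap k (SymmetricAlgebra k V ⧸ J)
          (SymmetricAlgebra.algebraMapInv (SymmetricAlgebra.ι k V (b i)))
      rw [SymmetricAlgebra.algebraMapInv_ι, map_zero]
      exact Ideal.Quotient.eq_zero_iff_mem.2 (Ideal.subset_span (Set.mem_range_self i))
    have := DFunLike.congr_fun key a
    rw [AlgHom.comp_apply, show SymmetricAlgebra.algebraMapInv a = (0 : k) from ha, map_zero] at this
    exact Ideal.Quotient.eq_zero_iff_mem.1 this
  · rintro _ ⟨i, rfl⟩
    exact SymmetricAlgebra.algebraMapInv_ι (R := k) (b i)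

variable {k V} in
lemma augmentation_eq {s : CompletedSym k V} {a : SymmetricAlgebra k V}
    (h : AdicCompletion.evalOneₐ (augmentationIdeal k V) s = Ideal.Quotient.mk _ a) :
    augmentation k V s = SymmetricAlgebra.algebraMapInv a :=
  congrArg (Ideal.Quotient.lift (augmentationIdeal k V)
    (SymmetricAlgebra.algebraMapInv : SymmetricAlgebra k V →ₐ[k] k).toRingHom
    (fun _ h => h)) h

lemma augmentation_algebraMap (c : k) : augmentation k V (algebraMap k _ c) = c := by
  have : (AdicCompletion.evalOneₐ (augmentationIdeal k V)) (algebraMap k _ c) =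
      Ideal.Quotient.mk _ (algebraMap k (SymmetricAlgebra k V) c) := by
    rw [IsScalarTower.algebraMap_apply k (SymmetricAlgebra k V) (CompletedSym k V)]
    rfl
  exact (augmentation_eq this).trans (SymmetricAlgebra.algebraMapInv.commutes c)

lemma augmentation_surjective : Function.Surjective (augmentation k V) :=
  fun c => ⟨algebraMap k _ c, augmentation_algebraMap k V c⟩

lemma ker_augmentation_eq_map (fg : (augmentationIdeal k V).FG) :
    RingHom.ker (augmentation k V) =
      (augmentationIdeal k V).map (algebraMap _ (CompletedSym k V)) := by
  rw [← AdicCompletion.ker_evalOneₐ_eq_map _ fg]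
  ext s
  obtain ⟨a, ha⟩ := Ideal.Quotient.mk_surjective (AdicCompletion.evalOneₐ (augmentationIdeal k V) s)
  have h1 : s ∈ RingHom.ker (augmentation k V) ↔ a ∈ augmentationIdeal k V := by
    rw [RingHom.mem_ker, RingHom.mem_ker, augmentation_eq ha.symm]
  rw [h1, ← Ideal.Quotient.eq_zero_iff_mem, ha]
  exact Iff.rfl

/-- The completed symmetric algebra has a regular sequence of parameters. -/
lemma exists_parameters [FiniteDimensional k V] :
    ∃ L : List (CompletedSym k V), L.length = Module.finrank k V ∧
      IsWeaklyRegular (CompletedSym k V) L ∧ Ideal.ofList L = RingHom.ker (augmentation k V) ∧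
      ∀ x ∈ L, DC x (CompletedSym k V) := by
  set b := Module.finBasis k V
  set e := SymmetricAlgebra.equivMvPolynomial b
  have : IsNoetherianRing (SymmetricAlgebra k V) :=
    isNoetherianRing_of_ringEquiv _ e.symm.toRingEquiv
  have fg : (augmentationIdeal k V).FG := IsNoetherian.noetherian _
  let L₀ : List (SymmetricAlgebra k V) :=
    (List.finRange _).map fun i => SymmetricAlgebra.ι k V (b i)
  have h₀ : IsWeaklyRegular (SymmetricAlgebra k V) L₀ := by
    have := isWeaklyRegular_X (A := k) (List.nodup_finRange (Module.finrank k V))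
    refine (e.symm.toAddEquiv.isWeaklyRegular_congr (as := (List.finRange _).map MvPolynomial.X)
      (bs := L₀) ?_).1 this
    rw [List.forall₂_map_left_iff, List.forall₂_map_right_iff, List.forall₂_same]
    intro i _ x
    change e.symm (MvPolynomial.X i * x) = SymmetricAlgebra.ι k V (b i) * e.symm x
    rw [map_mul, SymmetricAlgebra.equivMvPolynomial_symm_X]
  have hspan : Ideal.ofList L₀ = augmentationIdeal k V := by
    rw [augmentationIdeal_eq_span k V b, Ideal.ofList]
    congr 1
    ext x
    simp [L₀]
  have hker : Ideal.ofList (L₀.map (algebraMap _ (CompletedSym k V))) =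
      RingHom.ker (augmentation k V) := by
    exact (Ideal.map_ofList _ _).symm.trans ((congrArg _ hspan).trans (ker_augmentation_eq_map k V fg).symm)
  -- Regularity passes to the completion because the completion of a Noetherian ring is flat.
  refine ⟨L₀.map (algebraMap _ (CompletedSym k V)), by simp [L₀], h₀.of_flat, hker, fun x hx => ?_⟩
  have := AdicCompletion.isAdicComplete_self _ fg
  refine DC.of_isAdicComplete ((augmentationIdeal k V).map (algebraMap _ (CompletedSym k V))) ?_
  rw [← ker_augmentation_eq_map k V fg, ← hker]
  exact Ideal.subset_span hx

lemma residue_smul (s : CompletedSym k V) (a : residueModule k V) :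
    s • a = (augmentation k V s * (show k from a) : k) := rfl

/-- The residue module is the quotient by the maximal ideal. -/
def residueEquiv : (CompletedSym k V ⧸ RingHom.ker (augmentation k V)) ≃ₗ[CompletedSym k V]
    residueModule k V := by
  let f : CompletedSym k V →ₗ[CompletedSym k V] residueModule k V :=
    { toFun := fun s => (augmentation k V s : k)
      map_add' := fun _ _ => map_add _ _ _
      map_smul' := fun s t => map_mul (augmentation k V) s t }
  refine (Submodule.quotEquivOfEq _ _ ?_).trans (f.quotKerEquivOfSurjective ?_)
  · rfl
  · exact augmentation_surjective k V

lemma smul_residue_eq_zero {s : CompletedSym k V} (hs : s ∈ RingHom.ker (augmentation k V))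
    (a : residueModule k V) : s • a = 0 := by
  rw [residue_smul, show augmentation k V s = 0 from hs, zero_mul]
  rfl

end

end

end BGG

namespace BGG

noncomputable section

open CochainComplex CochainComplex.HomComplex Cx

/-! ### Koszul resolutions and K-projective models of the residue field -/

section Koszul

open RingTheory.Sequence

variable {R : Type u} [CommRing R]

lemma smul_HH_eq_zero {C : Type w} [Category.{v} C] [DGCategory R C] {P : C} {x : R}
    (hx : x • idE R P ∈ bdry _ 0) {X : C} {n : ℤ} (a : HH R X P n) : x • a = 0 := by
  rw [← post_smul_idE]
  obtain ⟨z, hz, rfl⟩ := cls_surj a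
  rw [post_cls]
  exact (cls_eq_zero_iff _ _).2 (dgc_mem_bdry_right hz hx _)

/-- Endomorphisms of `P` are, on cohomology, morphisms from `P` to `W`, where `x` acts by zero on
the nose. -/
lemma smul_idE_mem_bdry {C : Type w} [Category.{v} C] [DGCategory R C] {U P W : C}
    (hC : HasCones R C) (hP : KProj R U P) {g : (dgHom R P W).X 0} (hg : QIs U g) {x : R}
    (hx : x • idE R W = 0) : x • idE R P ∈ bdry _ 0 := by
  refine (cls_eq_zero_iff _ (smul_idE_mem_cyc x P)).1 ?_
  apply (hP.post_bijective hC hg 0).1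
  rw [map_zero, post_cls]
  refine (cls_eq_zero_iff _ _).2 ?_
  rw [smul_dgc, idE_dgc, ← dgc_idE g, ← dgc_smul, hx, dgc_zero]
  exact Submodule.zero_mem _

/-- As each `x` acts by zero on morphisms to `P`, every class extends over the cone of `x`, and
inductively over the whole chain. The map `ι` is the inclusion of the start of the chain. -/
lemma ConeChain.exists_pre_surjective {C : Type w} [Category.{v} C] [DGCategory R C] {L : List R}
    {X Z P : C} (h : ConeChain L X Z) (hx : ∀ x ∈ L, x • idE R P ∈ bdry _ 0) :
    ∃ (ι : (dgHom R X Z).X 0) (hι : ι ∈ cyc _ 0),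
      ∀ n, Function.Surjective (pre ι hι P (zero_add n)) := by
  induction h with
  | nil X => exact ⟨idE R X, idE_mem_cyc X, fun n a => ⟨a, pre_idE a⟩⟩
  | @cons x L X Y Z c _ ih =>
    obtain ⟨ι, hι, h⟩ := ih fun y hy => hx y (List.mem_cons_of_mem _ hy)
    refine ⟨dgc c.inr ι (add_zero 0), dgc_mem_cyc c.inr_mem hι _, fun n a => ?_⟩
    obtain ⟨b, rfl⟩ := (c.x_exact_inr P a).1 (smul_HH_eq_zero (hx x (by simp)) a)
    obtain ⟨b', rfl⟩ := h n b
    exact ⟨b', (pre_pre c.inr_mem hι _ _ (add_zero 0) b').symm⟩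

variable (R) in
/-- `X` has, seen from `U`, the cohomology `M` in degree `n`. -/
def ConcAt {C : Type w} [Category.{v} C] [DGCategory R C] (U X : C) (n : ℤ) (M : Type u)
    [AddCommGroup M] [Module R M] : Prop :=
  (∀ m, m ≠ n → Subsingleton (HH R U X m)) ∧ Nonempty (HH R U X n ≃ₗ[R] M)

/-- The data of a K-projective resolution of the quotient of a ring by a complete regular
sequence generating a maximal ideal. -/
structure IsResidueResolution (L : List R) (P : CochainComplex (ModuleCat.{u} R) ℤ) : Prop where
  isWeaklyRegular : IsWeaklyRegular R L
  dc : ∀ x ∈ L, DC x R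
  maximal : (Ideal.ofList L).IsMaximal
  kProj : KProj R (unitCx R) P
  conc : ConcAt R (unitCx R) P 0 (R ⧸ Ideal.ofList L)
  null : ∀ x ∈ L, x • idE R P ∈ bdry _ 0

lemma bijective_congr {A B : Type*} {f g : A → B} (h : ∀ a, f a = g a)
    (hf : Function.Bijective f) : Function.Bijective g :=
  funext h ▸ hf

lemma bijective_of_simple {I : Ideal R} [hI : I.IsMaximal] {A B : Type*} [AddCommGroup A]
    [AddCommGroup B] [Module R A] [Module R B] (eA : A ≃ₗ[R] R ⧸ I) (eB : B ≃ₗ[R] R ⧸ I)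
    (f : A →ₗ[R] B) (hf : f ≠ 0) : Function.Bijective f := by
  have hA : IsSimpleModule R A := isSimpleModule_iff_quot_maximal.2 ⟨I, hI, ⟨eA⟩⟩
  have hB : IsSimpleModule R B := isSimpleModule_iff_quot_maximal.2 ⟨I, hI, ⟨eB⟩⟩
  exact LinearMap.bijective_of_ne_zero hf

def quotOfListSmulTop (L : List R) :
    (R ⧸ (Ideal.ofList L • ⊤ : Submodule R R)) ≃ₗ[R] R ⧸ Ideal.ofList L :=
  Submodule.quotEquivOfEq _ _ (by rw [smul_eq_mul, Ideal.mul_top])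

namespace IsResidueResolution

variable {L : List R} {P : CochainComplex (ModuleCat.{u} R) ℤ}

/-- A nonzero class in the cohomology of `P`, viewed as a map from `R`, extends to the Koszul
complex `K`. Both have the same simple module as cohomology, so by Schur's lemma the extension is a
quasi-isomorphism, hence a homotopy equivalence by K-projectivity. -/
lemma exists_koszul (h : IsResidueResolution L P) : ∃ (K : CochainComplex (ModuleCat.{u} R) ℤ) (φ : (dgHom R K P).X 0)
    (φ' : (dgHom R P K).X 0), ConeChain L (unitCx R) K ∧ HInv φ φ' := by
  obtain ⟨K, hK⟩ := ConeChain.exists_of_hasCones (hasCones_complex (R := R)) L (unitCx R)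
  obtain ⟨ι, hι, hs⟩ := hK.exists_pre_surjective h.null
  obtain ⟨hP, ⟨eP⟩⟩ := h.conc
  obtain ⟨e₀⟩ := (HH_unitCx_unitCx (R := R)).2
  obtain ⟨hU, ⟨eU⟩⟩ := hK.covariant (unitCx R) R h.isWeaklyRegular HH_unitCx_unitCx.1 e₀
  have hmax := h.maximal
  obtain ⟨a, ha⟩ : ∃ a : HH R (unitCx R) P 0, a ≠ 0 := by
    have := eP.toEquiv.nontrivial
    exact exists_ne 0
  obtain ⟨b, rfl⟩ := hs 0 a
  obtain ⟨φ, hφ, rfl⟩ := cls_surj b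
  have hq : QIs (unitCx R) φ := by
    refine ⟨hφ, fun n m hm => ?_⟩
    obtain rfl : n = m := by lia
    obtain rfl | hn := eq_or_ne n 0
    -- The induced map is nonzero because it sends the class of `ι` to the chosen nonzero class.
    · refine bijective_of_simple (I := Ideal.ofList L) (eU ≪≫ₗ quotOfListSmulTop L) eP _ fun h0 => ha ?_
      have := congrArg (fun f => f (cls ι hι)) h0
      exact this
    · have := hU n hn
      have := hP n hn
      exact ⟨fun _ _ _ => Subsingleton.elim _ _, fun b => ⟨0, Subsingleton.elim _ _⟩⟩
  obtain ⟨φ', h'⟩ := exists_hInv hasCones_complex (hK.kProj (kProj_self _)) h.kProj hq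
  exact ⟨K, φ, φ', hK, h'⟩

/-- Self-duality of the Koszul complex: maps from it to the ring have cohomology only in degree the
number of parameters, where it is the residue field. -/
lemma concAt_unitCx (h : IsResidueResolution L P) :
    ConcAt R P (unitCx R) L.length (R ⧸ Ideal.ofList L) := by
  obtain ⟨K, φ, φ', hK, hφ⟩ := h.exists_koszul
  obtain ⟨e₀⟩ := (HH_unitCx_unitCx (R := R)).2
  obtain ⟨h1, ⟨e1⟩⟩ := hK.contravariant (unitCx R) R h.isWeaklyRegular 0 L.length (zero_add _).symm
    HH_unitCx_unitCx.1 e₀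
  let e (n : ℤ) : HH R P (unitCx R) n ≃ₗ[R] HH R K (unitCx R) n :=
    LinearEquiv.ofBijective _ (hφ.pre_bijective (unitCx R) (zero_add n))
  refine ⟨fun m hm => ?_, ⟨e _ ≪≫ₗ e1 ≪≫ₗ quotOfListSmulTop L⟩⟩
  have := h1 m hm
  exact (e m).toEquiv.subsingleton

lemma hasTel (h : IsResidueResolution L P) {x : R} (hx : x ∈ L) :
    HasTel R (DGModule.regular (endDGA R P)) x :=
  DGModule.hasTel (A := endDGA R P) (h.null x hx)

end IsResidueResolution

/-- `g` exhibits the top cohomology of every dg module as a quotient of the morphisms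
from `κ`. -/
def IsTopGenerator {C : Type w} [Category.{v} C] [DGCategory R C] {U κ : C} (g : (dgHom R U κ).X 0) : Prop :=
  ∃ hg : g ∈ cyc _ 0, ∀ (N : C) (m : ℤ), (∀ i, m < i → Subsingleton (HH R U N i)) →
    (∀ i, m < i → Subsingleton (HH R κ N i)) ∧ Function.Surjective (pre g hg N (zero_add m))

lemma IsTopGenerator.transfer {C : Type w} [Category.{v} C] [DGCategory R C] {U κ κ' : C}
    {g : (dgHom R U κ).X 0} (hg : IsTopGenerator g) {e : ℤ} {s : (dgHom R κ κ').X 0}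
    {s' : (dgHom R κ' κ).X e} (hs : HInv s s') : IsTopGenerator (dgc g s (add_zero 0)) := by
  obtain ⟨hg, H⟩ := hg
  refine ⟨dgc_mem_cyc hg hs.left _, fun N m hN => ?_⟩
  obtain ⟨h1, h2⟩ := H N m hN
  refine ⟨fun i hi => ?_, fun a => ?_⟩
  · have := h1 i hi
    exact (LinearEquiv.ofBijective _ (hs.pre_bijective N (zero_add i))).toEquiv.subsingleton
  · obtain ⟨c, rfl⟩ := h2 a
    obtain ⟨e, rfl⟩ := (hs.pre_bijective N (zero_add m)).2 c
    exact ⟨e, (pre_pre hg hs.left _ (zero_add m) (add_zero 0) e).symm⟩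

/-- The generator is assembled from homotopy equivalences at the start, the map `f` of degree `d`
provided by `ConeChain.exists_surjective`, and a shift that brings the degree back to zero. -/
lemma isTopGenerator_comp {C : Type w} [Category.{v} C] [DGCategory R C] {U X Y Z κ : C} {d : ℤ}
    {u : (dgHom R U X).X 0} {u' : (dgHom R X U).X 0} (hu : HInv u u')
    {v : (dgHom R X Y).X 0} {v' : (dgHom R Y X).X 0} (hv : HInv v v')
    {f : (dgHom R Y Z).X d} (hf : f ∈ cyc _ d)
    (Hf : ∀ (N : C) (n m : ℤ) (hm : d + n = m), (∀ i, m < i → Subsingleton (HH R Y N i)) →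
        (∀ i, n < i → Subsingleton (HH R Z N i)) ∧ Function.Surjective (pre f hf N hm)) {d' : ℤ}
    {s : (dgHom R Z κ).X (-d)} {s' : (dgHom R κ Z).X d'} (hs : HInv s s') :
    ∃ g : (dgHom R U κ).X 0, IsTopGenerator g := by
  refine ⟨dgc (dgc (dgc u v (add_zero 0)) f (zero_add _)) s (add_neg_cancel _),
    ⟨dgc_mem_cyc (dgc_mem_cyc (dgc_mem_cyc hu.left hv.left _) hf _) hs.left _, fun N m hN => ?_⟩⟩
  have hb (i : ℤ) := (hu.pre_bijective N (zero_add i)).comp (hv.pre_bijective N (zero_add i))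
  obtain ⟨h2, h3⟩ := Hf N (m - d) m (by lia) fun i hi => by
    have := hN i hi
    exact (hb i).1.subsingleton
  refine ⟨fun i hi => ?_, fun a => ?_⟩
  · have := h2 (-d + i) (by lia)
    exact (hs.pre_bijective N (rfl : -d + i = _)).1.subsingleton
  · obtain ⟨b, rfl⟩ := (hb m).2 a
    obtain ⟨b, rfl⟩ := h3 b
    obtain ⟨b, rfl⟩ := (hs.pre_bijective N (by lia : -d + m = m - d)).2 b
    refine ⟨b, ?_⟩
    rw [← pre_pre (dgc_mem_cyc (dgc_mem_cyc hu.left hv.left (add_zero 0)) hf (zero_add d)) hs.left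
      (by lia : -d + m = m - d) (by lia : d + (m - d) = m), ← pre_pre
      (dgc_mem_cyc hu.left hv.left (add_zero 0)) hf (by lia : d + (m - d) = m)
      (zero_add m), ← pre_pre hu.left hv.left (zero_add m) (zero_add m)]
    rfl

namespace IsResidueResolution

variable {L : List R} {P : CochainComplex (ModuleCat.{u} R) ℤ}

open DGModule

lemma kProj_dc (h : IsResidueResolution L P) {X : DGModule (endDGA R P)}
    (hX : KProj R (regular (endDGA R P)) X) {x : R} (hx : x ∈ L) (N : DGModule (endDGA R P)) (n : ℤ) :
    DC x (HH R X N n) :=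
  KProj.dc (hasCones _) (h.hasTel hx) hX N n

lemma concAt_homModule (h : IsResidueResolution L P) :
    ConcAt R (regular (endDGA R P)) ((homModuleFunctor R P).obj (unitCx R)) L.length
      (R ⧸ Ideal.ofList L) := by
  obtain ⟨h1, ⟨e1⟩⟩ := h.concAt_unitCx
  let e (n : ℤ) : HH R P (unitCx R) n ≃ₗ[R]
      HH R (regular (endDGA R P)) ((homModuleFunctor R P).obj (unitCx R)) n :=
    LinearEquiv.ofBijective _ (mapHH_homModuleFunctor_bijective P (unitCx R) n)
  refine ⟨fun m hm => ?_, ⟨(e _).symm ≪≫ₗ e1⟩⟩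
  have := h1 m hm
  exact (e m).symm.toEquiv.subsingleton

/-- Precomposition with `q` followed by the functor is bijective on endomorphisms of the unit
complex. -/
def IsDualizing {κ : DGModule (endDGA R P)} {d : ℤ}
    (q : (dgHom R κ ((homModuleFunctor R P).obj (unitCx R))).X d) : Prop :=
  ∃ hq : QIs (regular (endDGA R P)) q, ∀ n m (hm : d + n = m), Function.Bijective
    ((pre q hq.1 ((homModuleFunctor R P).obj (unitCx R)) hm).comp
      (mapHH (homModuleFunctor R P) (unitCx R) (unitCx R) n))

lemma IsDualizing.transfer {κ κ' : DGModule (endDGA R P)} {d e e' d' : ℤ}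
    {q : (dgHom R κ ((homModuleFunctor R P).obj (unitCx R))).X d} (hq : IsDualizing q)
    {s : (dgHom R κ' κ).X e} {s' : (dgHom R κ κ').X e'} (hs : HInv s s') (hd : e + d = d') :
    IsDualizing (dgc s q hd) := by
  obtain ⟨hq, H⟩ := hq
  refine ⟨(hs.qis _).comp hq hd, fun n m hm => ?_⟩
  have e : ⇑((pre (dgc s q hd) ((hs.qis _).comp hq hd).1 ((homModuleFunctor R P).obj (unitCx R))
        hm).comp (mapHH (homModuleFunctor R P) (unitCx R) (unitCx R) n)) =
      pre s hs.left ((homModuleFunctor R P).obj (unitCx R)) (by lia : e + (d + n) = m) ∘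
        ((pre q hq.1 ((homModuleFunctor R P).obj (unitCx R)) rfl).comp
          (mapHH (homModuleFunctor R P) (unitCx R) (unitCx R) n)) :=
    funext fun a => (pre_pre hs.left hq.1 rfl _ hd _).symm
  rw [e]
  exact (hs.pre_bijective _ _).comp (H n _ rfl)

/-- The module `Hom(P, R)` has the right cohomology up to shift. Its iterated telescope is
K-projective, since the Koszul cones on it end in a module equivalent to the free one. Both
remaining properties follow from completeness along this chain of cones. -/
lemma exists_model (h : IsResidueResolution L P) : ∃ κ : DGModule (endDGA R P),
    KProj R (regular (endDGA R P)) κ ∧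
    ConcAt R (regular (endDGA R P)) κ 0 (R ⧸ Ideal.ofList L) ∧
    (∃ g : (dgHom R (regular (endDGA R P)) κ).X 0, IsTopGenerator g) ∧
    ∃ q : (dgHom R κ ((homModuleFunctor R P).obj (unitCx R))).X L.length, IsDualizing q := by
  obtain ⟨T, pr, hpr, hnat, hK⟩ := exists_telescope_functor (regular (endDGA R P)) L
    fun x hx => h.hasTel hx
  obtain ⟨K, φ, φ', hc, hφ⟩ := h.exists_koszul
  have hφF := hφ.map (homModuleFunctor R P)
  -- The value at `K` is homotopy equivalent to the value at `P`, which is the free module.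
  have hFK : KProj R (regular (endDGA R P)) ((homModuleFunctor R P).obj K) :=
    hφF.symm.kProj (kProj_self _)
  have hZ := hK _ _ (hc.map (homModuleFunctor R P)) hFK
  have hcZ := (hc.map (homModuleFunctor R P)).map T
  have hTK := hcZ.kProj hZ
  obtain ⟨v, hv⟩ := exists_hInv (hasCones _) hTK hFK (hpr _)
  have hdc (X : DGModule (endDGA R P)) (hX : KProj R (regular (endDGA R P)) X) (x : R) (hx : x ∈ L)
    (N : DGModule (endDGA R P)) (n : ℤ) : DC x (HH R X N n) := h.kProj_dc hX hx N n
  obtain ⟨f, hf, Hf⟩ := hcZ.exists_surjective hZ hdc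
  obtain ⟨κ, s, s', hs⟩ := hasShifts (endDGA R P)
    (T.obj ((homModuleFunctor R P).obj (unitCx R))) (-(L.length : ℤ))
  have hs := hs.hInv
  have hq : IsDualizing (pr ((homModuleFunctor R P).obj (unitCx R))) := by
    refine ⟨hpr _, fun n m hm => ?_⟩
    obtain rfl : n = m := by lia
    -- Double centraliser: the comparison is moved from `R` to `K`. Completeness of the source is
    -- that of `R`, and completeness of the target comes from K-projectivity of the telescope. At
    -- `K` bijectivity is Yoneda for the free module, transported along the two equivalences.
    have key := cmpr_bijective_of_chain ((homModuleFunctor R P).comp T)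
      (hpr ((homModuleFunctor R P).obj (unitCx R))).1 (S := unitCx R) hc ?_
      (fun x hx n => hdc _ hZ x hx _ n) ?_ n
    · refine bijective_congr (fun a => ?_) key
      obtain ⟨z, hz, rfl⟩ := cls_surj a
      exact cls_congr (hnat ((homModuleFunctor R P).obj (unitCx R)) _ n
        ((homModuleFunctor R P).mapHom n z)) (dgc_mem_cyc (mapHom_mem_cyc T (mapHom_mem_cyc (homModuleFunctor R P) hz)) (hpr _).1 _)
    · intro x hx n
      obtain rfl | hn := eq_or_ne n 0
      · exact (h.dc x hx).of_linearEquiv (HH_unitCx_unitCx (R := R)).2.some.symm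
      · have := (HH_unitCx_unitCx (R := R)).1 n hn
        exact DC.of_subsingleton
    · intro n
      have h1 := (hv.pre_bijective ((homModuleFunctor R P).obj (unitCx R)) (zero_add n)).comp
        (mapHH_bijective_of_hInv P (homModuleFunctor R P) hφ
          (mapHH_homModuleFunctor_bijective P (unitCx R)) n)
      refine bijective_congr (fun a => ?_) h1
      obtain ⟨z, hz, rfl⟩ := cls_surj a
      exact cls_congr (hnat ((homModuleFunctor R P).obj K) _ n
        ((homModuleFunctor R P).mapHom n z)).symm (dgc_mem_cyc (hpr _).1 (mapHom_mem_cyc (homModuleFunctor R P) hz) _)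
  have hq' := hq.transfer hs.symm (by lia : -(-(L.length : ℤ)) + 0 = L.length)
  obtain ⟨h1, ⟨e1⟩⟩ := h.concAt_homModule
  let E (n : ℤ) : HH R (regular (endDGA R P)) κ n ≃ₗ[R]
      HH R (regular (endDGA R P)) ((homModuleFunctor R P).obj (unitCx R)) (n + L.length) :=
    LinearEquiv.ofBijective _ (hq'.1.2 rfl)
  refine ⟨κ, hs.kProj hZ, ⟨fun m hm => ?_, ⟨E 0 ≪≫ₗ ?_⟩⟩, ?_, _, hq'⟩
  · have := h1 (m + L.length) (by lia)
    exact (E m).toEquiv.subsingleton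
  · rw [zero_add]
    exact e1
  · exact isTopGenerator_comp (U := regular (endDGA R P)) (X := (homModuleFunctor R P).obj K)
      hφF.symm hv.symm hf Hf hs

/-- Uniqueness of models: it suffices to produce a homotopy equivalence with the model already
constructed and to transfer both properties along it. -/
lemma exists_generator (h : IsResidueResolution L P) {κ : DGModule (endDGA R P)}
    (hκ : KProj R (regular (endDGA R P)) κ)
    (hc : ConcAt R (regular (endDGA R P)) κ 0 (R ⧸ Ideal.ofList L)) :
    (∃ g : (dgHom R (regular (endDGA R P)) κ).X 0, IsTopGenerator g) ∧
    ∃ q : (dgHom R κ ((homModuleFunctor R P).obj (unitCx R))).X L.length, IsDualizing q := by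
  obtain ⟨κ₀, hκ₀, ⟨hc₀, ⟨e₀⟩⟩, ⟨g, hg⟩, q, hq⟩ := h.exists_model
  obtain ⟨hc, ⟨e⟩⟩ := hc
  have hmax := h.maximal
  obtain ⟨b, hb⟩ : ∃ b : HH R (regular (endDGA R P)) κ 0, b ≠ 0 := by
    have := e.toEquiv.nontrivial
    exact exists_ne 0
  -- The generator property of `κ₀` extends a nonzero class of `κ` to a map `κ₀ → κ`; Schur's lemma
  -- makes it a quasi-isomorphism.
  obtain ⟨a, rfl⟩ := (hg.2 κ 0 fun i hi => hc i hi.ne').2 b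
  obtain ⟨s, hs, rfl⟩ := cls_surj a
  have hq' : QIs (regular (endDGA R P)) s := by
    refine ⟨hs, fun n m hm => ?_⟩
    obtain rfl : n = m := by lia
    obtain rfl | hn := eq_or_ne n 0
    · refine bijective_of_simple (I := Ideal.ofList L) e₀ e _ fun h0 => hb ?_
      exact congrArg (fun f => f (cls g hg.1)) h0
    · have := hc₀ n hn
      have := hc n hn
      exact ⟨fun _ _ _ => Subsingleton.elim _ _, fun b => ⟨0, Subsingleton.elim _ _⟩⟩
  obtain ⟨s', hs'⟩ := exists_hInv (hasCones _) hκ₀ hκ hq'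
  exact ⟨⟨_, hg.transfer hs'⟩, _, hq.transfer hs'.symm (zero_add _)⟩

end IsResidueResolution

end Koszul

end

end BGG

namespace BGG

noncomputable section

open CochainComplex CochainComplex.HomComplex Cx

section NatTrans

variable {R : Type u} [CommRing R]

/-- A family of morphisms that is natural with respect to morphisms of all degrees, as a natural
transformation. -/
def DGFunctor.natTrans {C : Type w} [Category.{v} C] [DGCategory R C] {D : Type w'}
    [Category.{v'} D] [DGCategory R D] {F G : DGFunctor R C D} (τ : ∀ X, F.obj X ⟶ G.obj X)
    (h : ∀ ⦃X Y : C⦄ (n : ℤ) (z : (dgHom R X Y).X n),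
      dgc (DGCategory.ofHom (τ X)) (G.mapHom n z) (zero_add n) =
        dgc (F.mapHom n z) (DGCategory.ofHom (τ Y)) (add_zero n)) :
    F.toFunctor ⟶ G.toFunctor where
  app := τ
  naturality X Y f := ofHom_inj R (by
    rw [DGCategory.ofHom_comp, DGCategory.ofHom_comp, ← F.mapHom_ofHom, ← G.mapHom_ofHom]
    exact (h 0 _).symm)

/-! ### The counit -/

section Counit

variable {C : Type w} [Category.{v} C] [DGCategory R C] {P : C}

open DGModule

lemma yo_v_eq {A : DGAlgebra R} {N N' : DGModule A} {n e m : ℤ} (x : N.cx.X n)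
    (z : (dgHom R N N').X e) (h : n + e = m) : N'.yo (z.1.v n m h x) = dgc (N.yo x) z h := by
  rw [← N'.yo_oy (dgc (N.yo x) z h), oy_dgc, oy_yo]

lemma dgc_ofHom_v {A : DGAlgebra R} {M N L : DGModule A} {n : ℤ} (z : (dgHom R M N).X n)
    (f : N ⟶ L) {p q : ℤ} (h : p + n = q) (x : M.cx.X p) :
    (dgc z (DGCategory.ofHom (R := R) f) (add_zero n)).1.v p q h x = f.f.f q (z.1.v p q h x) := by
  refine (congrArg (fun f : M.cx.X p ⟶ L.cx.X q => f x) (Cochain.comp_v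
    z.1 (Cochain.ofHom f.f) (add_zero n) p q q h (add_zero q))).trans ?_
  exact congrArg (fun g : N.cx.X q ⟶ L.cx.X q => g (z.1.v p q h x)) (Cochain.ofHom_v f.f q)

lemma yo_act {A : DGAlgebra R} (N : DGModule A) {p q n : ℤ} (h : p + q = n) (x : N.cx.X p)
    (a : A.cx.X q) : N.yo (N.act h x a) =
      dgc ((regular A).yo (n := q) a) (N.yo x) (by lia : q + p = n) := by
  refine Eq.trans ?_ (N.yo_oy (dgc ((regular A).yo (n := q) a) (N.yo x) (by lia : q + p = n)))
  refine congrArg N.yo (Eq.trans ?_ (oy_dgc ((regular A).yo (n := q) a) (N.yo x) _).symm)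
  exact (congrArg (fun b : A.cx.X q => N.act h x b) (oy_yo (regular A) (n := q) a)).symm

variable (G : DGFunctor R (DGModule (endDGA R P)) C)
  (η : (DGFunctor.id R C).toFunctor ⟶ ((homModuleFunctor R P).comp G).toFunctor)

/-- The counit at a dg module. -/
def counitMap (hη : DGFunctor.IsDGNatural η) (N : DGModule (endDGA R P)) :
    N ⟶ homModule R P (G.obj N) where
  f :=
    -- An element of `N` is a morphism from the free module, which is the image of `P`; apply `G` to
    -- it and precompose with the unit at `P`.
    { f n := ModuleCat.ofHom ((DGCategory.comp (zero_add n) (DGCategory.ofHom (η.app P))).comp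
        ((G.mapHom n).comp N.yo))
      comm' n m hnm := by
        refine ModuleCat.hom_ext (LinearMap.ext fun x => ?_)
        refine (d_dgc_of_cyc_left (ofHom_mem_cyc (η.app P)) (G.mapHom n (N.yo x)) (zero_add n)
          hnm hnm).trans ?_
        refine congrArg (fun y => dgc (DGCategory.ofHom (η.app P)) y (zero_add m)) ?_
        exact (G.mapHom_d hnm _).symm.trans (congrArg (G.mapHom m) (N.yo_d x).symm) }
  map_act {p q n} h x a := by
    refine (congrArg (fun y => dgc (DGCategory.ofHom (η.app P)) (G.mapHom n y) (zero_add n))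
      (yo_act N h x a)).trans ?_
    refine (congrArg (fun y => dgc (DGCategory.ofHom (η.app P)) y (zero_add n))
      (mapHom_dgc G ((regular (endDGA R P)).yo (n := q) a) (N.yo x) _)).trans ?_
    refine (dgc_assoc (DGCategory.ofHom (η.app P)) (G.mapHom q ((regular (endDGA R P)).yo (n := q) a))
      (G.mapHom p (N.yo x)) (zero_add q) _ (by lia) (zero_add n)).symm.trans ?_
    refine (congrArg (fun y => dgc y (G.mapHom p (N.yo x)) (by lia : q + p = n)) (hη q a)).trans ?_
    exact dgc_assoc _ _ _ (add_zero q) (zero_add p) _ (by lia)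

lemma counitMap_natural (hη : DGFunctor.IsDGNatural η) ⦃N N' : DGModule (endDGA R P)⦄ (e : ℤ)
    (z : (dgHom R N N').X e) :
    dgc (DGCategory.ofHom (counitMap G η hη N))
      ((homModuleFunctor R P).mapHom e (G.mapHom e z)) (zero_add e) =
        dgc z (DGCategory.ofHom (counitMap G η hη N')) (add_zero e) := by
  refine linearCochain_ext fun p q h x => ?_
  refine (ofHom_dgc_v _ _ h x).trans ?_
  refine Eq.trans ?_ (dgc_ofHom_v z (counitMap G η hη N') h x).symm
  refine Eq.trans ?_ (congrArg (fun y => dgc (DGCategory.ofHom (η.app P)) y (zero_add q))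
    ((congrArg (G.mapHom q) (yo_v_eq x z h)).trans (mapHom_dgc G (N.yo x) z h))).symm
  exact dgc_assoc _ _ _ (zero_add p) _ h (zero_add q)

/-- The counit. -/
def counit (hη : DGFunctor.IsDGNatural η) :
    (DGFunctor.id R (DGModule (endDGA R P))).toFunctor ⟶
      (G.comp (homModuleFunctor R P)).toFunctor :=
  DGFunctor.natTrans (counitMap G η hη) (counitMap_natural G η hη)

lemma counit_natural (hη : DGFunctor.IsDGNatural η) : DGFunctor.IsDGNatural (counit G η hη) :=
  counitMap_natural G η hη

/-- Naturality of the unit with respect to morphisms `P → M` of all degrees. Thus a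
quasi-isomorphism result for the unit at `M` yields one for the counit at `Hom(P, M)`. -/
lemma counit_app_homModule (hη : DGFunctor.IsDGNatural η) (M : C) :
    (counit G η hη).app ((homModuleFunctor R P).obj M) = (homModuleFunctor R P).map (η.app M) := by
  refine DGModule.Hom.ext (HomologicalComplex.hom_ext _ _ fun n =>
    ModuleCat.hom_ext (LinearMap.ext fun x => ?_))
  exact hη n x

end Counit

end NatTrans

end

end BGG

namespace BGG

noncomputable section

open CochainComplex CochainComplex.HomComplex Cx

/-! ### Shifts, rank one twists and the construction of the unit -/

section Unit

variable {R : Type u} [CommRing R]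

lemma cls_units {M : CochainComplex (ModuleCat.{u} R) ℤ} {n : ℤ} (a : ℤˣ) {z : M.X n}
    (hz : z ∈ cyc M n) : cls (a • z) (units_smul_mem a _ hz) = a • cls z hz := by
  obtain rfl | rfl := Int.units_eq_one_or a
  · exact (cls_congr (one_smul _ z) _).trans (one_smul _ _).symm
  · have h (A : Type u) [AddCommGroup A] (a : A) : (-1 : ℤˣ) • a = -a := by
      rw [Units.smul_def, Units.val_neg, Units.val_one, neg_one_smul]
    exact (cls_congr (h _ z) _).trans (h _ (cls z hz)).symm

lemma mem_cyc_shift {K : CochainComplex (ModuleCat.{u} R) ℤ} {a n : ℤ} (x : (K⟦a⟧).X n) :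
    x ∈ cyc (K⟦a⟧) n ↔ (show K.X (n + a) from x) ∈ cyc K (n + a) := by
  refine (mem_cyc_iff rfl _).trans
    (Iff.trans ?_ (mem_cyc_iff (by lia : n + a + 1 = n + 1 + a) (show K.X (n + a) from x)).symm)
  exact smul_eq_zero_iff_eq a.negOnePow (x := K.d (n + a) (n + 1 + a) x)

lemma mem_bdry_shift {K : CochainComplex (ModuleCat.{u} R) ℤ} {a n : ℤ} (x : (K⟦a⟧).X n) :
    x ∈ bdry (K⟦a⟧) n ↔ (show K.X (n + a) from x) ∈ bdry K (n + a) := by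
  refine (mem_bdry_iff (sub_add_cancel n 1) _).trans
    (Iff.trans ?_ (mem_bdry_iff (by lia : n - 1 + a + 1 = n + a) (show K.X (n + a) from x)).symm)
  constructor
  · rintro ⟨w, rfl⟩
    exact ⟨a.negOnePow • (show K.X (n - 1 + a) from w),
      map_units_smul (K.d (n - 1 + a) (n + a)).hom _ _⟩
  · rintro ⟨w, h⟩
    refine ⟨(a.negOnePow • w : K.X (n - 1 + a)), Eq.trans ?_ h⟩
    exact (congrArg (fun y : K.X (n + a) => a.negOnePow • y)
      (map_units_smul (K.d (n - 1 + a) (n + a)).hom a.negOnePow w)).trans (neg_one_sq_smul a _)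

/-- The cohomology of a shifted complex. -/
def Hshift (K : CochainComplex (ModuleCat.{u} R) ℤ) (a n : ℤ) : H (K⟦a⟧) n ≃ₗ[R] H K (n + a) :=
  LinearEquiv.ofLinearMap
    (Hlift (M := K⟦a⟧) (N := K) (n := n) (m := n + a) (LinearMap.id (M := K.X (n + a)))
      (fun x hx => (mem_cyc_shift x).1 hx) (fun x hx => (mem_bdry_shift x).1 hx))
    (Hlift (M := K) (N := K⟦a⟧) (n := n + a) (m := n) (LinearMap.id (M := K.X (n + a)))
      (fun x hx => (mem_cyc_shift x).2 hx) (fun x hx => (mem_bdry_shift x).2 hx))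
    (LinearMap.ext fun x => by obtain ⟨z, hz, rfl⟩ := cls_surj x; rfl)
    (LinearMap.ext fun x => by obtain ⟨z, hz, rfl⟩ := cls_surj x; rfl)

/-- Tensoring with a free module of rank one. -/
def tensorUnit {T : ModuleCat.{u} R} (ν : 𝟭 (ModuleCat.{u} R) ≅ MonoidalCategory.tensorRight T)
    (X : CochainComplex (ModuleCat.{u} R) ℤ) : X ≅ (tensorDG T).obj X :=
  HomologicalComplex.Hom.isoOfComponents (fun n => ν.app (X.X n))
    (fun n m _ => (ν.hom.naturality (X.d n m)).symm)

lemma tensorUnit_natural {T : ModuleCat.{u} R}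
    (ν : 𝟭 (ModuleCat.{u} R) ≅ MonoidalCategory.tensorRight T)
    {X Y : CochainComplex (ModuleCat.{u} R) ℤ} (n : ℤ) (z : (dgHom R X Y).X n) :
    dgc (DGCategory.ofHom (tensorUnit ν X).hom) ((tensorDG T).mapHom n z) (zero_add n) =
      dgc z (DGCategory.ofHom (tensorUnit ν Y).hom) (add_zero n) := by
  refine Cochain.ext _ _ fun p q hpq => ?_
  refine (Cochain.zero_cochain_comp_v (Cochain.ofHom (tensorUnit ν X).hom) _ p q hpq).trans ?_
  refine Eq.trans ?_ (Cochain.comp_zero_cochain_v _ (Cochain.ofHom (tensorUnit ν Y).hom) p q hpq).symm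
  rw [Cochain.ofHom_v, Cochain.ofHom_v]
  exact (ν.hom.naturality (Cochain.v z p q hpq)).symm

lemma exists_tensorRight_iso {T : ModuleCat.{u} R} (e : T ≅ ModuleCat.of R R) :
    Nonempty (𝟭 (ModuleCat.{u} R) ≅ MonoidalCategory.tensorRight T) :=
  ⟨(MonoidalCategory.rightUnitorNatIso (ModuleCat.{u} R)).symm ≪≫
    (MonoidalCategory.tensoringRight (ModuleCat.{u} R)).mapIso e.symm⟩

variable {P : CochainComplex (ModuleCat.{u} R) ℤ} {κ : DGModule (endDGA R P)} {d : ℤ}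

lemma v_dgc {X Y Z : CochainComplex (ModuleCat.{u} R) ℤ} {n : ℤ} (f : X ⟶ Y)
    (z : (dgHom R Y Z).X n) {p q : ℤ} (h : p + n = q) (x : X.X p) :
    Cochain.v (dgc (DGCategory.ofHom f) z (zero_add n)) p q h x = Cochain.v z p q h (f.f p x) := by
  refine (congrArg (fun g : X.X p ⟶ Z.X q => g x)
    (Cochain.zero_cochain_comp_v (Cochain.ofHom f) z p q h)).trans ?_
  exact congrArg (fun g : X.X p ⟶ Y.X p => Cochain.v z p q h (g x)) (Cochain.ofHom_v f p)

lemma dgc_v {X Y Z : CochainComplex (ModuleCat.{u} R) ℤ} {n : ℤ}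
    (z : (dgHom R X Y).X n) (f : Y ⟶ Z) {p q : ℤ} (h : p + n = q) (x : X.X p) :
    Cochain.v (dgc z (DGCategory.ofHom f) (add_zero n)) p q h x = f.f q (Cochain.v z p q h x) := by
  refine (congrArg (fun g : X.X p ⟶ Z.X q => g x)
    (Cochain.comp_zero_cochain_v z (Cochain.ofHom f) p q h)).trans ?_
  exact congrArg (fun g : Y.X q ⟶ Z.X q => g (Cochain.v z p q h x)) (Cochain.ofHom_v f q)

/-- Composition with `q`, as a map to the shifted complex. -/
def unitMap (q : (dgHom R κ ((homModuleFunctor R P).obj (unitCx R))).X d) (hq : q ∈ cyc _ d)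
    (M : CochainComplex (ModuleCat.{u} R) ℤ) :
    M ⟶ (dgHom R κ ((homModuleFunctor R P).obj M))⟦d⟧ where
  -- The sign `(-1)^(dn)` absorbs the sign `(-1)^d` in the differential of the shifted complex.
  f n := ModuleCat.ofHom ((d * n).negOnePow • ((DGCategory.comp (by lia : d + n = n + d) q).comp
    (((homModuleFunctor R P).mapHom n).comp (yoC (N := M)).toLinearMap)))
  comm' n m (hnm : n + 1 = m) := by
    refine ModuleCat.hom_ext (LinearMap.ext fun x => ?_)
    have h1 := d_dgc_of_cyc_left hq ((homModuleFunctor R P).mapHom n (yoC x))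
      (by lia : d + n = n + d) hnm (by lia : n + d + 1 = m + d)
    rw [← (homModuleFunctor R P).mapHom_d hnm, ← yoC_d] at h1
    change d.negOnePow • (dgHom R κ ((homModuleFunctor R P).obj M)).d (n + d) (m + d)
      ((d * n).negOnePow • dgc q ((homModuleFunctor R P).mapHom n (yoC x))) =
      (d * m).negOnePow • dgc q ((homModuleFunctor R P).mapHom m (yoC (M.d n m x)))
    rw [map_units_smul, h1, smul_smul, ← Int.negOnePow_add]
    congr 2
    rw [← hnm]
    ring

lemma unitMap_apply (q : (dgHom R κ ((homModuleFunctor R P).obj (unitCx R))).X d) (hq : q ∈ cyc _ d)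
    (M : CochainComplex (ModuleCat.{u} R) ℤ) {n : ℤ} (x : M.X n) :
    (unitMap q hq M).f n x = (d * n).negOnePow • dgc q ((homModuleFunctor R P).mapHom n (yoC x)) :=
  rfl

lemma unitMap_natural (q : (dgHom R κ ((homModuleFunctor R P).obj (unitCx R))).X d) (hq : q ∈ cyc _ d)
    {M M' : CochainComplex (ModuleCat.{u} R) ℤ} (e : ℤ) (z : (dgHom R M M').X e) :
    dgc (DGCategory.ofHom (unitMap q hq M)) ((((homModuleFunctor R P).comp
      (homFunctor R κ)).comp (shiftDG R d)).mapHom e z) (zero_add e) =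
      dgc z (DGCategory.ofHom (unitMap q hq M')) (add_zero e) := by
  refine Cochain.ext _ _ fun a b hab => ModuleCat.hom_ext (LinearMap.ext fun x => ?_)
  refine (v_dgc (unitMap q hq M) _ hab x).trans ?_
  refine Eq.trans ?_ (dgc_v z (unitMap q hq M') hab x).symm
  rw [unitMap_apply, unitMap_apply, yoC_dgc, mapHom_dgc]
  change (e * d).negOnePow • dgc ((d * a).negOnePow • dgc q ((homModuleFunctor R P).mapHom a (yoC x)))
    ((homModuleFunctor R P).mapHom e z) (by lia : a + d + e = b + d) = _
  rw [units_dgc, smul_smul, ← Int.negOnePow_add,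
    dgc_assoc q _ _ _ hab (by lia : a + d + e = b + d) (by lia : d + b = b + d)]
  congr 2
  rw [← hab]
  ring

lemma quasiIso_unitMap_iff (q : (dgHom R κ ((homModuleFunctor R P).obj (unitCx R))).X d)
    (hq : q ∈ cyc _ d) (M : CochainComplex (ModuleCat.{u} R) ℤ) :
    QuasiIso (unitMap q hq M) ↔ ∀ n, Function.Bijective
      ((pre q hq ((homModuleFunctor R P).obj M) (by lia : d + n = n + d)).comp
        (mapHH (homModuleFunctor R P) (unitCx R) M n)) := by
  rw [quasiIso_iff_bijective]
  refine forall_congr' fun n => ?_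
  set f := (pre q hq ((homModuleFunctor R P).obj M) (by lia : d + n = n + d)).comp
        (mapHH (homModuleFunctor R P) (unitCx R) M n)
  have key (a : HH R (unitCx R) M n) : Hshift _ d n (Hmap (unitMap q hq M) n (oyHC M n a)) =
      (d * n).negOnePow • f a := by
    obtain ⟨z, hz, rfl⟩ := cls_surj a
    refine Eq.trans ?_ (cls_units _ (dgc_mem_cyc hq
      (mapHom_mem_cyc (homModuleFunctor R P) hz) (by lia : d + n = n + d)))
    refine cls_congr (congrArg (fun y => (d * n).negOnePow • dgc q
      ((homModuleFunctor R P).mapHom n y) (by lia : d + n = n + d)) (yoC_oyC z)) _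
  have h1 : Function.Bijective (fun a => Hshift _ d n (Hmap (unitMap q hq M) n (oyHC M n a))) ↔
      Function.Bijective (Hmap (unitMap q hq M) n) :=
    ((Hshift _ d n).bijective.of_comp_iff' _).trans (Function.Bijective.of_comp_iff _ (oyHC M n).bijective)
  rw [← h1, funext key]
  exact (MulAction.bijective (d * n).negOnePow).of_comp_iff' f

end Unit

end

end BGG

namespace BGG

noncomputable section

open CochainComplex CochainComplex.HomComplex Cx DGModule

/-! ### Stability properties -/

section Generic

variable {R : Type u} [CommRing R] {C : Type w} [Category.{v} C] [DGCategory R C]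

/-- Cones are unique up to closed isomorphism, so the image of a cone under a dg functor may be
compared with a mapping cone. -/
lemma ConeData.exists_sInv {X Y Z Z' : C} {f : (dgHom R X Y).X 0} (c : ConeData f Z) (c' : ConeData f Z') :
    ∃ (g : (dgHom R Z Z').X 0) (g' : (dgHom R Z' Z).X 0), SInv g g' := by
  have key {Z Z' : C} (c : ConeData f Z) (c' : ConeData f Z') :
      dgc c.fst c'.inl (add_neg_cancel 1) + dgc c.snd c'.inr (add_zero 0) ∈ cyc (dgHom R Z Z') 0 := by
    rw [mem_cyc_iff (zero_add 1), map_add, d_dgc_of_cyc_left c.fst_mem c'.inl (add_neg_cancel 1)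
      (neg_add_cancel 1) (zero_add 1), c'.d_inl, d_dgc_of_cyc_right c.snd c'.inr_mem (add_zero 0)
      (zero_add 1) (zero_add 1), c.d_snd, neg_dgc, Int.negOnePow_zero, one_smul,
      dgc_assoc c.fst f c'.inr (add_zero 1) (add_zero 0) (add_zero 1) (add_zero 1), add_neg_cancel]
  have key2 {Z Z' : C} (c : ConeData f Z) (c' : ConeData f Z') :
      dgc (dgc c.fst c'.inl (add_neg_cancel 1) + dgc c.snd c'.inr (add_zero 0))
        (dgc c'.fst c.inl (add_neg_cancel 1) + dgc c'.snd c.inr (add_zero 0)) (add_zero 0) =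
        idE R Z := by
    refine Eq.trans ?_ (c.decomp_left (idE R Z)).symm
    rw [add_dgc]
    congr 1
    · rw [dgc_assoc c.fst c'.inl _ _ (by lia : -1 + 0 = -1) _ (by lia), dgc_idE]
      exact congrArg (fun y => dgc c.fst y _) (c'.inl_dgc c.inl c.inr (neg_add_cancel 1))
    · rw [dgc_assoc c.snd c'.inr _ _ (zero_add 0) _ (zero_add 0), dgc_idE]
      exact congrArg (fun y => dgc c.snd y _) (c'.inr_dgc c.inl c.inr (neg_add_cancel 1))
  exact ⟨_, _, key c c', key c' c, add_zero 0, key2 c c', key2 c' c⟩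

/-- The isomorphism given by a strictly invertible element of degree `0`. -/
def SInv.iso {X Y : C} {e' : ℤ} {g : (dgHom R X Y).X 0} {g' : (dgHom R Y X).X e'} (h : SInv g g')
    (he : e' = 0) : X ≅ Y := by
  subst he
  exact
  { hom := toHom g h.left
    inv := toHom g' h.right
    hom_inv_id := ofHom_inj R (by
      rw [DGCategory.ofHom_comp, ofHom_toHom, ofHom_toHom]
      exact h.left_right)
    inv_hom_id := ofHom_inj R (by
      rw [DGCategory.ofHom_comp, ofHom_toHom, ofHom_toHom]
      exact h.right_left) }

lemma SInv.symm {X Y : C} {e e' : ℤ} {g : (dgHom R X Y).X e} {g' : (dgHom R Y X).X e'}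
    (h : SInv g g') : SInv g' g :=
  ⟨h.right, h.left, (add_comm _ _).trans h.add, h.right_left, h.left_right⟩

lemma SInv.trans {X Y Z : C} {e e' i i' s s' : ℤ} {g : (dgHom R X Y).X e} {g' : (dgHom R Y X).X e'}
    (h : SInv g g') {f : (dgHom R Y Z).X i} {f' : (dgHom R Z Y).X i'} (hf : SInv f f')
    (hs : e + i = s) (hs' : i' + e' = s') : SInv (dgc g f hs) (dgc f' g' hs') := by
  have h1 := h.add
  have h2 := hf.add
  refine ⟨dgc_mem_cyc h.left hf.left _, dgc_mem_cyc hf.right h.right _, by lia, ?_, ?_⟩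
  · rw [dgc_assoc g f _ hs (by lia : i + s' = e') _ (by lia : e + e' = 0),
      ← dgc_assoc f f' g' hf.add hs' (zero_add e') _, hf.left_right, idE_dgc, h.left_right]
  · rw [dgc_assoc f' g' _ hs' (by lia : e' + s = i) _ (by lia : i' + i = 0),
      ← dgc_assoc g' g f ((add_comm _ _).trans h.add) hs (zero_add i) _, h.right_left, idE_dgc,
      hf.right_left]

lemma SInv.map {D : Type w'} [Category.{v'} D] [DGCategory R D] (F : DGFunctor R C D) {X Y : C}
    {e e' : ℤ} {g : (dgHom R X Y).X e} {g' : (dgHom R Y X).X e'} (h : SInv g g') :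
    SInv (F.mapHom e g) (F.mapHom e' g') where
  left := mapHom_mem_cyc F h.left
  right := mapHom_mem_cyc F h.right
  add := h.add
  left_right := by rw [← mapHom_dgc, h.left_right, mapHom_idE]
  right_left := by rw [← mapHom_dgc, h.right_left, mapHom_idE]

section Naturality

variable {D : Type w'} [Category.{v'} D] [DGCategory R D] {F G : DGFunctor R C D}
  (τ : F.toFunctor ⟶ G.toFunctor) (U : D)

/-- The action of a natural transformation on cohomology. -/
abbrev natHH (X : C) (n : ℤ) : HH R U (F.obj X) n →ₗ[R] HH R U (G.obj X) n :=
  post U (DGCategory.ofHom (τ.app X)) (ofHom_mem_cyc _) (add_zero n)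

variable {τ} in
lemma natHH_post (hτ : DGFunctor.IsDGNatural τ) {X Y : C} {e n m : ℤ} {g : (dgHom R X Y).X e}
    (hg : g ∈ cyc _ e) (h : n + e = m) (a : HH R U (F.obj X) n) :
    natHH τ U Y m (post U (F.mapHom e g) (mapHom_mem_cyc F hg) h a) =
      post U (G.mapHom e g) (mapHom_mem_cyc G hg) h (natHH τ U X n a) := by
  obtain ⟨z, hz, rfl⟩ := cls_surj a
  refine cls_congr ?_ (dgc_mem_cyc (dgc_mem_cyc hz (mapHom_mem_cyc F hg) h) (ofHom_mem_cyc _) _)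
  refine (dgc_assoc z _ _ h (add_zero e) (add_zero m) h).trans ?_
  refine (congrArg (fun y => dgc z y h) (hτ e g)).symm.trans ?_
  exact (dgc_assoc z _ _ (add_zero n) (zero_add e) h h).symm

/-- The transformation `τ` is a quasi-isomorphism at `X`. -/
abbrev natQIs (X : C) : Prop := QIs U (DGCategory.ofHom (R := R) (τ.app X))

lemma natQIs_iff (X : C) : natQIs τ U X ↔ ∀ n, Function.Bijective (natHH τ U X n) := by
  refine ⟨fun h n => h.2 _, fun h => ⟨ofHom_mem_cyc _, fun n m hm => ?_⟩⟩
  obtain rfl : n = m := by lia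
  exact h n

variable {τ U}

lemma natQIs_of_hInv (hτ : DGFunctor.IsDGNatural τ) {X Y : C} {e e' : ℤ} {g : (dgHom R X Y).X e}
    {g' : (dgHom R Y X).X e'} (hg : HInv g g') (hX : natQIs τ U X) : natQIs τ U Y := by
  rw [natQIs_iff] at hX ⊢
  intro n
  have h1 := (hg.map F).post_bijective U (sub_add_cancel n e)
  have h2 := (hg.map G).post_bijective U (sub_add_cancel n e)
  rw [← Function.Bijective.of_comp_iff _ h1]
  refine bijective_congr (fun a => (natHH_post U hτ hg.left (sub_add_cancel n e) a).symm) ?_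
  exact h2.comp (hX _)

/-- Both functors preserve cones, and naturality in all degrees makes the two long exact sequences
commute, including along `fst` of degree `1`; then the five lemma applies. -/
lemma natQIs_cone (hτ : DGFunctor.IsDGNatural τ) {X Y Z : C} {f : (dgHom R X Y).X 0}
    (hf : f ∈ cyc _ 0) (c : ConeData f Z) (hX : natQIs τ U X) (hY : natQIs τ U Y) :
    natQIs τ U Z := by
  rw [natQIs_iff] at hX hY ⊢
  intro n
  have hf₁ := mapHom_mem_cyc F hf
  have hf₂ := mapHom_mem_cyc G hf
  exact LinearMap.bijective_of_surjective_of_bijective_of_bijective_of_injective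
    (post U (F.mapHom 0 f) hf₁ (add_zero n)) (post U (c.map F).inr (c.map F).inr_mem (add_zero n))
    (post U (c.map F).fst (c.map F).fst_mem rfl) (post U (F.mapHom 0 f) hf₁ (add_zero (n + 1)))
    (post U (G.mapHom 0 f) hf₂ (add_zero n)) (post U (c.map G).inr (c.map G).inr_mem (add_zero n))
    (post U (c.map G).fst (c.map G).fst_mem rfl) (post U (G.mapHom 0 f) hf₂ (add_zero (n + 1)))
    (natHH τ U X n) (natHH τ U Y n) (natHH τ U Z n) (natHH τ U X (n + 1)) (natHH τ U Y (n + 1))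
    (LinearMap.ext fun a => (natHH_post U hτ hf _ a).symm)
    (LinearMap.ext fun a => (natHH_post U hτ c.inr_mem _ a).symm)
    (LinearMap.ext fun a => (natHH_post U hτ c.fst_mem _ a).symm)
    (LinearMap.ext fun a => (natHH_post U hτ hf _ a).symm)
    ((c.map F).exact_post_f_inr U hf₁ n) ((c.map F).exact_post_inr_fst U hf₁ rfl)
    ((c.map F).exact_post_fst_f U hf₁ rfl)
    ((c.map G).exact_post_f_inr U hf₂ n) ((c.map G).exact_post_inr_fst U hf₂ rfl)
    ((c.map G).exact_post_fst_f U hf₂ rfl)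
    (hX n).2 (hY n) (hX _) (hY _).1

lemma natQIs_of_cone (hτ : DGFunctor.IsDGNatural τ) {X Y Z : C} {f : (dgHom R X Y).X 0}
    (hf : f ∈ cyc _ 0) (c : ConeData f Z) (hX : natQIs τ U X) (hZ : natQIs τ U Z) :
    natQIs τ U Y := by
  rw [natQIs_iff] at hX hZ ⊢
  intro n
  have hf₁ := mapHom_mem_cyc F hf
  have hf₂ := mapHom_mem_cyc G hf
  exact LinearMap.bijective_of_surjective_of_bijective_of_bijective_of_injective
    (post U (c.map F).fst (c.map F).fst_mem (sub_add_cancel n 1))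
    (post U (F.mapHom 0 f) hf₁ (add_zero n)) (post U (c.map F).inr (c.map F).inr_mem (add_zero n))
    (post U (c.map F).fst (c.map F).fst_mem rfl)
    (post U (c.map G).fst (c.map G).fst_mem (sub_add_cancel n 1))
    (post U (G.mapHom 0 f) hf₂ (add_zero n)) (post U (c.map G).inr (c.map G).inr_mem (add_zero n))
    (post U (c.map G).fst (c.map G).fst_mem rfl)
    (natHH τ U Z (n - 1)) (natHH τ U X n) (natHH τ U Y n) (natHH τ U Z n) (natHH τ U X (n + 1))
    (LinearMap.ext fun a => (natHH_post U hτ c.fst_mem _ a).symm)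
    (LinearMap.ext fun a => (natHH_post U hτ hf _ a).symm)
    (LinearMap.ext fun a => (natHH_post U hτ c.inr_mem _ a).symm)
    (LinearMap.ext fun a => (natHH_post U hτ c.fst_mem _ a).symm)
    ((c.map F).exact_post_fst_f U hf₁ (sub_add_cancel n 1))
    ((c.map F).exact_post_f_inr U hf₁ n) ((c.map F).exact_post_inr_fst U hf₁ rfl)
    ((c.map G).exact_post_fst_f U hf₂ (sub_add_cancel n 1))
    ((c.map G).exact_post_f_inr U hf₂ n) ((c.map G).exact_post_inr_fst U hf₂ rfl)
    (hZ _).2 (hX n) (hZ _) (hX _).1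

end Naturality

/-! ### Finiteness of cohomology -/

section Finiteness

variable (k : Type u) [Field k] [Algebra k R]

/-- An `R`-module is finite over `k`. -/
def FinK (A : Type u) [AddCommGroup A] [Module R A] : Prop :=
  Module.Finite k ((ModuleCat.restrictScalars (algebraMap k R)).obj (ModuleCat.of R A))

/-- A linear map, viewed as a map of vector spaces. -/
abbrev resK {A B : Type u} [AddCommGroup A] [Module R A] [AddCommGroup B] [Module R B]
    (f : A →ₗ[R] B) := ((ModuleCat.restrictScalars (algebraMap k R)).map (ModuleCat.ofHom f)).hom

variable {k}

lemma FinK.of_surjective {A B : Type u} [AddCommGroup A] [Module R A] [AddCommGroup B] [Module R B]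
    (f : A →ₗ[R] B) (hf : Function.Surjective f) (hA : FinK (R := R) k A) : FinK (R := R) k B :=
  have : Module.Finite k ((ModuleCat.restrictScalars (algebraMap k R)).obj (ModuleCat.of R A)) := hA
  Module.Finite.of_surjective (resK k f) hf

lemma FinK.of_exact {A B D : Type u} [AddCommGroup A] [Module R A] [AddCommGroup B] [Module R B]
    [AddCommGroup D] [Module R D] {f : A →ₗ[R] B} {g : B →ₗ[R] D} (h : Function.Exact f g)
    (hA : FinK (R := R) k A) (hD : FinK (R := R) k D) : FinK (R := R) k B := by
  have : Module.Finite k ((ModuleCat.restrictScalars (algebraMap k R)).obj (ModuleCat.of R A)) := hA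
  have : Module.Finite k ((ModuleCat.restrictScalars (algebraMap k R)).obj (ModuleCat.of R D)) := hD
  have key : IsNoetherian k ((ModuleCat.restrictScalars (algebraMap k R)).obj (ModuleCat.of R B)) :=
    isNoetherian_of_range_eq_ker (resK k f) (resK k g)
      (LinearMap.exact_iff.1 (show Function.Exact (resK k f) (resK k g) from h)).symm
  exact Module.IsNoetherian.finite k _

lemma FinK.of_subsingleton {A : Type u} [AddCommGroup A] [Module R A] [Subsingleton A] :
    FinK (R := R) k A :=
  have : Subsingleton ((ModuleCat.restrictScalars (algebraMap k R)).obj (ModuleCat.of R A)) :=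
    inferInstanceAs (Subsingleton A)
  Module.Finite.of_finite

/-- Submodules over `R` are subspaces over `k`, so both chain conditions are inherited. -/
lemma FinK.isFiniteLength {A : Type u} [AddCommGroup A] [Module R A] (hA : FinK (R := R) k A) :
    IsFiniteLength R A := by
  let _ : Module k A := Module.compHom A (algebraMap k R)
  have : IsScalarTower k R A := ⟨fun a b c => by
    rw [Algebra.smul_def, mul_smul]
    rfl⟩
  have : Module.Finite k A := hA
  exact isFiniteLength_iff_isNoetherian_isArtinian.2
    ⟨isNoetherian_of_tower k inferInstance, isArtinian_of_tower k inferInstance⟩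

variable (k) in
/-- The total cohomology of `Hom(U, X)` is finite over `k`. -/
def Coh (U X : C) : Prop :=
  {n : ℤ | ¬ Subsingleton (HH R U X n)}.Finite ∧ ∀ n, FinK (R := R) k (HH R U X n)

lemma Coh.of_exact {U U' U'' X Y Z : C} {b : ℤ}
    (f : ∀ n, HH R U X n →ₗ[R] HH R U' Y n) (g : ∀ n, HH R U' Y n →ₗ[R] HH R U'' Z (n + b))
    (h : ∀ n, Function.Exact (f n) (g n)) (hX : Coh (R := R) k U X) (hZ : Coh (R := R) k U'' Z) :
    Coh (R := R) k U' Y := by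
  refine ⟨(hX.1.union (hZ.1.preimage (add_left_injective b).injOn)).subset fun n hn => ?_,
    fun n => FinK.of_exact (h n) (hX.2 _) (hZ.2 _)⟩
  by_contra hc
  rw [Set.mem_union, not_or] at hc
  have h1 : Subsingleton (HH R U X n) := not_not.1 hc.1
  have h2 : Subsingleton (HH R U'' Z (n + b)) := not_not.1 hc.2
  have aux (a : HH R U' Y n) : a = 0 := by
    obtain ⟨x, rfl⟩ := (h n a).1 (Subsingleton.elim _ _)
    rw [Subsingleton.elim x 0, map_zero]
  exact hn ⟨fun a a' => (aux a).trans (aux a').symm⟩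

lemma Coh.of_bijective {U U' X Y : C} {a : ℤ} (f : ∀ n, HH R U X (n + a) →ₗ[R] HH R U' Y n)
    (h : ∀ n, Function.Bijective (f n)) (hX : Coh (R := R) k U X) : Coh (R := R) k U' Y := by
  refine ⟨(hX.1.preimage (add_left_injective a).injOn).subset fun n hn hc => hn ?_,
    fun n => (hX.2 _).of_surjective (f n) (h n).2⟩
  exact (h n).2.subsingleton

lemma Coh.post_hInv {U X Y : C} {e e' : ℤ} {g : (dgHom R X Y).X e} {g' : (dgHom R Y X).X e'}
    (h : HInv g g') (hX : Coh (R := R) k U X) : Coh (R := R) k U Y :=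
  hX.of_bijective (a := -e) (fun _ => post U g h.left (neg_add_cancel_right _ e))
    fun _ => h.post_bijective U _

lemma Coh.cone {U X Y Z : C} {f : (dgHom R X Y).X 0} (hf : f ∈ cyc _ 0) (c : ConeData f Z)
    (hX : Coh (R := R) k U X) (hY : Coh (R := R) k U Y) : Coh (R := R) k U Z :=
  Coh.of_exact (fun n => post U c.inr c.inr_mem (add_zero n))
    (fun n => post U c.fst c.fst_mem rfl) (fun _ => c.exact_post_inr_fst U hf rfl) hY hX

lemma finK_H_iff (K : CochainComplex (ModuleCat.{u} R) ℤ) (n : ℤ) : FinK (R := R) k (H K n) ↔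
    Module.Finite k ((ModuleCat.restrictScalars (algebraMap k R)).obj (K.homology n)) :=
  ⟨fun h => h.of_surjective (Hequiv K n).toLinearMap (Hequiv K n).surjective,
    fun h => FinK.of_surjective (Hequiv K n).symm.toLinearMap (Hequiv K n).symm.surjective h⟩

lemma isCoherent_iff {A : DGAlgebra R} (N : DGModule A) : IsCoherent k N ↔
    {n : ℤ | ¬ Subsingleton (H N.cx n)}.Finite ∧ ∀ n, FinK (R := R) k (H N.cx n) := by
  simp only [IsCoherent, finK_H_iff, subsingleton_H_iff, isZero_homology_iff]

lemma isCoherent_homModule_iff (X Y : C) : IsCoherent k (homModule R X Y) ↔ Coh (R := R) k X Y :=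
  isCoherent_iff _

lemma isCoherent_iff_coh {A : DGAlgebra R} (N : DGModule A) :
    IsCoherent k N ↔ Coh (R := R) k (regular A) N := by
  rw [isCoherent_iff]
  have e n := (N.oyH n).toEquiv.subsingleton_congr
  simp only [← e]
  exact and_congr_right fun _ => forall_congr' fun n =>
    ⟨fun h => h.of_surjective (N.oyH n).symm.toLinearMap (N.oyH n).symm.surjective,
      fun h => h.of_surjective (N.oyH n).toLinearMap (N.oyH n).surjective⟩

end Finiteness

end Generic

end

end BGG

namespace BGG

noncomputable section

open CochainComplex CochainComplex.HomComplex Cx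

/-! ### Dévissage -/

section Devissage

variable {R : Type u} [CommRing R] {C : Type w} [Category.{v} C] [DGCategory R C] {U κ : C}
  {g : (dgHom R U κ).X 0} {I : Ideal R}

/-- The top cohomology of `N` can be attacked by a map from a shift of `κ` which is injective
on cohomology. -/
lemma IsTopGenerator.exists_injective (hg : IsTopGenerator g) (hI : I.IsMaximal)
    (hκ : ConcAt R U κ 0 (R ⧸ I)) (hS : HasShifts R C) {N : C} {b : ℤ}
    (hN : ∀ i, b < i → Subsingleton (HH R U N i)) (hb : Nontrivial (HH R U N b)) :
    ∃ (X : C) (s : (dgHom R κ X).X b) (s' : (dgHom R X κ).X (-b)) (f : (dgHom R X N).X 0)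
      (hf : f ∈ cyc _ 0), SInv s s' ∧ (∀ n, Function.Injective (post U f hf (add_zero n))) ∧
      IsSimpleModule R (HH R U X b) := by
  obtain ⟨hg, H⟩ := hg
  obtain ⟨a, ha⟩ := exists_ne (0 : HH R U N b)
  obtain ⟨c, rfl⟩ := (H N b hN).2 a
  obtain ⟨h, hh, rfl⟩ := cls_surj c
  -- A nonzero top class factors through a map `h` of degree `b` from `κ`; shifting `κ` turns it
  -- into a map of degree `0`.
  obtain ⟨X, s, s', hs⟩ := hS κ b
  have hf : dgc s' h (neg_add_cancel b) ∈ cyc (dgHom R X N) 0 := dgc_mem_cyc hs.right hh _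
  let e (n : ℤ) := LinearEquiv.ofBijective _ (hs.hInv.post_bijective U (sub_add_cancel n b))
  have : IsSimpleModule R (R ⧸ I) := isSimpleModule_iff_isCoatom.2 hI.1
  have hsimple : IsSimpleModule R (HH R U X b) :=
    IsSimpleModule.congr ((e b).symm.trans
      (show HH R U κ (b - b) ≃ₗ[R] R ⧸ I by rw [sub_self]; exact hκ.2.some))
  refine ⟨X, s, s', _, hf, hs, fun n => ?_, hsimple⟩
  by_cases hn : n = b
  · subst hn
    refine (LinearMap.injective_or_eq_zero _).resolve_right fun h0 => ha ?_
    have h1 := LinearMap.congr_fun h0 (cls (dgc g s (zero_add n)) (dgc_mem_cyc hg hs.left _))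
    rw [LinearMap.zero_apply, post_cls] at h1
    refine Eq.trans ?_ h1
    refine cls_congr ?_ (dgc_mem_cyc hg hh _)
    rw [dgc_assoc g s _ (zero_add n) (add_zero n) (add_zero n) (zero_add n),
      ← dgc_assoc s s' h hs.add (neg_add_cancel n) (zero_add n) (add_zero n), hs.left_right, idE_dgc]
  · have h1 := hκ.1 (n - b) (by lia)
    have h2 : Subsingleton (HH R U X n) := (e n).symm.toEquiv.subsingleton
    exact Function.injective_of_subsingleton _

lemma ConeData.exact_of_injective {X Y Z : C} {f : (dgHom R X Y).X 0} (c : ConeData f Z)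
    (hf : f ∈ cyc _ 0) (h : ∀ n, Function.Injective (post U f hf (add_zero n))) (n : ℤ) :
    Function.Surjective (post U c.inr c.inr_mem (add_zero n)) := by
  intro a
  refine (c.exact_post_inr_fst U hf rfl a).1 ?_
  refine h (n + 1) ?_
  rw [map_zero]
  exact (c.exact_post_fst_f U hf rfl _).2 ⟨a, rfl⟩

/-- A class of objects which contains the acyclic objects and the shifts of `κ`, and is closed
under extensions, contains all objects with bounded cohomology of finite length. -/
theorem IsTopGenerator.devissage (hg : IsTopGenerator g) (hI : I.IsMaximal)
    (hκ : ConcAt R U κ 0 (R ⧸ I)) (hC : HasCones R C) (hS : HasShifts R C) (T : C → Prop)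
    (acy : ∀ N, Acy R U N → T N)
    (shift : ∀ ⦃X : C⦄ ⦃e e' : ℤ⦄ ⦃s : (dgHom R κ X).X e⦄ ⦃s' : (dgHom R X κ).X e'⦄,
      SInv s s' → T X)
    (ext : ∀ ⦃X Y Z : C⦄ ⦃f : (dgHom R X Y).X 0⦄, f ∈ cyc _ 0 → ConeData f Z → T X → T Z → T Y)
    (N : C) (hb : {n : ℤ | ¬ Subsingleton (HH R U N n)}.Finite)
    (hl : ∀ n, IsFiniteLength R (HH R U N n)) : T N := by
  -- Double induction: on the width `w` of the range of degrees ending at `b`, and inside it on the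
  -- length of the cohomology in degree `b`.
  have key (w : ℕ) : ∀ (b : ℤ) (N : C), (∀ n, b < n → Subsingleton (HH R U N n)) →
      (∀ n, n ≤ b - w → Subsingleton (HH R U N n)) → (∀ n, IsFiniteLength R (HH R U N n)) →
      T N := by
    induction w with
    | zero =>
      intro b N h1 h2 _
      refine acy N fun n => ?_
      by_cases h : b < n
      · exact h1 n h
      · exact h2 n (by push_cast; lia)
    | succ w IH =>
      intro b N h1 h2 h3
      obtain ⟨l, hl⟩ := ENat.ne_top_iff_exists.1 (Module.length_ne_top_iff.2 (h3 b))
      induction l generalizing N with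
      | zero =>
        have h0 : Subsingleton (HH R U N b) := Module.length_eq_zero_iff.1 hl.symm
        refine IH (b - 1) N (fun n hn => ?_) (fun n hn => h2 n (by push_cast; lia)) h3
        by_cases h : n = b
        · exact h ▸ h0
        · exact h1 n (by lia)
      | succ l IH' =>
        have hnt : Nontrivial (HH R U N b) := by
          rw [← Module.length_pos_iff (R := R), ← hl]
          exact_mod_cast Nat.succ_pos l
        obtain ⟨X, s, s', f, hf, hs, hinj, hsimple⟩ := hg.exists_injective hI hκ hS h1 hnt
        obtain ⟨Z, ⟨c⟩⟩ := hC f hf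
        have hsurj := c.exact_of_injective hf hinj
        refine ext hf c (shift hs) (IH' Z (fun n hn => ?_) (fun n hn => ?_) (fun n => ?_) ?_)
        · have := h1 n hn
          exact (hsurj n).subsingleton
        · have := h2 n hn
          exact (hsurj n).subsingleton
        · exact (h3 n).of_surjective (hsurj n)
        -- Passing to the cone removes a simple submodule from the top cohomology, so its length
        -- drops by one.
        · have h4 := Module.length_eq_add_of_exact _ _ (hinj b) (hsurj b) (c.exact_post_f_inr U hf b)
          rw [← hl, Module.length_eq_one, add_comm, Nat.cast_add, Nat.cast_one] at h4
          exact (ENat.add_right_injective_of_ne_top ENat.one_ne_top h4)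
  obtain ⟨B, hB⟩ := hb.bddAbove
  obtain ⟨A, hA⟩ := hb.bddBelow
  refine key (B - A + 1).toNat B N (fun n hn => ?_) (fun n hn => ?_) hl
  · by_contra h
    exact absurd (hB h) (by lia)
  · by_contra h
    have := hA h
    have := hB h
    lia

end Devissage

end

end BGG

namespace BGG

noncomputable section

open CochainComplex CochainComplex.HomComplex Cx

/-! ### Perfect complexes -/

lemma retract_of_localization {C : Type*} [Category* C] {D : Type*} [Category* D] {A : Type*}
    [Category* A] (L : C ⥤ D) (W : MorphismProperty C) [L.IsLocalization W] (Φ : C ⥤ A)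
    (hΦ : W.IsInvertedBy Φ) {X Y : C} (h : Retract (L.obj X) (L.obj Y)) :
    Nonempty (Retract (Φ.obj X) (Φ.obj Y)) :=
  ⟨((Retract.ofIso ((Localization.fac Φ hΦ L).symm.app X)).trans
    (h.map (Localization.lift Φ hΦ L))).trans (Retract.ofIso ((Localization.fac Φ hΦ L).app Y))⟩

/-- Viewing `τ` as a functor to the arrow category, retracts in the localization become retracts of
arrows, and a retract of an isomorphism is an isomorphism. -/
lemma isIso_of_retract_of_localization {C : Type*} [Category* C] {D : Type*} [Category* D]
    {A : Type*} [Category* A] (L : C ⥤ D) (W : MorphismProperty C) [L.IsLocalization W]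
    {Φ Ψ : C ⥤ A} (τ : Φ ⟶ Ψ) (hΦ : W.IsInvertedBy Φ) (hΨ : W.IsInvertedBy Ψ) {X Y : C}
    (h : Retract (L.obj X) (L.obj Y)) (hY : IsIso (τ.app Y)) : IsIso (τ.app X) := by
  let Θ : C ⥤ Arrow A :=
    { obj X := Arrow.mk (τ.app X)
      map f := Arrow.homMk (Φ.map f) (Ψ.map f) (τ.naturality f) }
  have hΘ : W.IsInvertedBy Θ := fun X Y f hf => by
    have := hΦ f hf
    have := hΨ f hf
    exact (Arrow.isoMk (asIso (Φ.map f)) (asIso (Ψ.map f)) (τ.naturality f) :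
      Arrow.mk (τ.app X) ≅ Arrow.mk (τ.app Y)).isIso_hom
  obtain ⟨r⟩ := retract_of_localization L W Θ hΘ h
  exact MorphismProperty.of_retract (P := MorphismProperty.isomorphisms A) (f := τ.app X)
    (g := τ.app Y) r hY

section Perfect

open Limits ZeroObject

variable {R : Type u} [CommRing R] [HasDerivedCategory.{v} (ModuleCat.{u} R)]

open DerivedCategory

instance : (perfect R).IsTriangulated := by
  unfold perfect
  infer_instance

instance : (perfect R).IsStableUnderRetracts := by
  unfold perfect
  infer_instance

lemma perfect_unitCx : perfect R (Q.obj (unitCx R)) :=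
  ObjectProperty.le_triangEnvelope _ _ (by
    exact ObjectProperty.singleton_iff _ _ |>.2 rfl)

/-- An induction principle for perfect complexes. -/
theorem perfect_induction (T : CochainComplex (ModuleCat.{u} R) ℤ → Prop)
    (retract : ∀ M N, Retract (Q.obj M) (Q.obj N) → T N → T M) (unit : T (unitCx R))
    (shift : ∀ (M : CochainComplex (ModuleCat.{u} R) ℤ) (a : ℤ), T M → T (M⟦a⟧))
    (cone : ∀ ⦃M N : CochainComplex (ModuleCat.{u} R) ℤ⦄ (f : M ⟶ N), T M → T N →
      T (mappingCone f)) (M : CochainComplex (ModuleCat.{u} R) ℤ) (hM : perfect R (Q.obj M)) :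
    T M := by
  -- The property is moved to the derived category by choosing preimages; stability under retracts
  -- makes it independent of the choice.
  let G : ObjectProperty (DerivedCategory (ModuleCat.{u} R)) := fun X => T (Q.objPreimage X)
  have e (X : DerivedCategory (ModuleCat.{u} R)) := Q.objObjPreimageIso X
  have hG (M) : G (Q.obj M) ↔ T M :=
    ⟨fun h => retract _ _ (Retract.ofIso (e _).symm) h,
      fun h => retract _ _ (Retract.ofIso (e _)) h⟩
  have : G.IsStableUnderRetracts := ⟨fun {X Y} r h =>
    retract _ _ (((Retract.ofIso (e X)).trans r).trans (Retract.ofIso (e Y).symm)) h⟩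
  have : G.IsClosedUnderIsomorphisms := inferInstance
  -- Zero is a retract of the unit, so it needs no hypothesis of its own.
  have : G.ContainsZero := ⟨0, Limits.isZero_zero _, ObjectProperty.prop_of_retract G
    (Y := Q.obj (unitCx R)) ⟨0, 0, (Limits.isZero_zero _).eq_of_src _ _⟩ ((hG _).2 unit)⟩
  have : G.IsStableUnderShift ℤ := ⟨fun a => ⟨fun X hX => by
    refine G.prop_of_iso ?_ ((hG _).2 (shift (Q.objPreimage X) a hX))
    exact (Q.commShiftIso a).app _ ≪≫ (CategoryTheory.shiftFunctor _ a).mapIso (e X)⟩⟩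
  have : G.IsTriangulatedClosed₃ := .mk' fun S hS h₁ h₂ => by
    obtain ⟨X, Y, f, ⟨i⟩⟩ := (mem_distTriang_iff S).1 hS
    refine G.prop_of_iso (Pretriangulated.Triangle.π₃.mapIso i).symm ((hG _).2 (cone f ?_ ?_))
    · exact (hG _).1 (G.prop_of_iso (Pretriangulated.Triangle.π₁.mapIso i) h₁)
    · exact (hG _).1 (G.prop_of_iso (Pretriangulated.Triangle.π₂.mapIso i) h₂)
  have : G.IsTriangulatedClosed₂ := .of_isTriangulatedClosed₃
  have : G.IsTriangulated := {}
  refine (hG M).1 ((ObjectProperty.triangEnvelope_le_iff _).2 ?_ _ hM)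
  rw [ObjectProperty.singleton_le_iff]
  exact (hG _).2 unit

end Perfect

/-! ### Properties of perfect complexes tested at the unit complex -/

section Invariance

variable {R : Type u} [CommRing R]

lemma exists_sInv_shiftFunctor (M : CochainComplex (ModuleCat.{u} R) ℤ) (a : ℤ) :
    ∃ (s : (dgHom R M (M⟦a⟧)).X (-a)) (s' : (dgHom R (M⟦a⟧) M).X a), SInv s s' := by
  have key : ∃ (s : (dgHom R M (shiftCx M (- -a))).X (-a))
      (s' : (dgHom R (shiftCx M (- -a)) M).X (- -a)), SInv s s' := ⟨_, _, sInv_shift M (-a)⟩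
  rw [neg_neg] at key
  exact key

lemma quasiIso_homFunctor_map {C : Type w} [Category.{v} C] [DGCategory R C] {U X Y Z : C}
    (hC : HasCones R C) (hX : KProj R U X) (f : Y ⟶ Z) (hf : QIs U (DGCategory.ofHom (R := R) f)) :
    QuasiIso ((homFunctor R X).map f) := by
  rw [quasiIso_iff_bijective]
  exact hX.post_bijective hC hf

variable [HasDerivedCategory.{v'} (ModuleCat.{u} R)]

open DerivedCategory

/-- A dg natural transformation which is a quasi-isomorphism at the unit is one at all perfect
complexes. -/
theorem quasiIso_of_perfect
    {Φ : DGFunctor R (CochainComplex (ModuleCat.{u} R) ℤ) (CochainComplex (ModuleCat.{u} R) ℤ)}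
    (η : (DGFunctor.id R (CochainComplex (ModuleCat.{u} R) ℤ)).toFunctor ⟶ Φ.toFunctor)
    (hη : DGFunctor.IsDGNatural η)
    (hΦ : ∀ ⦃M N : CochainComplex (ModuleCat.{u} R) ℤ⦄ (f : M ⟶ N), QuasiIso f →
      QuasiIso (Φ.map f))
    (hu : QuasiIso (η.app (unitCx R))) (M : CochainComplex (ModuleCat.{u} R) ℤ)
    (hM : perfect R (Q.obj M)) : QuasiIso (η.app M) := by
  have key (M : CochainComplex (ModuleCat.{u} R) ℤ) :
      natQIs η (unitCx R) M ↔ QuasiIso (η.app M) := qis_unitCx_iff (η.app M)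
  refine perfect_induction (fun M => QuasiIso (η.app M)) (fun M N r hN => ?_) hu
    (fun M a hM => ?_) (fun M N f hM hN => ?_) M hM
  · rw [← isIso_Q_map_iff_quasiIso] at hN ⊢
    refine isIso_of_retract_of_localization Q
      (HomologicalComplex.quasiIso (ModuleCat.{u} R) (ComplexShape.up ℤ))
      (Functor.whiskerRight η Q) (fun X Y f hf => ?_) (fun X Y f hf => ?_) r hN
    · exact (isIso_Q_map_iff_quasiIso _ f).2 hf
    · exact (isIso_Q_map_iff_quasiIso _ _).2 (hΦ f hf)
  · rw [← key] at hM ⊢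
    obtain ⟨s, s', hs⟩ := exists_sInv_shiftFunctor M a
    exact natQIs_of_hInv hη hs.hInv hM
  · rw [← key] at hM hN ⊢
    exact natQIs_cone hη (ofHom_mem_cyc f) (mappingConeData f) hM hN

/-- Finiteness is preserved by shifts and cones. For retracts, the functors `H^n Hom(P, -)` invert
quasi-isomorphisms, so a retract in the derived category gives a quotient on cohomology. -/
theorem coh_of_perfect {k : Type u} [Field k] [Algebra k R]
    {P : CochainComplex (ModuleCat.{u} R) ℤ} (hP : KProj R (unitCx R) P)
    (hu : Coh (R := R) k P (unitCx R)) (M : CochainComplex (ModuleCat.{u} R) ℤ)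
    (hM : perfect R (Q.obj M)) : Coh (R := R) k P M := by
  refine perfect_induction (Coh (R := R) k P) (fun M N r hN => ?_) hu
    (fun M a hM => ?_) (fun M N f hM hN => ?_) M hM
  · have key (n : ℤ) : ∃ f : HH R P N n →ₗ[R] HH R P M n, Function.Surjective f := by
      obtain ⟨i, p, h⟩ := (retract_of_localization Q
        (HomologicalComplex.quasiIso (ModuleCat.{u} R) (ComplexShape.up ℤ))
        ((homFunctor R P).toFunctor ⋙ HomologicalComplex.homologyFunctor _ _ n)
        (fun X Y f hf => by
          have : QuasiIso ((homFunctor R P).map f) := quasiIso_homFunctor_map hasCones_complex hP f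
            ((qis_unitCx_iff f).2 hf)
          exact inferInstanceAs (IsIso (HomologicalComplex.homologyMap _ n))) r).some
      have hp : Function.Surjective p.hom := fun x => ⟨i.hom x, congrArg (fun g => g.hom x) h⟩
      refine ⟨(Hequiv (dgHom R P M) n).symm.toLinearMap.comp
        (p.hom.comp (Hequiv (dgHom R P N) n).toLinearMap), ?_⟩
      exact (Hequiv (dgHom R P M) n).symm.surjective.comp
        (hp.comp (Hequiv (dgHom R P N) n).surjective)
    choose f hf using key
    refine ⟨hN.1.subset fun n hn hc => hn ?_, fun n => (hN.2 n).of_surjective (f n) (hf n)⟩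
    exact (hf n).subsingleton
  · obtain ⟨s, s', hs⟩ := exists_sInv_shiftFunctor M a
    exact hM.post_hInv hs.hInv
  · exact hM.cone (ofHom_mem_cyc f) (mappingConeData f) hN

end Invariance

end

end BGG

namespace BGG

noncomputable section

open CochainComplex CochainComplex.HomComplex Cx DGModule DerivedCategory

/-! ### Coherent dg modules -/

section Generic

variable {R : Type u} [CommRing R]

lemma natQIs_of_qIs {C : Type w} [Category.{v} C] [DGCategory R C] {D : Type w'} [Category.{v'} D]
    [DGCategory R D] {F G : DGFunctor R C D} {τ : F.toFunctor ⟶ G.toFunctor}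
    (hτ : DGFunctor.IsDGNatural τ) {U : D} {X Y : C} {e : ℤ} {g : (dgHom R X Y).X e}
    (hg : g ∈ cyc _ e) (hF : QIs U (F.mapHom e g)) (hG : QIs U (G.mapHom e g))
    (hY : natQIs τ U Y) : natQIs τ U X := by
  rw [natQIs_iff] at hY ⊢
  intro n
  rw [← Function.Bijective.of_comp_iff' (hG.2 (rfl : n + e = n + e))]
  exact bijective_congr (fun a => (natHH_post U hτ hg rfl a)) ((hY _).comp (hF.2 (rfl : n + e = n + e)))

variable [HasDerivedCategory.{v'} (ModuleCat.{u} R)]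

lemma perfect_of_iso {M N : CochainComplex (ModuleCat.{u} R) ℤ} (e : M ≅ N)
    (h : perfect R (Q.obj M)) : perfect R (Q.obj N) :=
  (perfect R).prop_of_iso (Q.mapIso e) h

lemma perfect_iff_of_quasiIso {M N : CochainComplex (ModuleCat.{u} R) ℤ} (f : M ⟶ N)
    (hf : QuasiIso f) : perfect R (Q.obj M) ↔ perfect R (Q.obj N) :=
  have := (isIso_Q_map_iff_quasiIso _ f).2 hf
  (perfect R).prop_iff_of_iso (asIso (Q.map f))

lemma perfect_of_sInv {M N : CochainComplex (ModuleCat.{u} R) ℤ} {e e' : ℤ}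
    {s : (dgHom R M N).X e} {s' : (dgHom R N M).X e'} (hs : SInv s s')
    (h : perfect R (Q.obj M)) : perfect R (Q.obj N) := by
  obtain ⟨t, t', ht⟩ := exists_sInv_shiftFunctor M (-e)
  have := hs.add
  have i := (ht.symm.trans hs (neg_add_cancel e) (by lia : e' + - -e = 0)).iso rfl
  exact perfect_of_iso i ((perfect R).prop_of_iso ((Q.commShiftIso (-e)).app M).symm
    ((perfect R).le_shift (-e) _ h))

lemma perfect_of_cone {X Y Z : CochainComplex (ModuleCat.{u} R) ℤ} {f : (dgHom R X Y).X 0}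
    (hf : f ∈ cyc _ 0) (c : ConeData f Z) (hX : perfect R (Q.obj X)) (hZ : perfect R (Q.obj Z)) :
    perfect R (Q.obj Y) := by
  rw [← ofHom_toHom f hf] at c
  obtain ⟨s, s', hs⟩ := c.exists_sInv (mappingConeData (toHom f hf))
  exact (perfect R).ext_of_isTriangulatedClosed₂ _
    (mappingCone_triangle_distinguished (toHom f hf)) hX (perfect_of_sInv hs hZ)

/-- The zero endomorphism is a quasi-isomorphism, so the object is zero in the derived category and
a retract of the unit. -/
lemma perfect_of_acyclic {M : CochainComplex (ModuleCat.{u} R) ℤ} (h : M.Acyclic) :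
    perfect R (Q.obj M) := by
  have h1 : QuasiIso (0 : M ⟶ M) := by
    rw [acyclic_iff] at h
    rw [quasiIso_iff_bijective]
    intro n
    have := h n
    exact ⟨Function.injective_of_subsingleton _, fun b => ⟨0, Subsingleton.elim _ _⟩⟩
  rw [← isIso_Q_map_iff_quasiIso, Functor.map_zero] at h1
  have h2 : 𝟙 (Q.obj M) = 0 := by
    rw [← IsIso.hom_inv_id (0 : Q.obj M ⟶ Q.obj M), Limits.zero_comp]
  exact ObjectProperty.prop_of_retract _ (Y := Q.obj (unitCx R)) ⟨0, 0, by simp [h2]⟩ perfect_unitCx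

end Generic

/-- On an acyclic module the zero endomorphism is a quasi-isomorphism, and `G` sends it to a zero
endomorphism that is again one. -/
lemma acyclic_of_preserves {R : Type u} [CommRing R] {A : DGAlgebra R}
    (G : DGFunctor R (DGModule A) (CochainComplex (ModuleCat.{u} R) ℤ))
    (hG : ∀ ⦃N N' : DGModule A⦄ (f : N ⟶ N'), quasiIso A f → QuasiIso (G.map f))
    {N : DGModule A} (hN : Acy R (regular A) N) : (G.obj N).Acyclic := by
  have hz : (0 : (dgHom R N N).X 0) ∈ cyc _ 0 := Submodule.zero_mem _
  have h1 : quasiIso A (toHom (0 : (dgHom R N N).X 0) hz) := by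
    rw [← qis_iff, ofHom_toHom]
    refine ⟨hz, fun n m h => ?_⟩
    have := hN n
    have := hN m
    exact ⟨Function.injective_of_subsingleton _, fun b => ⟨0, Subsingleton.elim _ _⟩⟩
  have h2 := (qis_unitCx_iff _).2 (hG _ h1)
  rw [← G.mapHom_ofHom, ofHom_toHom, map_zero] at h2
  rw [← acy_unitCx_iff]
  intro n
  have h3 := h2.2 (add_zero n)
  have h4 (a : HH R (unitCx R) (G.obj N) n) : a = 0 := by
    refine h3.1 ?_
    rw [map_zero]
    obtain ⟨z, hz, rfl⟩ := cls_surj a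
    rw [post_cls, cls_eq_zero_iff, dgc_zero]
    exact Submodule.zero_mem _
  exact ⟨fun a b => (h4 a).trans (h4 b).symm⟩

lemma quasiIso_homModuleFunctor_map {R : Type u} [CommRing R]
    {P : CochainComplex (ModuleCat.{u} R) ℤ} (hP : KProj R (unitCx R) P)
    {M N : CochainComplex (ModuleCat.{u} R) ℤ} (f : M ⟶ N) (hf : QuasiIso f) :
    quasiIso (endDGA R P) ((homModuleFunctor R P).map f) :=
  quasiIso_homFunctor_map hasCones_complex hP f ((qis_unitCx_iff f).2 hf)

namespace IsResidueResolution

variable {R : Type u} [CommRing R] [HasDerivedCategory.{v'} (ModuleCat.{u} R)] {L : List R}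
  {P : CochainComplex (ModuleCat.{u} R) ℤ} {κ : DGModule (endDGA R P)}

/-- If a dg functor `G` preserves quasi-isomorphisms and admits a unit which is a
quasi-isomorphism at the unit complex, then the counit is a quasi-isomorphism on coherent dg
modules, and `G` sends these to perfect complexes. -/
theorem counit_of_coherent (h : IsResidueResolution L P) {k : Type u} [Field k] [Algebra k R]
    (hκ : KProj R (regular (endDGA R P)) κ)
    (hc : ConcAt R (regular (endDGA R P)) κ 0 (R ⧸ Ideal.ofList L))
    (G : DGFunctor R (DGModule (endDGA R P)) (CochainComplex (ModuleCat.{u} R) ℤ))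
    (hG : ∀ ⦃N N' : DGModule (endDGA R P)⦄ (f : N ⟶ N'),
      quasiIso (endDGA R P) f → QuasiIso (G.map f))
    (η : (DGFunctor.id R (CochainComplex (ModuleCat.{u} R) ℤ)).toFunctor ⟶
      ((homModuleFunctor R P).comp G).toFunctor)
    (hη : DGFunctor.IsDGNatural η) (hu : QuasiIso (η.app (unitCx R)))
    (N : DGModule (endDGA R P)) (hN : IsCoherent k N) :
    quasiIso (endDGA R P) ((counit G η hη).app N) ∧ perfect R (Q.obj (G.obj N)) := by
  obtain ⟨⟨g, hg⟩, q, hq, -⟩ := h.exists_generator hκ hc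
  have hθ := counit_natural G η hη
  let U := regular (endDGA R P)
  let T (N : DGModule (endDGA R P)) : Prop :=
    natQIs (counit G η hη) U N ∧ perfect R (Q.obj (G.obj N))
  have hF {M M' : CochainComplex (ModuleCat.{u} R) ℤ} (f : M ⟶ M') (hf : QuasiIso f) :=
    quasiIso_homModuleFunctor_map h.kProj f hf
  -- At the image of the unit complex the counit is the image of the unit `η`, and `G` returns a
  -- complex quasi-isomorphic to `R`.
  have hT0 : T ((homModuleFunctor R P).obj (unitCx R)) := by
    refine ⟨?_, (perfect_iff_of_quasiIso _ hu).1 perfect_unitCx⟩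
    refine (qis_iff _).2 ?_
    rw [counit_app_homModule]
    exact hF _ hu
  have hTs {X Y : DGModule (endDGA R P)} {e e' : ℤ} {s : (dgHom R X Y).X e}
      {s' : (dgHom R Y X).X e'} (hs : SInv s s') (hX : T X) : T Y :=
    ⟨natQIs_of_hInv hθ hs.hInv hX.1, perfect_of_sInv (hs.map G) hX.2⟩
  have hTq {X Y : DGModule (endDGA R P)} (f : X ⟶ Y) (hf : quasiIso (endDGA R P) f) (hY : T Y) :
      T X := by
    refine ⟨natQIs_of_qIs hθ (ofHom_mem_cyc f) ((qis_iff f).2 hf) ?_ hY.1,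
      (perfect_iff_of_quasiIso _ (hG f hf)).2 hY.2⟩
    rw [DGFunctor.mapHom_ofHom]
    exact (qis_iff _).2 (hF _ (hG f hf))
  -- The dualizing class makes a shift of `κ` quasi-isomorphic to the image of the unit complex.
  have hTκ : T κ := by
    obtain ⟨X, s, s', hs⟩ := DGModule.hasShifts _ κ L.length
    have h1 := QIs.comp (hs.symm.hInv.qis U) hq (neg_add_cancel _)
    rw [← ofHom_toHom _ h1.1] at h1
    exact hTs hs.symm (hTq _ ((qis_iff _).1 h1) hT0)
  have hT := hg.devissage h.maximal hc (DGModule.hasCones _) (DGModule.hasShifts _) T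
    (fun N hN => by
      have hGN := acyclic_of_preserves G hG hN
      refine ⟨?_, perfect_of_acyclic hGN⟩
      rw [natQIs_iff]
      intro n
      have h1 := hN n
      have h2 : Subsingleton (HH R U ((homModuleFunctor R P).obj (G.obj N)) n) :=
        (oyH ((homModuleFunctor R P).obj (G.obj N)) n).toEquiv.subsingleton_congr.2
          (h.kProj (G.obj N) ((acy_unitCx_iff _).2 hGN) n)
      exact ⟨fun a b _ => h1.elim a b, fun b => ⟨0, h2.elim _ b⟩⟩)
    (fun _ _ _ _ _ hs => hTs hs hTκ)
    (fun _ _ _ _ hf c hX hZ =>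
      ⟨natQIs_of_cone hθ hf c hX.1 hZ.1, perfect_of_cone (mapHom_mem_cyc G hf) (c.map G) hX.2 hZ.2⟩)
    N ((isCoherent_iff_coh N).1 hN).1 fun n => (((isCoherent_iff_coh N).1 hN).2 n).isFiniteLength
  exact ⟨(qis_iff _).1 hT.1, hT.2⟩

end IsResidueResolution

end

end BGG

namespace BGG

noncomputable section

/-! ### Equivalences between subcategories of localizations -/

section Localizations

variable {C : Type*} [Category* C] {C' : Type*} [Category* C'] {D : Type*} [Category* D]
  {D' : Type*} [Category* D']

/-- The transformation `τ` descends to the localization, and its value at an object is an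
isomorphism as soon as it is one at some representative. -/
lemma exists_unit_of_localization (L : C ⥤ D) (W : MorphismProperty C) [L.IsLocalization W]
    {L' : C' ⥤ D'} (p : ObjectProperty D) {F : C ⥤ C'} {G : C' ⥤ C}
    {RF : D ⥤ D'} {RG : D' ⥤ D} (iF : L ⋙ RF ≅ F ⋙ L') (iG : L' ⋙ RG ≅ G ⋙ L)
    (τ : 𝟭 C ⟶ F ⋙ G)
    (hτ : ∀ X, p X → ∃ M, Nonempty (L.obj M ≅ X) ∧ IsIso (L.map (τ.app M))) :
    ∃ σ : 𝟭 D ⟶ RF ⋙ RG, ∀ X, p X → IsIso (σ.app X) := by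
  let _ : Localization.Lifting L W ((F ⋙ G) ⋙ L) (RF ⋙ RG) :=
    ⟨(Functor.associator _ _ _).symm ≪≫ Functor.isoWhiskerRight iF RG ≪≫
      Functor.associator _ _ _ ≪≫ Functor.isoWhiskerLeft F iG ≪≫ (Functor.associator _ _ _).symm⟩
  let _ : Localization.Lifting L W (𝟭 C ⋙ L) (𝟭 D) := ⟨Functor.rightUnitor L⟩
  let σ := Localization.liftNatTrans L W (𝟭 C ⋙ L) ((F ⋙ G) ⋙ L) (𝟭 D) (RF ⋙ RG)
    (Functor.whiskerRight τ L)
  refine ⟨σ, fun X hX => ?_⟩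
  obtain ⟨M, ⟨i⟩, h1⟩ := hτ X hX
  have h2 : IsIso (σ.app (L.obj M)) := by
    rw [Localization.liftNatTrans_app]
    have : IsIso ((Functor.whiskerRight τ L).app M) := h1
    infer_instance
  have h3 := σ.naturality i.hom
  have h4 : σ.app X = (𝟭 D).map i.inv ≫ σ.app (L.obj M) ≫ (RF ⋙ RG).map i.hom := by
    rw [← h3, ← Category.assoc, ← Functor.map_comp, Iso.inv_hom_id, CategoryTheory.Functor.map_id,
      Category.id_comp]
  rw [h4]
  infer_instance

/-- An isomorphism between the identity and an endofunctor of a full subcategory. -/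
def fullSubcategoryIso (p : ObjectProperty D) (Φ : p.FullSubcategory ⥤ p.FullSubcategory)
    {Ψ : D ⥤ D} (i : p.ι ⋙ Ψ ≅ Φ ⋙ p.ι) (σ : 𝟭 D ⟶ Ψ) (hσ : ∀ X, p X → IsIso (σ.app X)) :
    𝟭 p.FullSubcategory ≅ Φ :=
  NatIso.ofComponents (fun X => p.isoMk
      (haveI := hσ X.obj X.property
      asIso (σ.app X.obj) ≪≫ i.app X)) fun {X Y} f => p.ι.map_injective (by
    have h1 := i.hom.naturality f
    have h2 := σ.naturality f.hom
    dsimp at h1 h2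
    change f.hom ≫ σ.app Y.obj ≫ i.hom.app Y = (σ.app X.obj ≫ i.hom.app X) ≫ (Φ.map f).hom
    rw [Category.assoc, ← h1, ← Category.assoc, h2, Category.assoc])

/-- Both functors preserve weak equivalences and so descend. The descended transformations need not
be invertible everywhere, only on the two subcategories, which the functors exchange. -/
theorem exists_equivalence_of_localization (L : C ⥤ D) (W : MorphismProperty C)
    [L.IsLocalization W] (L' : C' ⥤ D') (W' : MorphismProperty C') [L'.IsLocalization W']
    (p : ObjectProperty D) [p.IsClosedUnderIsomorphisms] (c : ObjectProperty C')
    {F : C ⥤ C'} {G : C' ⥤ C} (hF : ∀ ⦃M N⦄ (f : M ⟶ N), W f → W' (F.map f))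
    (hG : ∀ ⦃M N⦄ (f : M ⟶ N), W' f → W (G.map f)) (η : 𝟭 C ⟶ F ⋙ G) (θ : 𝟭 C' ⟶ G ⋙ F)
    (hη : ∀ M, p (L.obj M) → W (η.app M)) (hθ : ∀ N, c N → W' (θ.app N))
    (hpc : ∀ M, p (L.obj M) → c (F.obj M)) (hcp : ∀ N, c N → p (L.obj (G.obj N))) :
    ∃ (RF : D ⥤ D') (RG : D' ⥤ D) (e : p.FullSubcategory ≌ (c.map L').FullSubcategory),
      Nonempty (L ⋙ RF ≅ F ⋙ L') ∧ Nonempty (L' ⋙ RG ≅ G ⋙ L) ∧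
      Nonempty (e.functor ⋙ (c.map L').ι ≅ p.ι ⋙ RF) ∧
      Nonempty (e.inverse ⋙ p.ι ≅ (c.map L').ι ⋙ RG) := by
  have := Localization.essSurj L W
  have hF' : W.IsInvertedBy (F ⋙ L') := fun _ _ f hf => Localization.inverts L' W' _ (hF f hf)
  have hG' : W'.IsInvertedBy (G ⋙ L) := fun _ _ f hf => Localization.inverts L W _ (hG f hf)
  let RF := Localization.lift (F ⋙ L') hF' L
  let RG := Localization.lift (G ⋙ L) hG' L'
  let iF : L ⋙ RF ≅ F ⋙ L' := Localization.fac (F ⋙ L') hF' L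
  let iG : L' ⋙ RG ≅ G ⋙ L := Localization.fac (G ⋙ L) hG' L'
  obtain ⟨σ, hσ⟩ := exists_unit_of_localization L W p iF iG η fun X hX =>
    ⟨_, ⟨L.objObjPreimageIso X⟩, Localization.inverts L W _
      (hη _ (p.prop_of_iso (L.objObjPreimageIso X).symm hX))⟩
  obtain ⟨ρ, hρ⟩ := exists_unit_of_localization L' W' (c.map L') iG iF θ fun X ⟨N, hN, i⟩ =>
    ⟨N, i, Localization.inverts L' W' _ (hθ N hN)⟩
  have hRF (X : p.FullSubcategory) : (c.map L') (RF.obj X.obj) :=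
    ⟨F.obj (L.objPreimage X.obj), hpc _ (p.prop_of_iso (L.objObjPreimageIso X.obj).symm X.property),
      ⟨(iF.app _).symm ≪≫ RF.mapIso (L.objObjPreimageIso X.obj)⟩⟩
  have hRG (X : (c.map L').FullSubcategory) : p (RG.obj X.obj) := by
    obtain ⟨N, hN, ⟨i⟩⟩ := X.property
    exact p.prop_of_iso ((iG.app N).symm ≪≫ RG.mapIso i) (hcp N hN)
  let Φ := (c.map L').lift (p.ι ⋙ RF) hRF
  let Ψ := p.lift ((c.map L').ι ⋙ RG) hRG
  exact ⟨RF, RG, CategoryTheory.Equivalence.mk Φ Ψ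
    (fullSubcategoryIso p (Φ ⋙ Ψ) (Iso.refl _) σ hσ)
    (fullSubcategoryIso (c.map L') (Ψ ⋙ Φ) (Iso.refl _) ρ hρ).symm,
    ⟨iF⟩, ⟨iG⟩, ⟨Iso.refl _⟩, ⟨Iso.refl _⟩⟩

end Localizations

end

end BGG

namespace BGG

noncomputable section

open CochainComplex CochainComplex.HomComplex Cx DGModule DerivedCategory

/-! ### The unit -/

section Unit

variable {R : Type u} [CommRing R] {P : CochainComplex (ModuleCat.{u} R) ℤ}
  {κ : DGModule (endDGA R P)} {d : ℤ} {T : ModuleCat.{u} R}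

lemma unitTwist_natural (ν : 𝟭 (ModuleCat.{u} R) ≅ MonoidalCategory.tensorRight T)
    (q : (dgHom R κ ((homModuleFunctor R P).obj (unitCx R))).X d) (hq : q ∈ cyc _ d)
    ⦃M M' : CochainComplex (ModuleCat.{u} R) ℤ⦄ (e : ℤ) (z : (dgHom R M M').X e) :
    dgc (DGCategory.ofHom (unitMap q hq M ≫ (tensorUnit ν _).hom))
      (((homModuleFunctor R P).comp ((homFunctor R κ).comp
        ((shiftDG R d).comp (tensorDG T)))).mapHom e z) (zero_add e) =
      dgc z (DGCategory.ofHom (unitMap q hq M' ≫ (tensorUnit ν _).hom)) (add_zero e) := by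
  refine (congrArg (fun y => dgc y (((homModuleFunctor R P).comp ((homFunctor R κ).comp
        ((shiftDG R d).comp (tensorDG T)))).mapHom e z) (zero_add e))
    (DGCategory.ofHom_comp (unitMap q hq M) (tensorUnit ν _).hom)).trans ?_
  refine (dgc_assoc _ _ _ (add_zero 0) (zero_add e) (zero_add e) (zero_add e)).trans ?_
  refine (congrArg (fun y => dgc (DGCategory.ofHom (unitMap q hq M)) y (zero_add e))
    (tensorUnit_natural ν e ((((homModuleFunctor R P).comp
      (homFunctor R κ)).comp (shiftDG R d)).mapHom e z))).trans ?_
  refine (dgc_assoc _ _ _ (zero_add e) (add_zero e) (add_zero e) (zero_add e)).symm.trans ?_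
  refine (congrArg (fun y => dgc y (DGCategory.ofHom (tensorUnit ν _).hom) (add_zero e))
    (unitMap_natural q hq e z)).trans ?_
  refine (dgc_assoc _ _ _ (add_zero e) (add_zero 0) (add_zero e) (add_zero e)).trans ?_
  exact congrArg (fun y => dgc z y (add_zero e))
    (DGCategory.ofHom_comp (unitMap q hq M') (tensorUnit ν _).hom).symm

/-- The unit of the pair of functors `Hom(P, -)` and `Hom(κ, -)[d] ⊗ T`. -/
def unitTwist (ν : 𝟭 (ModuleCat.{u} R) ≅ MonoidalCategory.tensorRight T)
    (q : (dgHom R κ ((homModuleFunctor R P).obj (unitCx R))).X d) (hq : q ∈ cyc _ d) :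
    (DGFunctor.id R (CochainComplex (ModuleCat.{u} R) ℤ)).toFunctor ⟶
      ((homModuleFunctor R P).comp ((homFunctor R κ).comp
        ((shiftDG R d).comp (tensorDG T)))).toFunctor :=
  DGFunctor.natTrans (fun M => unitMap q hq M ≫ (tensorUnit ν _).hom) (unitTwist_natural ν q hq)

lemma quasiIso_unitTwist (ν : 𝟭 (ModuleCat.{u} R) ≅ MonoidalCategory.tensorRight T)
    (q : (dgHom R κ ((homModuleFunctor R P).obj (unitCx R))).X d) (hq : IsResidueResolution.IsDualizing q) :
    QuasiIso ((unitTwist ν q hq.1.1).app (unitCx R)) := by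
  have : QuasiIso (unitMap q hq.1.1 (unitCx R)) :=
    (quasiIso_unitMap_iff q hq.1.1 (unitCx R)).2 fun n => hq.2 n _ _
  exact inferInstanceAs (QuasiIso (unitMap q hq.1.1 (unitCx R) ≫ (tensorUnit ν _).hom))

lemma quasiIso_tensorDG_map (ν : 𝟭 (ModuleCat.{u} R) ≅ MonoidalCategory.tensorRight T)
    {M N : CochainComplex (ModuleCat.{u} R) ℤ} (f : M ⟶ N) (hf : QuasiIso f) :
    QuasiIso ((tensorDG T).map f) := by
  have h : (tensorDG T).map f = (tensorUnit ν M).inv ≫ f ≫ (tensorUnit ν N).hom := by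
    rw [Iso.eq_inv_comp]
    exact HomologicalComplex.hom_ext _ _ fun n => (ν.hom.naturality (f.f n)).symm
  rw [h]
  infer_instance

lemma quasiIso_twist_map (hκ : KProj R (regular (endDGA R P)) κ)
    (ν : 𝟭 (ModuleCat.{u} R) ≅ MonoidalCategory.tensorRight T) {N N' : DGModule (endDGA R P)}
    (f : N ⟶ N') (hf : quasiIso (endDGA R P) f) :
    QuasiIso (((homFunctor R κ).comp ((shiftDG R d).comp (tensorDG T))).map f) := by
  have : QuasiIso ((homFunctor R κ).map f) :=
    quasiIso_homFunctor_map (DGModule.hasCones _) hκ f ((qis_iff f).2 hf)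
  exact quasiIso_tensorDG_map ν _ ((quasiIso_shift_iff _ d).2 this)

end Unit

/-! ### Complexes with cohomology concentrated in degree zero -/

section Conc

variable {R : Type u} [CommRing R]

lemma isModelOf_iff {A : DGAlgebra R} {M : DGModule A} {L : ModuleCat.{u} R} {B : Type u}
    [AddCommGroup B] [Module R B] (e : B ≃ₗ[R] L) :
    IsModelOf M L ↔ ConcAt R (regular A) M 0 B := by
  rw [IsModelOf, ConcAt, and_comm]
  refine and_congr (forall₂_congr fun n _ => ?_) ⟨fun ⟨i⟩ => ⟨?_⟩, fun ⟨i⟩ => ⟨?_⟩⟩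
  · rw [isZero_homology_iff]
    exact (M.oyH n).symm.toEquiv.subsingleton_congr
  · exact ((M.oyH 0).trans (Hequiv M.cx 0)).trans (i.toLinearEquiv.trans e.symm)
  · exact LinearEquiv.toModuleIso ((((M.oyH 0).trans (Hequiv M.cx 0)).symm.trans i).trans e)

lemma concAt_of_quasiIso {P : CochainComplex (ModuleCat.{u} R) ℤ} {W : ModuleCat.{u} R}
    (ε : P ⟶ (HomologicalComplex.single _ (ComplexShape.up ℤ) 0).obj W) [QuasiIso ε]
    {B : Type u} [AddCommGroup B] [Module R B] (e : B ≃ₗ[R] W) :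
    ConcAt R (unitCx R) P 0 B := by
  refine ⟨fun n hn => ?_, ⟨?_⟩⟩
  · have h1 := (HomologicalComplex.isZero_single_obj_homology (ComplexShape.up ℤ) 0 W n hn).of_iso
      (asIso (HomologicalComplex.homologyMap ε n))
    rw [isZero_homology_iff] at h1
    exact (oyHC P n).toEquiv.subsingleton
  · exact ((oyHC P 0).trans (Hequiv P 0)).trans (((asIso (HomologicalComplex.homologyMap ε 0)).trans
      (HomologicalComplex.singleObjHomologySelfIso (ComplexShape.up ℤ) 0 W)).toLinearEquiv.trans
        e.symm)

lemma smul_idE_single {W : ModuleCat.{u} R} {x : R} (hx : ∀ a : W, x • a = 0) :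
    x • idE R ((HomologicalComplex.single (ModuleCat.{u} R) (ComplexShape.up ℤ) 0).obj W) = 0 := by
  refine Cochain.ext _ _ fun p q hpq => ?_
  by_cases hp : p = 0
  · subst hp
    refine ModuleCat.hom_ext (LinearMap.ext fun a => ?_)
    have i := (HomologicalComplex.singleObjXSelf (ComplexShape.up ℤ) 0 W).toLinearEquiv
    have h (b : ((HomologicalComplex.single (ModuleCat.{u} R) (ComplexShape.up ℤ) 0).obj W).X 0) :
        x • b = 0 := by
      apply i.injective
      rw [map_smul, hx, map_zero]
    have h2 := map_smul (Cochain.v (idE R ((HomologicalComplex.single (ModuleCat.{u} R)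
      (ComplexShape.up ℤ) 0).obj W)) 0 q hpq).hom x a
    rw [h a, map_zero] at h2
    exact h2.symm
  · exact (HomologicalComplex.isZero_single_obj_X (ComplexShape.up ℤ) 0 W p hp).eq_of_src _ _

end Conc

/-! ### The residue field of the completed symmetric algebra -/

section Residue

variable {k : Type u} [Field k] {V : Type u} [AddCommGroup V] [Module k V]

lemma exists_topExterior_iso [FiniteDimensional k V] :
    Nonempty (topExterior k V ≅ ModuleCat.of (CompletedSym k V) (CompletedSym k V)) := by
  have h : Module.finrank k (⋀[k]^(Module.finrank k V) V) = Module.finrank k k := by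
    rw [exteriorPower.finrank_eq, Nat.choose_self, Module.finrank_self]
  exact ⟨LinearEquiv.toModuleIso ((TensorProduct.AlgebraTensorModule.congr
    (LinearEquiv.refl (CompletedSym k V) (CompletedSym k V)) (LinearEquiv.ofFinrankEq _ _ h)).trans
    (TensorProduct.AlgebraTensorModule.rid k (CompletedSym k V) (CompletedSym k V)))⟩

lemma finK_residue : FinK (R := CompletedSym k V) k (residueModule k V) := by
  let f : k →ₗ[k] ((ModuleCat.restrictScalars (algebraMap k (CompletedSym k V))).obj
      (ModuleCat.of (CompletedSym k V) (residueModule k V))) :=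
    { toFun := fun c => (c : k)
      map_add' := fun _ _ => rfl
      map_smul' := fun c a => congrArg (fun b : k => b * a) (augmentation_algebraMap k V c).symm }
  exact Module.Finite.of_surjective f fun a => ⟨a, rfl⟩

/-- A K-projective resolution of the residue field is a residue resolution. -/
lemma exists_isResidueResolution [FiniteDimensional k V] (P : SComplex k V) [P.IsKProjective]
    (ε : P ⟶ (HomologicalComplex.single _ (ComplexShape.up ℤ) 0).obj (residueModule k V))
    [QuasiIso ε] : ∃ L : List (CompletedSym k V), L.length = Module.finrank k V ∧
      Ideal.ofList L = RingHom.ker (augmentation k V) ∧ IsResidueResolution L P := by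
  obtain ⟨L, h1, h2, h3, h4⟩ := exists_parameters k V
  refine ⟨L, h1, h3, h2, h4, ?_, kProj_of_isKProjective P, ?_, fun x hx => ?_⟩
  · rw [h3]
    exact RingHom.ker_isMaximal_of_surjective _ (augmentation_surjective k V)
  · rw [h3]
    exact concAt_of_quasiIso ε (residueEquiv k V)
  · refine smul_idE_mem_bdry hasCones_complex (kProj_of_isKProjective P)
      ((qis_unitCx_iff ε).2 inferInstance) (smul_idE_single fun a => smul_residue_eq_zero k V ?_ a)
    rw [← h3]
    exact Ideal.subset_span hx

/-- The only cohomology is one copy of the residue field, which is one-dimensional over `k`. -/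
lemma IsResidueResolution.coh_unitCx {P : SComplex k V} {L : List (CompletedSym k V)}
    (h : IsResidueResolution L P) (hL : Ideal.ofList L = RingHom.ker (augmentation k V)) :
    Coh (R := CompletedSym k V) k P (unitCx (CompletedSym k V)) := by
  obtain ⟨h1, ⟨e⟩⟩ := h.concAt_unitCx
  rw [hL] at e
  refine ⟨(Set.finite_singleton (L.length : ℤ)).subset fun n hn => ?_, fun n => ?_⟩
  · by_contra hc
    exact hn (h1 n hc)
  · by_cases hn : n = L.length
    · subst hn
      let i := (residueEquiv k V).symm.trans e.symm
      exact finK_residue.of_surjective i.toLinearMap i.surjective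
    · have := h1 n hn
      exact FinK.of_subsingleton

end Residue

end

end BGG
theorem proposition4p9 {k : Type u} [Field k] {V : Type u} [AddCommGroup V] [Module k V]
    [FiniteDimensional k V] [HasDerivedCategory.{v} (ModuleCat.{u} (BGG.CompletedSym k V))]
    (P : BGG.SComplex k V) [P.IsKProjective]
    (ε : P ⟶ (HomologicalComplex.single _ (ComplexShape.up ℤ) 0).obj (BGG.residueModule k V))
    [QuasiIso ε] :
    (∃ κ : BGG.DGModule (BGG.extAlgebra P),
      κ.IsKProjective ∧ BGG.IsModelOf κ (BGG.residueModule k V)) ∧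
    ∀ κ : BGG.DGModule (BGG.extAlgebra P),
      κ.IsKProjective → BGG.IsModelOf κ (BGG.residueModule k V) →
      (∀ M : BGG.SComplex k V, BGG.perfect (BGG.CompletedSym k V) (DerivedCategory.Q.obj M) →
        BGG.IsCoherent k ((BGG.functorF P).obj M)) ∧
      (∀ N : BGG.DGModule (BGG.extAlgebra P), BGG.IsCoherent k N →
        BGG.perfect (BGG.CompletedSym k V) (DerivedCategory.Q.obj ((BGG.functorG κ).obj N))) ∧
      (∃ η : (BGG.DGFunctor.id (BGG.CompletedSym k V) (BGG.SComplex k V)).toFunctor ⟶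
          ((BGG.functorF P).comp (BGG.functorG κ)).toFunctor,
        BGG.DGFunctor.IsDGNatural η ∧
        ∀ M : BGG.SComplex k V, BGG.perfect (BGG.CompletedSym k V) (DerivedCategory.Q.obj M) →
          QuasiIso (η.app M)) ∧
      (∃ θ : (BGG.DGFunctor.id (BGG.CompletedSym k V)
            (BGG.DGModule (BGG.extAlgebra P))).toFunctor ⟶
          ((BGG.functorG κ).comp (BGG.functorF P)).toFunctor,
        BGG.DGFunctor.IsDGNatural θ ∧
        ∀ N : BGG.DGModule (BGG.extAlgebra P), BGG.IsCoherent k N →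
          BGG.DGModule.quasiIso (BGG.extAlgebra P) (θ.app N)) ∧
      (∃ (RF : DerivedCategory (ModuleCat.{u} (BGG.CompletedSym k V)) ⥤
          BGG.DGModule.Derived (BGG.extAlgebra P))
        (RG : BGG.DGModule.Derived (BGG.extAlgebra P) ⥤
          DerivedCategory (ModuleCat.{u} (BGG.CompletedSym k V)))
        (e : (BGG.perfect (BGG.CompletedSym k V)).FullSubcategory ≌
          (BGG.coherent k (BGG.extAlgebra P)).FullSubcategory),
        Nonempty (DerivedCategory.Q ⋙ RF ≅
          (BGG.functorF P).toFunctor ⋙ BGG.DGModule.toDerived (BGG.extAlgebra P)) ∧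
        Nonempty (BGG.DGModule.toDerived (BGG.extAlgebra P) ⋙ RG ≅
          (BGG.functorG κ).toFunctor ⋙ DerivedCategory.Q) ∧
        Nonempty (e.functor ⋙ (BGG.coherent k (BGG.extAlgebra P)).ι ≅
          (BGG.perfect (BGG.CompletedSym k V)).ι ⋙ RF) ∧
        Nonempty (e.inverse ⋙ (BGG.perfect (BGG.CompletedSym k V)).ι ≅
          (BGG.coherent k (BGG.extAlgebra P)).ι ⋙ RG)) := by
  obtain ⟨L, hL, hker, h⟩ := BGG.exists_isResidueResolution P ε
  obtain ⟨i⟩ := BGG.exists_topExterior_iso (k := k) (V := V)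
  obtain ⟨ν⟩ := BGG.exists_tensorRight_iso i
  have hmodel (κ : BGG.DGModule (BGG.extAlgebra P)) : BGG.IsModelOf κ (BGG.residueModule k V) ↔
      BGG.ConcAt (BGG.CompletedSym k V) (BGG.DGModule.regular (BGG.extAlgebra P)) κ 0
        (BGG.CompletedSym k V ⧸ Ideal.ofList L) := by
    rw [hker]
    exact BGG.isModelOf_iff (BGG.residueEquiv k V)
  refine ⟨?_, fun κ hκ hmod => ?_⟩
  · obtain ⟨κ, hκ, hc, -⟩ := h.exists_model
    exact ⟨κ, (BGG.DGModule.kProj_iff κ).1 hκ, (hmodel κ).2 hc⟩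
  have hκ' := (BGG.DGModule.kProj_iff κ).2 hκ
  have hc := (hmodel κ).1 hmod
  obtain ⟨q, hq⟩ : ∃ q : (BGG.dgHom (BGG.CompletedSym k V) κ
      ((BGG.functorF P).obj (BGG.unitCx (BGG.CompletedSym k V)))).X (Module.finrank k V),
      BGG.IsResidueResolution.IsDualizing q := by
    -- The degree `d = dim V` is the length of the regular sequence, which is the degree of the
    -- dualizing class.
    rw [← hL]
    exact (h.exists_generator hκ' hc).2
  have hG ⦃N N' : BGG.DGModule (BGG.extAlgebra P)⦄ (f : N ⟶ N')
      (hf : BGG.DGModule.quasiIso (BGG.extAlgebra P) f) : QuasiIso ((BGG.functorG κ).map f) :=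
    BGG.quasiIso_twist_map hκ' ν f hf
  have hF ⦃M M' : BGG.SComplex k V⦄ (f : M ⟶ M') (hf : QuasiIso f) :
      BGG.DGModule.quasiIso (BGG.extAlgebra P) ((BGG.functorF P).map f) :=
    BGG.quasiIso_homModuleFunctor_map h.kProj f hf
  let η : (BGG.DGFunctor.id (BGG.CompletedSym k V) (BGG.SComplex k V)).toFunctor ⟶
      ((BGG.functorF P).comp (BGG.functorG κ)).toFunctor := BGG.unitTwist ν q hq.1.1
  have hη : BGG.DGFunctor.IsDGNatural η := BGG.unitTwist_natural ν q hq.1.1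
  have hu : QuasiIso (η.app (BGG.unitCx (BGG.CompletedSym k V))) := BGG.quasiIso_unitTwist ν q hq
  have hperf (M : BGG.SComplex k V)
      (hM : BGG.perfect (BGG.CompletedSym k V) (DerivedCategory.Q.obj M)) : QuasiIso (η.app M) :=
    BGG.quasiIso_of_perfect (Φ := (BGG.functorF P).comp (BGG.functorG κ)) η hη
      (fun _ _ f hf => hG _ (hF f hf)) hu M hM
  have hcoh (M : BGG.SComplex k V)
      (hM : BGG.perfect (BGG.CompletedSym k V) (DerivedCategory.Q.obj M)) :
      BGG.IsCoherent k ((BGG.functorF P).obj M) :=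
    (BGG.isCoherent_homModule_iff P M).2 (BGG.coh_of_perfect h.kProj (h.coh_unitCx hker) M hM)
  have hθ (N : BGG.DGModule (BGG.extAlgebra P)) (hN : BGG.IsCoherent k N) :=
    h.counit_of_coherent hκ' hc (BGG.functorG κ) hG η hη hu N hN
  refine ⟨hcoh, fun N hN => (hθ N hN).2, ⟨η, hη, hperf⟩,
    ⟨BGG.counit (BGG.functorG κ) η hη, BGG.counit_natural (BGG.functorG κ) η hη,
      fun N hN => (hθ N hN).1⟩, ?_⟩
  exact BGG.exists_equivalence_of_localization DerivedCategory.Q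
    (HomologicalComplex.quasiIso (ModuleCat.{u} (BGG.CompletedSym k V)) (ComplexShape.up ℤ))
    (BGG.DGModule.toDerived (BGG.extAlgebra P)) (BGG.DGModule.quasiIso (BGG.extAlgebra P))
    (BGG.perfect (BGG.CompletedSym k V)) (BGG.IsCoherent k) (F := (BGG.functorF P).toFunctor)
    (G := (BGG.functorG κ).toFunctor) hF hG η (BGG.counit (BGG.functorG κ) η hη) hperf
    (fun N hN => (hθ N hN).1) hcoh (fun N hN => (hθ N hN).2)
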